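/- Let $-\infty\le b_-<b_+\le+\infty$, let $[b_-,b_+]$ denote the closed interval of real numbers between them, let $\beta>0$ and let $V:[b_-,b_+]\to\mathbb R$ be continuous. For each $\tau\in\{-,+\}$ with $b_\tau=\tau\infty$, assume $\liminf_{x\to\tau\infty}\frac{V(x)}{2\ln|x|}>1$. For an interval $I\subseteq[b_-,b_+]$ set $$Z_N^{V;I}=\int_{I^N}\prod_{i=1}^N e^{-\frac{N\beta}{2}V(\lambda_i)}\prod_{1\le i<j\le N}|\lambda_i-\lambda_j|^\beta\,d\lambda_1\cdots d\lambda_N ,$$ let $\mu_N^{V;I}$ be the corresponding normalized probability measure on $I^N$, and for $n\ge1$ and $x_1,\dots,x_n\in\mathbb C\setminus I$ let $W_n^{V;I}(x_1,\dots,x_n)$ be the joint cumulant under $\mu_N^{V;I}$ of the random variables $\sum_{k=1}^N\frac1{x_i-\lambda_k}$, $1\le i\le n$. Let $\mu_{\rm eq}$ be the equilibrium measure, i.e. the minimizer of $\int V\,d\mu-\iint\ln|\xi-\eta|\,d\mu(\xi)\,d\mu(\eta)$ among probability measures $\mu$ on $[b_-,b_+]$; let $\alpha_-$ and $\alpha_+$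 be the least and the greatest point of its (compact) support. Let $\mathcal J(x)=\frac{V(x)}2-\int\ln|x-\xi|\,d\mu_{\rm eq}(\xi)$ for $x\in[b_-,b_+]$ and $\mathcal J(x)=+\infty$ otherwise, and assume that $\mathcal J$ attains its minimum only at points of $[\alpha_-,\alpha_+]$. There are constants $\gamma_n>0$, depending on $n$ only (not on $\beta,b_\pm,V,\varepsilon,N$ or the $x_i$), such that the following holds. Suppose $b_-<\alpha_-$. Then for every $\varepsilon>0$ there exists $\eta_\varepsilon>0$ such that, writing $I_\varepsilon=[\max(b_-,\alpha_--\varepsilon),\,b_+]$, $$Z_N^{V;[b_-,b_+]}=Z_N^{V;I_\varepsilon}\bigl(1+O(e^{-N\eta_\varepsilon})\bigr)\qquad(N\to\infty),$$ both partition functions being finite and nonzero for all large $N$, and such that for all $N$ larger than some $N_0$ (which does not depend on $n$ or on the $x_i$), all $n\ge1$ and all $x_1,\dots,x_n\in\mathbb C\setminus[b_-,b_+]$, $$\bigl|W_n^{V;[b_-,b_+]}(x_1,\dots,x_n)-W_n^{V;I_\varepsilon}(x_1,\dots,x_n)\bigr|\le\frac{\gamma_n\,e^{-N\eta_\varepsilon}}{\prod_{i=1}^n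 d(x_i,[b_-,b_+])}.$$ Likewise, if $\alpha_+<b_+$, the same statements hold for every $\varepsilon>0$ with $I_\varepsilon=[b_-,\,\min(b_+,\alpha_++\varepsilon)]$. -/

import Mathlib

open MeasureTheory Filter Topology
open scoped ENNReal

noncomputable section

namespace BetaEnsemble

/-- The real points of the interval with (possibly infinite) end points `bl`, `br`. -/
def realInterval (bl br : EReal) : Set ℝ := {x : ℝ | bl ≤ (x : EReal) ∧ (x : EReal) ≤ br}

/-- `log |x - y|`, with the value `-∞` on the diagonal. -/
def logDist (x y : ℝ) : EReal := ENNReal.log (edist x y)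

/-- The integral of an extended-real function, as integral of the positive part minus integral of
the negative part. -/
def extIntegral {X : Type*} [MeasurableSpace X] (μ : Measure X) (f : X → EReal) : EReal :=
  ((∫⁻ x, (f x).toENNReal ∂μ : ℝ≥0∞) : EReal) - ((∫⁻ x, (-f x).toENNReal ∂μ : ℝ≥0∞) : EReal)

/-- The energy `∫ V dμ - ∬ log |ξ - η| dμ(ξ) dμ(η)`, written as the double integral of
`V(ξ)/2 + V(η)/2 - log |ξ - η|`. For a confining potential this integrand is bounded below on
the interval, so the energy is always defined, with values in `(-∞, +∞]`. -/
def energy (V : ℝ → ℝ) (μ : Measure ℝ) : EReal :=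
  extIntegral (μ.prod μ) (fun p => ((V p.1 / 2 + V p.2 / 2 : ℝ) : EReal) - logDist p.1 p.2)

/-- `μ` is an equilibrium measure of `V` on `S`: it minimizes the energy among the probability
measures carried by `S`. -/
def IsEquilibriumMeasure (V : ℝ → ℝ) (S : Set ℝ) (μ : Measure ℝ) : Prop :=
  IsProbabilityMeasure μ ∧ μ Sᶜ = 0 ∧
    ∀ ν : Measure ℝ, IsProbabilityMeasure ν → ν Sᶜ = 0 → energy V μ ≤ energy V ν

open Classical in
/-- The effective potential `V(x)/2 - ∫ log |x - ξ| dμ(ξ)` for `x ∈ S`, and `+∞` elsewhere. -/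
def effPotential (V : ℝ → ℝ) (S : Set ℝ) (μ : Measure ℝ) (x : ℝ) : EReal :=
  if x ∈ S then ((V x / 2 : ℝ) : EReal) - extIntegral μ (fun ξ => logDist x ξ) else ⊤

/-- The unnormalized density `∏ᵢ exp(-NβV(λᵢ)/2) ∏_{i<j} |λᵢ - λⱼ|^β`. -/
def gibbsWeight (N : ℕ) (β : ℝ) (V : ℝ → ℝ) (l : Fin N → ℝ) : ℝ :=
  (∏ i, Real.exp (-((N : ℝ) * β / 2) * V (l i))) *
    ∏ i, ∏ j ∈ Finset.Ioi i, |l i - l j| ^ β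

/-- The unnormalized measure of the `β`-ensemble of `N` eigenvalues in `S`. -/
def gibbsMeasure (N : ℕ) (β : ℝ) (V : ℝ → ℝ) (S : Set ℝ) : Measure (Fin N → ℝ) :=
  (volume.restrict (Set.univ.pi fun _ => S)).withDensity
    fun l => ENNReal.ofReal (gibbsWeight N β V l)

/-- The partition function, a priori possibly infinite. -/
def partitionFunction (N : ℕ) (β : ℝ) (V : ℝ → ℝ) (S : Set ℝ) : ℝ≥0∞ :=
  gibbsMeasure N β V S Set.univ

/-- The `β`-ensemble: the normalized measure. -/
def ensemble (N : ℕ) (β : ℝ) (V : ℝ → ℝ) (S : Set ℝ) : Measure (Fin N → ℝ) :=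
  (partitionFunction N β V S)⁻¹ • gibbsMeasure N β V S

/-- The joint cumulant of `X₁, …, Xₙ`: the sum over set partitions `π` of the indices of
`(-1)^(|π|-1) (|π|-1)! ∏_{B ∈ π} E[∏_{i ∈ B} Xᵢ]`. -/
def jointCumulant {Ω : Type*} [MeasurableSpace Ω] (P : Measure Ω) {n : ℕ}
    (X : Fin n → Ω → ℂ) : ℂ :=
  ∑ π : Finpartition (Finset.univ : Finset (Fin n)),
    (-1 : ℂ) ^ (π.parts.card - 1) * ((π.parts.card - 1).factorial : ℂ) *
      ∏ B ∈ π.parts, ∫ ω, ∏ i ∈ B, X i ω ∂P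

/-- The correlator `Wₙ(x₁, …, xₙ)`: the joint cumulant of the Stieltjes transforms
`∑ₖ 1 / (xᵢ - λₖ)` of the unnormalized empirical measure. -/
def correlator (N : ℕ) (β : ℝ) (V : ℝ → ℝ) (S : Set ℝ) {n : ℕ} (x : Fin n → ℂ) : ℂ :=
  jointCumulant (ensemble N β V S) (fun i l => ∑ k, 1 / (x i - (l k : ℂ)))

/-- Replacing `S` by `S'` changes the partition function by a factor `1 + O(e^{-Nη})` and the
correlators by at most `γₙ e^{-Nη} / ∏ᵢ d(xᵢ, S)` for all large `N`, where all the partition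
functions are finite and nonzero. -/
def ExpClose (γ : ℕ → ℝ) (β : ℝ) (V : ℝ → ℝ) (S S' : Set ℝ) (η : ℝ) : Prop :=
  (∀ᶠ N : ℕ in atTop,
    partitionFunction N β V S ≠ 0 ∧ partitionFunction N β V S ≠ ⊤ ∧
    partitionFunction N β V S' ≠ 0 ∧ partitionFunction N β V S' ≠ ⊤) ∧
  (∃ δ : ℕ → ℝ, δ =O[atTop] (fun N : ℕ => Real.exp (-((N : ℝ) * η))) ∧
    ∀ᶠ N : ℕ in atTop, (partitionFunction N β V S).toReal =
      (partitionFunction N β V S').toReal * (1 + δ N)) ∧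
  (∀ᶠ N : ℕ in atTop, ∀ n : ℕ, 1 ≤ n → ∀ x : Fin n → ℂ,
    (∀ i, x i ∉ Complex.ofReal '' S) →
      ‖correlator N β V S x - correlator N β V S' x‖ ≤
        γ n * Real.exp (-((N : ℝ) * η)) / ∏ i, Metric.infDist (x i) (Complex.ofReal '' S))

end BetaEnsemble

end

/-!
Replacing the interval `S` by a smaller one `S'` amounts to conditioning the `β`-ensemble on having
no point in `S \ S'`. Everything therefore reduces to one estimate, `exists_outlier_decay`: if a
closed set `A ⊆ S` is at a positive distance from the equilibrium measure `μ` and contains no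
minimizer of the effective potential `J`, then the probability that some point lies in `A` is at
most `exp (-N η)`. The partition functions are compared at once, and the cumulants because moments
of bounded variables move little under conditioning (`norm_jointCumulant_sub_cond_le`). The
resolvent traces are bounded by `N / d`, and `eventually_pow_le_mul_exp` absorbs the factor `Nⁿ`
with a constant depending on `n` only, for `N` large uniformly in `n`.

The estimate is obtained without large deviation theory, from the positivity of the logarithmic
energy on neutral signed measures. The kernel `-log |z|` is replaced by `regLog h z`, which follows
the tangent line below the scale `h`. It bounds `-log |z|` from below, is finite on the diagonal,
and is positive semidefinite on neutral combinations of probability measures, with a quadratic form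
decreasing in `h`, being up to a constant a mixture of tent functions (`regForm_nonneg`,
`regForm_anti`). Let `m` be the minimum of `J`.

* Variational facts. `J` is the supremum of its regularizations `regPot h`, so Dini's argument gives
  `regPot h ≥ m - s` on `S` for small `h` (`exists_regPot_ge`), and `regPot h` exceeds `m` by a gap
  growing logarithmically on `A` (`exists_gap`). Smoothing a measure towards the uniform law on a
  fixed interval produces measures on `S` with bounded density and nearly the same energy; testing
  the minimality of `μ` with them gives `∫ V/2 dμ - ∬ log |x - y| dμ dμ ≤ m`
  (`IsEquilibriumMeasure.mean_le`).
* Let `L` be the empirical measure of all points but one. If `L` is far from `μ` in the energy norm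
  of `regLog h`, then by the two inequalities above its energy exceeds the minimum by a fixed amount
  (`energy_ge_of_regDist`), whereas Jensen's inequality bounds the partition function from below in
  terms of the energy of smoothings of `μ` (`partitionFunction_ge`). Such configurations have
  probability `exp (-c N²)`.
* If `L` is close to `μ`, the Cauchy-Schwarz inequality for the energy pairing of `L - μ` with
  `δ_x - ρ`, where `ρ` is a smoothed point mass at a minimizer of `J`, shows that the effective
  potential of `L` at `x ∈ A` exceeds its mean under `ρ` by a fixed amount
  (`regPot_gap_of_regDist_le`). The conditional density of the remaining point is therefore
  exponentially small on `A`, its normalization being bounded from below by Jensen's inequality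
  with respect to `ρ` (`lintegral_pointWeight_le`).
-/

namespace BetaEnsemble

/-! ### The regularized logarithmic kernel -/

/-- The function `-log |z|` for `|z| ≥ h`, continued for `|z| ≤ h` by its tangent line at `h`. -/
noncomputable def regLog (h z : ℝ) : ℝ := 1 - Real.log (max |z| h) - |z| / max |z| h

lemma continuous_regLog {h : ℝ} (hh : 0 < h) : Continuous (regLog h) := by
  have hm : ∀ z : ℝ, max |z| h ≠ 0 := fun z => (lt_max_of_lt_right hh).ne'
  unfold regLog
  fun_prop (disch := exact hm _)

lemma regLog_of_le {h z : ℝ} (hh : 0 < h) (hz : h ≤ |z|) : regLog h z = -Real.log |z| := by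
  have : |z| ≠ 0 := (hh.trans_le hz).ne'
  rw [regLog, max_eq_left hz, div_self this]; ring

lemma regLog_of_ge {h z : ℝ} (hz : |z| ≤ h) : regLog h z = 1 - Real.log h - |z| / h := by
  rw [regLog, max_eq_right hz]

lemma regLog_zero {h : ℝ} (hh : 0 < h) : regLog h 0 = 1 - Real.log h := by
  rw [regLog_of_ge (by simpa using hh.le)]; simp

lemma regLog_le {h : ℝ} (hh : 0 < h) (z : ℝ) : regLog h z ≤ 1 - Real.log h := by
  have h1 : Real.log h ≤ Real.log (max |z| h) := Real.log_le_log hh (le_max_right _ _)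
  have h2 : 0 ≤ |z| / max |z| h := div_nonneg (abs_nonneg _) (le_max_of_le_left (abs_nonneg _))
  unfold regLog; linarith

lemma neg_log_le_regLog {h : ℝ} (hh : 0 < h) (h1 : h ≤ 1) (z : ℝ) :
    -Real.log (1 + |z|) ≤ regLog h z := by
  have hm : 0 < max |z| h := lt_max_of_lt_right hh
  have h2 : |z| / max |z| h ≤ 1 := (div_le_one hm).2 (le_max_left _ _)
  have h3 : Real.log (max |z| h) ≤ Real.log (1 + |z|) :=
    Real.log_le_log hm (max_le (by linarith) (by linarith [abs_nonneg z]))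
  unfold regLog; linarith

lemma regLog_anti {h h' : ℝ} (hh : 0 < h) (hle : h ≤ h') (z : ℝ) : regLog h' z ≤ regLog h z := by
  -- `1 - log m - |z| / m` is decreasing in `m ≥ |z|`
  have key : ∀ m m' : ℝ, 0 < m → m ≤ m' → |z| ≤ m →
      1 - Real.log m' - |z| / m' ≤ 1 - Real.log m - |z| / m := by
    intro m m' hm hmm hz
    have hm' : 0 < m' := hm.trans_le hmm
    have h1 := Real.log_le_sub_one_of_pos (div_pos hm hm')
    rw [Real.log_div hm.ne' hm'.ne'] at h1
    have h2 : |z| / m - |z| / m' ≤ 1 - m / m' := by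
      have : |z| / m - |z| / m' = (|z| / m) * (1 - m / m') := by field_simp
      rw [this]
      have h3 : |z| / m ≤ 1 := (div_le_one hm).2 hz
      have h4 : 0 ≤ 1 - m / m' := by
        have : m / m' ≤ 1 := (div_le_one hm').2 hmm
        linarith
      nlinarith
    linarith
  exact key _ _ (lt_max_of_lt_right hh) (max_le_max_left _ hle) (le_max_left _ _)

lemma regLog_le_neg_log {h z : ℝ} (hh : 0 < h) (hz : z ≠ 0) : regLog h z ≤ -Real.log |z| := by
  have hz' : 0 < |z| := abs_pos.2 hz
  rcases le_total h |z| with h1 | h1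
  · exact (regLog_of_le hh h1).le
  · exact (regLog_anti hz' h1 z).trans (regLog_of_le hz' le_rfl).le

lemma abs_le_exp_neg_regLog {h : ℝ} (hh : 0 < h) (z : ℝ) : |z| ≤ Real.exp (-regLog h z) := by
  rcases eq_or_ne z 0 with rfl | hz
  · simpa using (Real.exp_pos _).le
  · rw [← Real.log_le_iff_le_exp (abs_pos.2 hz)]
    linarith [regLog_le_neg_log hh hz]

lemma regLog_symm (h x y : ℝ) : regLog h (x - y) = regLog h (y - x) := by
  simp only [regLog, abs_sub_comm]

lemma log_one_add_abs_sub_le (x y : ℝ) :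
    Real.log (1 + |x - y|) ≤ Real.log (1 + |x|) + Real.log (1 + |y|) := by
  have hx := abs_nonneg x
  have hy := abs_nonneg y
  rw [← Real.log_mul (by positivity) (by positivity)]
  apply Real.log_le_log (by positivity)
  have := abs_sub x y
  nlinarith [mul_nonneg hx hy]

lemma log_one_add_abs_nonneg (x : ℝ) : 0 ≤ Real.log (1 + |x|) :=
  Real.log_nonneg (by linarith [abs_nonneg x])

lemma neg_log_add_le_regLog {h : ℝ} (hh : 0 < h) (h1 : h ≤ 1) (x y : ℝ) :
    -(Real.log (1 + |x|) + Real.log (1 + |y|)) ≤ regLog h (x - y) :=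
  (neg_le_neg (log_one_add_abs_sub_le x y)).trans (neg_log_le_regLog hh h1 _)

/-! ### Positivity of the kernel on neutral combinations of measures -/

lemma integrable_of_continuous_of_ae_mem {X : Type*} [TopologicalSpace X] [MeasurableSpace X]
    [OpensMeasurableSpace X] {P : Measure X} [IsFiniteMeasure P] {f : X → ℝ}
    (hf : Continuous f) {K : Set X} (hK : IsCompact K) (hP : ∀ᵐ x ∂P, x ∈ K) :
    Integrable f P := by
  obtain ⟨C, hC⟩ := hK.exists_bound_of_continuousOn hf.continuousOn
  exact Integrable.of_bound hf.measurable.aestronglyMeasurable C (hP.mono fun x hx => hC x hx)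

lemma ae_prod_mem {X Y : Type*} [MeasurableSpace X] [MeasurableSpace Y] {P : Measure X}
    {Q : Measure Y} [SFinite P] [SFinite Q] {A : Set X} {B : Set Y} (hP : ∀ᵐ x ∂P, x ∈ A)
    (hQ : ∀ᵐ y ∂Q, y ∈ B) : ∀ᵐ p ∂(P.prod Q), p ∈ A ×ˢ B := by
  have h1 : ∀ᵐ p ∂(P.prod Q), p.1 ∈ A := Measure.quasiMeasurePreserving_fst.ae hP
  have h2 : ∀ᵐ p ∂(P.prod Q), p.2 ∈ B := Measure.quasiMeasurePreserving_snd.ae hQ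
  filter_upwards [h1, h2] with p h1 h2 using ⟨h1, h2⟩

/-- A kernel that is a mixture of products `φ(ω, x) φ(ω, y)` is positive semidefinite on
signed combinations of probability measures. -/
lemma mixture_nonneg {Ω ι : Type*} [MeasurableSpace Ω] [Fintype ι] (ω : Measure Ω)
    [IsFiniteMeasure ω] {φ : Ω → ℝ → ℝ} (hφ : Measurable (Function.uncurry φ)) {C : ℝ}
    (hC : ∀ w x, |φ w x| ≤ C) (P : ι → Measure ℝ) [∀ i, IsProbabilityMeasure (P i)]
    (c : ι → ℝ) {k : ℝ → ℝ → ℝ} {K : Set ℝ} (hP : ∀ i, ∀ᵐ x ∂(P i), x ∈ K)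
    (hk : ∀ x ∈ K, ∀ y ∈ K, k x y = ∫ w, φ w x * φ w y ∂ω) :
    0 ≤ ∑ i, ∑ j, c i * c j * ∫ x, ∫ y, k x y ∂(P j) ∂(P i) := by
  have hφx : ∀ w, Measurable (φ w) := fun w => hφ.comp (measurable_const.prodMk measurable_id)
  have hφw : ∀ x, Measurable fun w => φ w x := fun x =>
    hφ.comp (measurable_id.prodMk measurable_const)
  have hsm : ∀ i, StronglyMeasurable fun w => ∫ x, φ w x ∂(P i) := fun i =>
    hφ.stronglyMeasurable.integral_prod_right
  have hbd : ∀ i w, |∫ x, φ w x ∂(P i)| ≤ C := by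
    intro i w
    have := norm_integral_le_of_norm_le_const (μ := P i) (f := φ w) (C := C)
      (Eventually.of_forall fun x => hC w x)
    simpa using this
  have hint2 : ∀ i j, Integrable (fun w => (∫ x, φ w x ∂(P i)) * ∫ x, φ w x ∂(P j)) ω := by
    intro i j
    refine Integrable.of_bound ((hsm i).mul (hsm j)).aestronglyMeasurable (C * C)
      (Eventually.of_forall fun w => ?_)
    rw [norm_mul]
    exact mul_le_mul (hbd i w) (hbd j w) (norm_nonneg _) ((abs_nonneg _).trans (hbd i w))
  have hswap : ∀ i j, ∫ x, ∫ y, k x y ∂(P j) ∂(P i)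
      = ∫ w, (∫ x, φ w x ∂(P i)) * (∫ x, φ w x ∂(P j)) ∂ω := by
    intro i j
    have h1 : ∫ x, ∫ y, k x y ∂(P j) ∂(P i)
        = ∫ x, ∫ w, φ w x * (∫ y, φ w y ∂(P j)) ∂ω ∂(P i) := by
      refine integral_congr_ae ((hP i).mono fun x hx => ?_)
      have h2 : ∫ y, k x y ∂(P j) = ∫ y, ∫ w, φ w x * φ w y ∂ω ∂(P j) :=
        integral_congr_ae ((hP j).mono fun y hy => hk x hx y hy)
      dsimp only
      rw [h2, integral_integral_swap]
      · simp_rw [integral_const_mul]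
      · refine Integrable.of_bound (C := C * C) ?_ (Eventually.of_forall fun p => ?_)
        · exact (((hφw x).comp measurable_snd).mul
            (hφ.comp measurable_swap)).aestronglyMeasurable
        · simp only [Function.uncurry, norm_mul]
          exact mul_le_mul (hC _ _) (hC _ _) (norm_nonneg _) ((abs_nonneg _).trans (hC p.2 x))
    rw [h1, integral_integral_swap]
    · simp_rw [integral_mul_const]
    · refine Integrable.of_bound (C := C * C) ?_ (Eventually.of_forall fun p => ?_)
      · exact ((hφ.comp measurable_swap).mul
          ((hsm j).measurable.comp measurable_snd)).aestronglyMeasurable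
      · simp only [Function.uncurry, norm_mul]
        exact mul_le_mul (hC _ _) (hbd _ _) (norm_nonneg _) ((abs_nonneg _).trans (hC p.2 p.1))
  have : ∑ i, ∑ j, c i * c j * ∫ x, ∫ y, k x y ∂(P j) ∂(P i)
      = ∫ w, (∑ i, c i * ∫ x, φ w x ∂(P i)) ^ 2 ∂ω := by
    have hexp : ∀ w, (∑ i, c i * ∫ x, φ w x ∂(P i)) ^ 2
        = ∑ i, ∑ j, c i * c j * ((∫ x, φ w x ∂(P i)) * ∫ x, φ w x ∂(P j)) := by
      intro w
      rw [sq, Finset.sum_mul_sum]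
      refine Finset.sum_congr rfl fun i _ => Finset.sum_congr rfl fun j _ => by ring
    simp_rw [hexp, hswap]
    rw [integral_finsetSum _ fun i _ =>
      integrable_finsetSum _ fun j _ => (hint2 i j).const_mul (c i * c j)]
    refine Finset.sum_congr rfl fun i _ => ?_
    rw [integral_finsetSum _ fun j _ => (hint2 i j).const_mul (c i * c j)]
    refine Finset.sum_congr rfl fun j _ => ?_
    rw [integral_const_mul]
  rw [this]
  exact integral_nonneg fun w => sq_nonneg _

/-- The indicator of the window `[u, u + s]`. -/
noncomputable def window (s u x : ℝ) : ℝ := if u ≤ x ∧ x ≤ u + s then 1 else 0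

lemma measurable_window : Measurable fun p : ℝ × ℝ × ℝ => window p.1 p.2.1 p.2.2 := by
  refine Measurable.ite ?_ measurable_const measurable_const
  exact (measurableSet_le (f := fun p : ℝ × ℝ × ℝ => p.2.1) (g := fun p => p.2.2)
    (by fun_prop) (by fun_prop)).inter
    (measurableSet_le (f := fun p : ℝ × ℝ × ℝ => p.2.2) (g := fun p => p.2.1 + p.1)
      (by fun_prop) (by fun_prop))

lemma abs_window_le (s u x : ℝ) : |window s u x| ≤ 1 := by
  unfold window; split_ifs <;> simp

/-- The tent function is the self-convolution of a window. -/
lemma integral_window_mul {M s x y b : ℝ} (hx : |x| ≤ M) (hb : s ≤ b) :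
    ∫ u in Set.Icc (-M - b) M, window s u x * window s u y = max 0 (s - |x - y|) := by
  have h1 : (fun u => window s u x * window s u y)
      = Set.indicator (Set.Icc (max x y - s) (min x y)) (fun _ => (1 : ℝ)) := by
    ext u
    simp only [window, Set.indicator, Set.mem_Icc, le_min_iff, tsub_le_iff_right, max_le_iff]
    by_cases h1 : u ≤ x ∧ x ≤ u + s <;> by_cases h2 : u ≤ y ∧ y ≤ u + s <;>
      simp only [h1, h2, and_self, if_true, if_false, mul_one, mul_zero] <;> grind
  rw [h1, setIntegral_indicator measurableSet_Icc, Set.inter_eq_right.2]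
  · simp only [integral_const, smul_eq_mul, mul_one, measureReal_restrict_apply_univ,
      Real.volume_real_Icc]
    rw [max_comm, max_sub_min_eq_abs' x y |>.symm]
    congr 1; ring
  · rw [abs_le] at hx
    intro u hu
    have h3 := le_max_left x y
    have h4 := min_le_left x y
    exact ⟨by linarith [hu.1], by linarith [hu.2]⟩

/-- Differentiating the regularized kernel in the regularization scale produces tents. -/
lemma regLog_sub_eq_integral {h R z : ℝ} (hh : 0 < h) (hR : h ≤ R) :
    regLog h z - regLog R z = ∫ s in h..R, max 0 (s - |z|) / s ^ 2 := by
  have hcont : ContinuousOn (fun s => regLog s z) (Set.Icc h R) := by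
    intro s hs
    have hm : max |z| s ≠ 0 := (lt_max_of_lt_right (hh.trans_le hs.1)).ne'
    unfold regLog
    apply ContinuousAt.continuousWithinAt
    fun_prop (disch := exact hm)
  have hcont' : ContinuousOn (fun s : ℝ => -(max 0 (s - |z|) / s ^ 2)) (Set.Icc h R) := by
    intro s hs
    have hm : s ^ 2 ≠ 0 := pow_ne_zero _ (hh.trans_le hs.1).ne'
    apply ContinuousAt.continuousWithinAt
    fun_prop (disch := exact hm)
  have key : ∫ s in h..R, -(max 0 (s - |z|) / s ^ 2) = regLog R z - regLog h z := by
    refine integral_eq_of_hasDerivAt_off_countable_of_le (fun s => regLog s z) _ hR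
      (Set.countable_singleton |z|) hcont ?_ ?_
    · rintro s ⟨hs, hsz⟩
      have hs0 : 0 < s := hh.trans hs.1
      rcases lt_or_gt_of_ne hsz with hlt | hgt
      · have h1 : (fun t => regLog t z) =ᶠ[𝓝 s] fun _ => -Real.log |z| := by
          filter_upwards [Ioo_mem_nhds hs0 hlt] with t ht
          exact regLog_of_le ht.1 ht.2.le
        rw [max_eq_left (by linarith)]
        simpa using (hasDerivAt_const s (-Real.log |z|)).congr_of_eventuallyEq h1
      · have h1 : (fun t => regLog t z) =ᶠ[𝓝 s] fun t => 1 - Real.log t - |z| * t⁻¹ := by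
          filter_upwards [Ioi_mem_nhds hgt] with t ht
          rw [regLog_of_ge (le_of_lt ht), div_eq_mul_inv]
        rw [max_eq_right (by linarith [show |z| < s from hgt])]
        refine HasDerivAt.congr_of_eventuallyEq ?_ h1
        have h2 := (((hasDerivAt_const s (1 : ℝ)).sub (Real.hasDerivAt_log hs0.ne')).sub
          ((hasDerivAt_inv hs0.ne').const_mul |z|))
        refine h2.congr_deriv ?_
        field_simp; ring
    · exact hcont'.intervalIntegrable_of_Icc hR
  rw [intervalIntegral.integral_neg] at key
  linarith

section RegForm

variable {ι : Type*} [Fintype ι]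

/-- The quadratic form of the regularized kernel on `∑ᵢ cᵢ Pᵢ`. -/
noncomputable def regForm (h : ℝ) (P : ι → Measure ℝ) (c : ι → ℝ) : ℝ :=
  ∑ i, ∑ j, c i * c j * ∫ x, ∫ y, regLog h (x - y) ∂(P j) ∂(P i)

lemma integrable_regLog {h M M' : ℝ} (hh : 0 < h) {P Q : Measure ℝ} [IsProbabilityMeasure P]
    [IsProbabilityMeasure Q] (hP : ∀ᵐ x ∂P, |x| ≤ M) (hQ : ∀ᵐ x ∂Q, |x| ≤ M') :
    Integrable (fun p : ℝ × ℝ => regLog h (p.1 - p.2)) (P.prod Q) := by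
  refine integrable_of_continuous_of_ae_mem (K := Set.Icc (-M) M ×ˢ Set.Icc (-M') M')
    ((continuous_regLog hh).comp (by fun_prop)) (isCompact_Icc.prod isCompact_Icc) ?_
  exact ae_prod_mem (hP.mono fun x hx => abs_le.1 hx) (hQ.mono fun x hx => abs_le.1 hx)

lemma integrable_regLog_right {h M : ℝ} (hh : 0 < h) {Q : Measure ℝ}
    [IsProbabilityMeasure Q] (hQ : ∀ᵐ x ∂Q, |x| ≤ M) (x : ℝ) :
    Integrable (fun y : ℝ => regLog h (x - y)) Q :=
  integrable_of_continuous_of_ae_mem (K := Set.Icc (-M) M)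
    ((continuous_regLog hh).comp (by fun_prop)) isCompact_Icc (hQ.mono fun x hx => abs_le.1 hx)

lemma regForm_anti {h h' M : ℝ} (hh : 0 < h) (hle : h ≤ h') (P : ι → Measure ℝ)
    [∀ i, IsProbabilityMeasure (P i)] (hP : ∀ i, ∀ᵐ x ∂(P i), |x| ≤ M) (c : ι → ℝ) :
    regForm h' P c ≤ regForm h P c := by
  -- `regLog h - regLog h'` is a mixture of tents of widths between `h` and `h'`
  have key := mixture_nonneg (Ω := ℝ × ℝ)
    ((volume.restrict (Set.Ioc h h')).prod (volume.restrict (Set.Icc (-M - h') M)))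
    (φ := fun w x => window w.1 w.2 x / max w.1 h) (C := 1 / h)
    (by
      refine Measurable.div ?_ (by fun_prop)
      exact measurable_window.comp
        ((measurable_fst.comp measurable_fst).prodMk
          ((measurable_snd.comp measurable_fst).prodMk measurable_snd)))
    (by
      intro w x
      rw [abs_div, abs_of_pos (lt_max_of_lt_right hh)]
      exact div_le_div₀ zero_le_one (abs_window_le _ _ _) hh (le_max_right _ _))
    P c (k := fun x y => regLog h (x - y) - regLog h' (x - y)) (K := {x | |x| ≤ M}) hP
    (by
      intro x hx y hy
      rw [regLog_sub_eq_integral hh hle, intervalIntegral.integral_of_le hle, integral_prod]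
      · refine setIntegral_congr_fun measurableSet_Ioc fun s hs => ?_
        dsimp only
        rw [← integral_window_mul hx hs.2, max_eq_left hs.1.le, ← integral_div]
        refine integral_congr_ae (Eventually.of_forall fun u => ?_)
        dsimp only
        field_simp
      · refine Integrable.of_bound (C := 1 / h * (1 / h)) ?_ (Eventually.of_forall fun w => ?_)
        · refine (Measurable.mul ?_ ?_).aestronglyMeasurable
          all_goals
            refine Measurable.div ?_ (by fun_prop)
            exact measurable_window.comp
              (measurable_fst.prodMk (measurable_snd.prodMk measurable_const))
        · have : ∀ x, ‖window w.1 w.2 x / max w.1 h‖ ≤ 1 / h := fun x => by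
            rw [norm_div, Real.norm_eq_abs, Real.norm_eq_abs, abs_of_pos (lt_max_of_lt_right hh)]
            exact div_le_div₀ zero_le_one (abs_window_le _ _ _) hh (le_max_right _ _)
          rw [norm_mul]
          exact mul_le_mul (this x) (this y) (norm_nonneg _) (by positivity))
  have hsub : ∀ i j, ∫ x, ∫ y, (regLog h (x - y) - regLog h' (x - y)) ∂(P j) ∂(P i)
      = (∫ x, ∫ y, regLog h (x - y) ∂(P j) ∂(P i))
        - ∫ x, ∫ y, regLog h' (x - y) ∂(P j) ∂(P i) := by
    intro i j
    have h1 := integrable_regLog hh (hP i) (hP j)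
    have h2 := integrable_regLog (hh.trans_le hle) (hP i) (hP j)
    exact integral_integral_sub h1 h2
  simp_rw [hsub, mul_sub, Finset.sum_sub_distrib] at key
  unfold regForm
  linarith

/-- The regularized kernel is positive semidefinite on neutral combinations of probability
measures with bounded support: on a bounded set it is a mixture of tents plus a constant. -/
lemma regForm_nonneg {h M : ℝ} (hh : 0 < h) (P : ι → Measure ℝ)
    [∀ i, IsProbabilityMeasure (P i)] (hP : ∀ i, ∀ᵐ x ∂(P i), |x| ≤ M) (c : ι → ℝ)
    (hc : ∑ i, c i = 0) : 0 ≤ regForm h P c := by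
  set R := max h (2 * M) with hRdef
  have hR : 0 < R := lt_max_of_lt_left hh
  refine le_trans ?_ (regForm_anti hh (le_max_left h (2 * M)) P hP c)
  rw [← hRdef]
  have key := mixture_nonneg (Ω := ℝ) (volume.restrict (Set.Icc (-M - R) M))
    (φ := fun w x => window R w x) (C := 1)
    (measurable_window.comp (measurable_const.prodMk measurable_id))
    (fun w x => abs_window_le _ _ _)
    P c (k := fun x y => R * (regLog R (x - y) + Real.log R)) (K := {x | |x| ≤ M}) hP
    (by
      intro x hx y hy
      rw [integral_window_mul hx le_rfl]
      have h2 : |x - y| ≤ R := by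
        have := abs_sub x y
        have h3 : |x| ≤ M := hx
        have h4 : |y| ≤ M := hy
        have h5 : 2 * M ≤ R := le_max_right _ _
        linarith
      rw [regLog_of_ge h2, max_eq_right (by linarith)]
      field_simp; ring)
  have hadd : ∀ i j, ∫ x, ∫ y, R * (regLog R (x - y) + Real.log R) ∂(P j) ∂(P i)
      = R * ((∫ x, ∫ y, regLog R (x - y) ∂(P j) ∂(P i)) + Real.log R) := by
    intro i j
    simp_rw [integral_const_mul]
    have h1 := integrable_regLog hR (hP i) (hP j)
    rw [integral_integral_add h1 (integrable_const _)]
    simp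
  have hsum : ∑ i, ∑ j, c i * c j * (R * Real.log R) = 0 := by
    simp_rw [← Finset.sum_mul, ← Finset.mul_sum, ← Finset.sum_mul, hc]; simp
  have heq : ∑ i, ∑ j, c i * c j * ∫ x, ∫ y, R * (regLog R (x - y) + Real.log R) ∂(P j) ∂(P i)
      = R * regForm R P c := by
    rw [← add_zero (R * _), ← hsum, regForm, Finset.mul_sum, ← Finset.sum_add_distrib]
    refine Finset.sum_congr rfl fun i _ => ?_
    rw [Finset.mul_sum, ← Finset.sum_add_distrib]
    refine Finset.sum_congr rfl fun j _ => ?_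
    rw [hadd]; ring
  rw [heq] at key
  exact (mul_nonneg_iff_of_pos_left hR).1 key

end RegForm

/-! ### Extended-real integrals of the logarithm -/

section ExtIntegral

variable {X : Type*} [MeasurableSpace X] {μ : Measure X}

lemma extIntegral_of_ae_eq {f : X → EReal} {g : X → ℝ} (hg : Integrable g μ)
    (h : ∀ᵐ x ∂μ, f x = (g x : EReal)) : extIntegral μ f = ((∫ x, g x ∂μ : ℝ) : EReal) := by
  have h1 : ∫⁻ x, (f x).toENNReal ∂μ = ∫⁻ x, ENNReal.ofReal (g x) ∂μ :=
    lintegral_congr_ae (h.mono fun x hx => by simp only [hx, EReal.real_coe_toENNReal])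
  have h2 : ∫⁻ x, (-f x).toENNReal ∂μ = ∫⁻ x, ENNReal.ofReal (-g x) ∂μ :=
    lintegral_congr_ae (h.mono fun x hx => by
      simp only [hx, ← EReal.coe_neg, EReal.real_coe_toENNReal])
  have h3 := hg.lintegral_lt_top.ne
  have h4 := hg.neg.lintegral_lt_top.ne
  simp only [Pi.neg_apply] at h4
  rw [extIntegral, h1, h2, integral_eq_lintegral_pos_part_sub_lintegral_neg_part hg,
    EReal.coe_sub, EReal.coe_ennreal_toReal h3, EReal.coe_ennreal_toReal h4]

lemma ae_eq_toReal_of_lintegral_ne_top {f : X → EReal} (hf : Measurable f)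
    (hp : ∫⁻ x, (f x).toENNReal ∂μ ≠ ⊤) (hn : ∫⁻ x, (-f x).toENNReal ∂μ ≠ ⊤) :
    (∀ᵐ x ∂μ, f x ≠ ⊤ ∧ f x ≠ ⊥) ∧ Integrable (fun x => (f x).toReal) μ := by
  have hm : Measurable fun x => (f x).toENNReal := measurable_ereal_toENNReal.comp hf
  have hm' : Measurable fun x => (-f x).toENNReal := measurable_ereal_toENNReal.comp hf.neg
  have hae : ∀ᵐ x ∂μ, f x ≠ ⊤ ∧ f x ≠ ⊥ := by
    filter_upwards [ae_lt_top hm hp, ae_lt_top hm' hn] with x h1 h2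
    constructor
    · intro h; simp [h] at h1
    · intro h; simp [h] at h2
  refine ⟨hae, ?_⟩
  have h1 := integrable_toReal_of_lintegral_ne_top hm.aemeasurable hp
  have h2 := integrable_toReal_of_lintegral_ne_top hm'.aemeasurable hn
  refine (h1.sub h2).congr (hae.mono fun x hx => ?_)
  obtain ⟨r, hr⟩ : ∃ r : ℝ, f x = r := ⟨(f x).toReal, (EReal.coe_toReal hx.1 hx.2).symm⟩
  simp only [Pi.sub_apply, hr, ← EReal.coe_neg, EReal.real_coe_toENNReal, EReal.toReal_coe]
  rcases le_total 0 r with h | h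
  · rw [ENNReal.toReal_ofReal h, ENNReal.ofReal_of_nonpos (by linarith)]; simp
  · rw [ENNReal.toReal_ofReal (by linarith : 0 ≤ -r), ENNReal.ofReal_of_nonpos h]; simp

end ExtIntegral

lemma logDist_of_ne {x y : ℝ} (h : x ≠ y) : logDist x y = (Real.log |x - y| : EReal) := by
  rw [logDist, edist_dist, Real.dist_eq, ENNReal.log_ofReal_of_pos (abs_pos.2 (sub_ne_zero.2 h))]

lemma logDist_self (x : ℝ) : logDist x x = ⊥ := by simp [logDist]

lemma measurable_logDist : Measurable fun p : ℝ × ℝ => logDist p.1 p.2 :=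
  ENNReal.measurable_log.comp measurable_edist

lemma measurable_log_abs_sub : Measurable fun p : ℝ × ℝ => Real.log |p.1 - p.2| := by fun_prop

lemma logDist_le (x y : ℝ) :
    logDist x y ≤ ((Real.log (1 + |x|) + Real.log (1 + |y|) : ℝ) : EReal) := by
  rcases eq_or_ne x y with rfl | h
  · simp [logDist_self]
  · rw [logDist_of_ne h, EReal.coe_le_coe_iff]
    refine le_trans (Real.log_le_log (abs_pos.2 (sub_ne_zero.2 h)) ?_)
      (log_one_add_abs_sub_le x y)
    linarith

lemma log_one_add_abs_le {x M : ℝ} (h : |x| ≤ M) : Real.log (1 + |x|) ≤ Real.log (1 + M) :=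
  Real.log_le_log (by positivity) (by linarith)

/-- The pair of measures has a finite mutual logarithmic energy: the logarithm of the distance is
finite almost everywhere and integrable. -/
def LogFinite (μ ν : Measure ℝ) : Prop :=
  (∀ᵐ p ∂(μ.prod ν), p.1 ≠ p.2) ∧ Integrable (fun p : ℝ × ℝ => Real.log |p.1 - p.2|) (μ.prod ν)

/-! ### The effective potential and its regularization -/

lemma effPotential_of_integrable {V : ℝ → ℝ} {S : Set ℝ} {μ : Measure ℝ} {x : ℝ} (hx : x ∈ S)
    (hne : ∀ᵐ ξ ∂μ, x ≠ ξ) (hint : Integrable (fun ξ => Real.log |x - ξ|) μ) :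
    effPotential V S μ x = ((V x / 2 - ∫ ξ, Real.log |x - ξ| ∂μ : ℝ) : EReal) := by
  rw [effPotential, if_pos hx, extIntegral_of_ae_eq hint (hne.mono fun ξ h => logDist_of_ne h),
    EReal.coe_sub]

section Potential

variable {V : ℝ → ℝ} {S : Set ℝ} {μ : Measure ℝ} [IsProbabilityMeasure μ] {M : ℝ}

/-- The effective potential with the logarithm replaced by its regularization. -/
noncomputable def regPot (h : ℝ) (V : ℝ → ℝ) (μ : Measure ℝ) (x : ℝ) : ℝ :=
  V x / 2 + ∫ ξ, regLog h (x - ξ) ∂μ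

lemma continuous_regPot {h : ℝ} (hh : 0 < h) (hV : Continuous V) (hμ : ∀ᵐ ξ ∂μ, |ξ| ≤ M) :
    Continuous (regPot h V μ) := by
  have h1 : μ.restrict (Set.Icc (-M) M) = μ :=
    Measure.restrict_eq_self_of_ae_mem (hμ.mono fun x hx => abs_le.1 hx)
  have h2 := continuous_parametric_integral_of_continuous (μ := μ)
    (f := fun x ξ : ℝ => regLog h (x - ξ))
    ((continuous_regLog hh).comp (by fun_prop)) (isCompact_Icc (a := -M) (b := M))
  rw [h1] at h2
  unfold regPot
  fun_prop

lemma regPot_anti {h h' : ℝ} (hh : 0 < h) (hle : h ≤ h') (hμ : ∀ᵐ ξ ∂μ, |ξ| ≤ M) (x : ℝ) :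
    regPot h' V μ x ≤ regPot h V μ x := by
  have := integral_mono (integrable_regLog_right (hh.trans_le hle) hμ x)
    (integrable_regLog_right hh hμ x) fun ξ => regLog_anti hh hle (x - ξ)
  unfold regPot; linarith

lemma le_regPot {h : ℝ} (hh : 0 < h) (h1 : h ≤ 1) (hμ : ∀ᵐ ξ ∂μ, |ξ| ≤ M) (x : ℝ) :
    V x / 2 - Real.log (1 + |x|) - Real.log (1 + M) ≤ regPot h V μ x := by
  have := integral_mono_ae (integrable_const (-(Real.log (1 + |x|) + Real.log (1 + M))))
    (integrable_regLog_right hh hμ x) (hμ.mono fun ξ hξ => by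
      have := neg_log_add_le_regLog hh h1 x ξ
      have := log_one_add_abs_le hξ
      dsimp only
      linarith)
  simp only [integral_const, probReal_univ, one_smul] at this
  unfold regPot; linarith

lemma lintegral_logDist_toENNReal_ne_top (hμ : ∀ᵐ ξ ∂μ, |ξ| ≤ M) (x : ℝ) :
    ∫⁻ ξ, (logDist x ξ).toENNReal ∂μ ≠ ⊤ := by
  refine ne_top_of_le_ne_top (b := ENNReal.ofReal (Real.log (1 + |x|) + Real.log (1 + M)))
    ENNReal.ofReal_ne_top ?_
  calc ∫⁻ ξ, (logDist x ξ).toENNReal ∂μ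
      ≤ ∫⁻ _, ENNReal.ofReal (Real.log (1 + |x|) + Real.log (1 + M)) ∂μ := by
        refine lintegral_mono_ae (hμ.mono fun ξ hξ => ?_)
        rw [← EReal.real_coe_toENNReal]
        refine EReal.toENNReal_le_toENNReal ((logDist_le x ξ).trans ?_)
        rw [EReal.coe_le_coe_iff]
        linarith [log_one_add_abs_le hξ]
    _ = _ := by simp

lemma of_effPotential_ne_top (hμ : ∀ᵐ ξ ∂μ, |ξ| ≤ M) {x : ℝ}
    (h : effPotential V S μ x ≠ ⊤) :
    x ∈ S ∧ (∀ᵐ ξ ∂μ, x ≠ ξ) ∧ Integrable (fun ξ => Real.log |x - ξ|) μ := by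
  have hx : x ∈ S := by
    by_contra hx
    exact h (if_neg hx)
  have hp := lintegral_logDist_toENNReal_ne_top hμ x
  have hn : ∫⁻ ξ, (-logDist x ξ).toENNReal ∂μ ≠ ⊤ := by
    intro hn
    apply h
    rw [effPotential, if_pos hx, extIntegral, hn, ← EReal.coe_ennreal_toReal hp]
    rfl
  have hm : Measurable fun ξ => logDist x ξ := measurable_logDist.comp measurable_prodMk_left
  obtain ⟨h1, h2⟩ := ae_eq_toReal_of_lintegral_ne_top hm hp hn
  have hne : ∀ᵐ ξ ∂μ, x ≠ ξ := h1.mono fun ξ hξ hxe => hξ.2 (hxe ▸ logDist_self x)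
  refine ⟨hx, hne, h2.congr (hne.mono fun ξ hξ => ?_)⟩
  simp [logDist_of_ne hξ]

lemma regPot_le_of_integrable {h : ℝ} (hh : 0 < h) (hμ : ∀ᵐ ξ ∂μ, |ξ| ≤ M) {x : ℝ}
    (hne : ∀ᵐ ξ ∂μ, x ≠ ξ) (hint : Integrable (fun ξ => Real.log |x - ξ|) μ) :
    regPot h V μ x ≤ V x / 2 - ∫ ξ, Real.log |x - ξ| ∂μ := by
  have := integral_mono_ae (integrable_regLog_right hh hμ x) hint.neg (hne.mono fun ξ hξ =>
    regLog_le_neg_log hh (sub_ne_zero.2 hξ))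
  simp only [Pi.neg_apply, integral_neg] at this
  unfold regPot; linarith

lemma regPot_le_effPotential {h : ℝ} (hh : 0 < h) (hμ : ∀ᵐ ξ ∂μ, |ξ| ≤ M) (x : ℝ) :
    (regPot h V μ x : EReal) ≤ effPotential V S μ x := by
  by_cases htop : effPotential V S μ x = ⊤
  · simp [htop]
  · obtain ⟨hx, hne, hint⟩ := of_effPotential_ne_top hμ htop
    rw [effPotential_of_integrable hx hne hint, EReal.coe_le_coe_iff]
    exact regPot_le_of_integrable hh hμ hne hint

/-- Monotone convergence: a uniform bound on the regularized effective potentials at a point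
bounds the effective potential there. -/
lemma effPotential_le_of_regPot_le (hμ : ∀ᵐ ξ ∂μ, |ξ| ≤ M) {x B : ℝ} (hx : x ∈ S)
    (hB : ∀ n : ℕ, regPot (1 / ((n : ℝ) + 1)) V μ x ≤ B) :
    effPotential V S μ x ≤ (B : EReal) := by
  set c := Real.log (1 + |x|) + Real.log (1 + M) with hc
  set e : ℕ → ℝ := fun n => 1 / ((n : ℝ) + 1) with he
  have he0 : ∀ n, 0 < e n := fun n => Nat.one_div_pos_of_nat
  have he1 : ∀ n, e n ≤ 1 := fun n => by
    have : (1 : ℝ) ≤ n + 1 := by linarith [n.cast_nonneg (α := ℝ)]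
    exact (div_le_one (by linarith)).2 this
  have hmono : Antitone e := fun a b hab => Nat.one_div_le_one_div hab
  let f : ℕ → ℝ → ℝ≥0∞ := fun n ξ => ENNReal.ofReal (regLog (e n) (x - ξ) + c)
  have hfm : ∀ n, Measurable (f n) := fun n =>
    (((continuous_regLog (he0 n)).comp (by fun_prop : Continuous fun ξ : ℝ => x - ξ)).measurable.add
      measurable_const).ennreal_ofReal
  have hfmono : Monotone f := fun a b hab ξ =>
    ENNReal.ofReal_le_ofReal (by linarith [regLog_anti (he0 b) (hmono hab) (x - ξ)])
  have hfint : ∀ n, ∫⁻ ξ, f n ξ ∂μ ≤ ENNReal.ofReal (B - V x / 2 + c) := by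
    intro n
    have hi : Integrable (fun ξ => regLog (e n) (x - ξ) + c) μ :=
      (integrable_regLog_right (he0 n) hμ x).add (integrable_const c)
    simp only [f]
    rw [← ofReal_integral_eq_lintegral_ofReal hi]
    · refine ENNReal.ofReal_le_ofReal ?_
      have h1 : ∫ ξ, (regLog (e n) (x - ξ) + c) ∂μ
          = (∫ ξ, regLog (e n) (x - ξ) ∂μ) + c := by
        rw [integral_add (integrable_regLog_right (he0 n) hμ x) (integrable_const c)]
        simp
      rw [h1]
      have := hB n
      unfold regPot at this
      linarith
    · filter_upwards [hμ] with ξ hξ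
      have := neg_log_add_le_regLog (he0 n) (he1 n) x ξ
      have := log_one_add_abs_le hξ
      simp only [Pi.zero_apply]
      linarith
  have hsup : ∫⁻ ξ, ⨆ n, f n ξ ∂μ ≤ ENNReal.ofReal (B - V x / 2 + c) := by
    rw [lintegral_iSup hfm hfmono]
    exact iSup_le hfint
  have hfin : ∀ᵐ ξ ∂μ, ⨆ n, f n ξ < ⊤ :=
    ae_lt_top (Measurable.iSup hfm) (ne_top_of_le_ne_top ENNReal.ofReal_ne_top hsup)
  have hne : ∀ᵐ ξ ∂μ, x ≠ ξ := by
    filter_upwards [hfin] with ξ hξ hxξ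
    subst hxξ
    obtain ⟨r, hr⟩ : ∃ r : ℝ, ⨆ n, f n x = ENNReal.ofReal r :=
      ⟨_, (ENNReal.ofReal_toReal hξ.ne).symm⟩
    have h1 : ∀ n, f n x ≤ ENNReal.ofReal r := fun n => hr ▸ le_iSup (fun n => f n x) n
    have h2 : Tendsto (fun n : ℕ => 1 + Real.log ((n : ℝ) + 1) + c) atTop atTop :=
      tendsto_atTop_add_const_right _ _ (tendsto_atTop_add_const_left _ _
        (Real.tendsto_log_atTop.comp (tendsto_atTop_add_const_right _ _
          tendsto_natCast_atTop_atTop)))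
    obtain ⟨n, hn⟩ := (h2.eventually_gt_atTop (max r 0)).exists
    have h3 := h1 n
    simp only [f, sub_self, regLog_zero (he0 n)] at h3
    rw [he] at h3
    simp only [one_div, Real.log_inv, sub_neg_eq_add] at h3
    have h4 : 0 < 1 + Real.log ((n : ℝ) + 1) + c := (le_max_right _ _).trans_lt hn
    rw [ENNReal.ofReal_le_ofReal_iff'] at h3
    have := le_max_left r 0
    rcases h3 with h3 | h3 <;> linarith
  have hle : ∀ᵐ ξ ∂μ, ENNReal.ofReal (-Real.log |x - ξ| + c) ≤ ⨆ n, f n ξ := by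
    filter_upwards [hne] with ξ hξ
    obtain ⟨n, hn⟩ := exists_nat_one_div_lt (abs_pos.2 (sub_ne_zero.2 hξ))
    refine le_trans (le_of_eq ?_) (le_iSup (fun n => f n ξ) n)
    simp only [f]
    rw [regLog_of_le (he0 n) hn.le]
  have hnn : ∀ᵐ ξ ∂μ, 0 ≤ -Real.log |x - ξ| + c := by
    filter_upwards [hne, hμ] with ξ hξ hξM
    have h1 := regLog_le_neg_log one_pos (sub_ne_zero.2 hξ)
    have h2 := neg_log_add_le_regLog one_pos le_rfl x ξ
    have h3 := log_one_add_abs_le hξM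
    linarith
  have hm : Measurable fun ξ => -Real.log |x - ξ| + c := by fun_prop
  have hbd : ∫⁻ ξ, ENNReal.ofReal (-Real.log |x - ξ| + c) ∂μ
      ≤ ENNReal.ofReal (B - V x / 2 + c) := (lintegral_mono_ae hle).trans hsup
  have hint1 : Integrable (fun ξ => -Real.log |x - ξ| + c) μ := by
    refine ⟨hm.aestronglyMeasurable, ?_⟩
    rw [hasFiniteIntegral_iff_ofReal hnn]
    exact hbd.trans_lt ENNReal.ofReal_lt_top
  have hint : Integrable (fun ξ => Real.log |x - ξ|) μ := by
    convert (hint1.sub (integrable_const c)).neg using 1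
    ext ξ; simp
  rw [effPotential_of_integrable hx hne hint, EReal.coe_le_coe_iff]
  rw [← ofReal_integral_eq_lintegral_ofReal hint1 hnn, ENNReal.ofReal_le_ofReal_iff',
    integral_add (show Integrable (fun ξ => -Real.log |x - ξ|) μ from hint.neg)
      (integrable_const c)] at hbd
  simp only [integral_neg, integral_const, probReal_univ, one_smul] at hbd
  have h6 : 0 ≤ B - V x / 2 + c := by
    have h7 := hB 0
    have h8 := le_regPot (V := V) (he0 0) (he1 0) hμ x
    simp only [he] at h8
    linarith
  rcases hbd with h5 | h5 <;> linarith

end Potential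

/-! ### Smoothing of measures inside a convex set -/

/-- The uniform probability measure on `[a, b]`. -/
noncomputable def unif (a b : ℝ) : Measure ℝ :=
  (ENNReal.ofReal (b - a))⁻¹ • volume.restrict (Set.Icc a b)

lemma isProbabilityMeasure_unif {a b : ℝ} (hab : a < b) : IsProbabilityMeasure (unif a b) := by
  refine ⟨?_⟩
  rw [unif, Measure.smul_apply, Measure.restrict_apply_univ, Real.volume_Icc, smul_eq_mul,
    ENNReal.inv_mul_cancel (by simpa using hab) ENNReal.ofReal_ne_top]

lemma unif_le {a b : ℝ} : unif a b ≤ (ENNReal.ofReal (b - a))⁻¹ • volume := by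
  intro s
  simp only [unif, Measure.smul_apply, smul_eq_mul]
  gcongr
  exact Measure.restrict_le_self

lemma ae_unif_mem {a b : ℝ} : ∀ᵐ u ∂(unif a b), u ∈ Set.Icc a b :=
  Measure.ae_smul_measure (ae_restrict_mem measurableSet_Icc) _

/-- The law of `(1 - t) X + t U`, where `X` has law `P` and `U` is uniform on `[a, b]` and
independent of `X`. It stays in every convex set that carries `P` and contains `[a, b]`, and its
density is at most `1 / (t (b - a))`. -/
noncomputable def smoothing (a b t : ℝ) (P : Measure ℝ) : Measure ℝ :=
  (P.prod (unif a b)).map fun p => (1 - t) * p.1 + t * p.2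

section Smoothing

variable {a b t : ℝ} {P : Measure ℝ} [IsProbabilityMeasure P]

lemma isProbabilityMeasure_smoothing (hab : a < b) :
    IsProbabilityMeasure (smoothing a b t P) := by
  have := isProbabilityMeasure_unif hab
  exact Measure.isProbabilityMeasure_map (by fun_prop)

lemma ae_smoothing_mem (hab : a < b) (ht : 0 < t) (ht1 : t ≤ 1) {S : Set ℝ}
    (hS : MeasurableSet S) (hconv : Convex ℝ S) (hsub : Set.Icc a b ⊆ S)
    (hP : ∀ᵐ x ∂P, x ∈ S) : ∀ᵐ x ∂(smoothing a b t P), x ∈ S := by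
  have := isProbabilityMeasure_unif hab
  refine (ae_map_iff (p := fun x => x ∈ S) (by fun_prop) hS).2 ?_
  filter_upwards [ae_prod_mem hP (ae_unif_mem (a := a) (b := b))] with p hp
  exact hconv hp.1 (hsub hp.2) (by linarith) ht.le (by ring)

lemma smoothing_le (hab : a < b) (ht : 0 < t) :
    smoothing a b t P ≤ ENNReal.ofReal (1 / (t * (b - a))) • volume := by
  have := isProbabilityMeasure_unif hab
  refine Measure.le_iff.2 fun s hs => ?_
  have hm : Measurable fun p : ℝ × ℝ => (1 - t) * p.1 + t * p.2 := by fun_prop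
  rw [smoothing, Measure.map_apply hm hs, Measure.prod_apply (hm hs)]
  calc ∫⁻ x, unif a b (Prod.mk x ⁻¹' ((fun p : ℝ × ℝ => (1 - t) * p.1 + t * p.2) ⁻¹' s)) ∂P
      ≤ ∫⁻ _, ENNReal.ofReal (1 / (t * (b - a))) * volume s ∂P := by
        refine lintegral_mono fun x => (unif_le _).trans (le_of_eq ?_)
        have h1 : Prod.mk x ⁻¹' ((fun p : ℝ × ℝ => (1 - t) * p.1 + t * p.2) ⁻¹' s)
            = (fun u => t * u) ⁻¹' ((fun y => (1 - t) * x + y) ⁻¹' s) := rfl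
        rw [Measure.smul_apply, smul_eq_mul, h1, Real.volume_preimage_mul_left ht.ne',
          measure_preimage_add, ← mul_assoc, abs_of_pos (inv_pos.2 ht),
          ← ENNReal.ofReal_inv_of_pos (sub_pos.2 hab),
          ← ENNReal.ofReal_mul (inv_nonneg.2 (sub_pos.2 hab).le)]
        congr 2
        rw [one_div, mul_inv, mul_comm]
    _ = (ENNReal.ofReal (1 / (t * (b - a))) • volume) s := by simp

/-- The singular part of the logarithm is integrable for Lebesgue measure. -/
lemma lintegral_neg_log_ne_top : ∫⁻ z : ℝ, ENNReal.ofReal (-Real.log |z|) ≠ ⊤ := by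
  have h1 : (fun z : ℝ => ENNReal.ofReal (-Real.log |z|))
      ≤ Set.indicator (Set.Ioc (-1) 1) (fun z => ENNReal.ofReal ‖Real.log z‖) := by
    intro z
    by_cases hz : z ∈ Set.Ioc (-1 : ℝ) 1
    · rw [Set.indicator_of_mem hz]
      dsimp only
      rw [Real.log_abs]
      exact ENNReal.ofReal_le_ofReal (by rw [← norm_neg]; exact le_abs_self _)
    · rw [Set.indicator_of_notMem hz]
      have : 1 ≤ |z| := by
        by_contra! h
        exact hz ⟨(abs_lt.1 h).1, (abs_lt.1 h).2.le⟩
      have h2 := Real.log_nonneg this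
      dsimp only
      rw [ENNReal.ofReal_of_nonpos (by linarith)]
  refine ne_top_of_le_ne_top ?_ (lintegral_mono h1)
  rw [lintegral_indicator measurableSet_Ioc]
  have h2 : IntervalIntegrable Real.log volume (-1) 1 := intervalIntegral.intervalIntegrable_log'
  have h3 := (intervalIntegrable_iff_integrableOn_Ioc_of_le (by norm_num)).1 h2
  exact h3.norm.lintegral_lt_top.ne

/-- `∫ (log |z|)⁻ dz`. -/
noncomputable def logConst : ℝ≥0∞ := ∫⁻ z : ℝ, ENNReal.ofReal (-Real.log |z|)

lemma ae_ne_of_le {ν : Measure ℝ} {C : ℝ≥0∞} (hν : ν ≤ C • volume) (x : ℝ) :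
    ∀ᵐ y ∂ν, y ≠ x := by
  have := hν {x}
  rw [ae_iff]
  simpa using this

lemma lintegral_neg_log_le {ν : Measure ℝ} {C : ℝ≥0∞} (hν : ν ≤ C • volume) (x : ℝ) :
    ∫⁻ y, ENNReal.ofReal (-Real.log |x - y|) ∂ν ≤ C * logConst := by
  refine (lintegral_mono' hν le_rfl).trans (le_of_eq ?_)
  rw [lintegral_smul_measure, smul_eq_mul, logConst]
  congr 1
  exact lintegral_sub_left_eq_self (fun z => ENNReal.ofReal (-Real.log |z|)) x

lemma logFinite_of_le {μ ν : Measure ℝ} [IsProbabilityMeasure μ] [IsProbabilityMeasure ν]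
    {M : ℝ} (hμ : ∀ᵐ x ∂μ, |x| ≤ M) (hνM : ∀ᵐ x ∂ν, |x| ≤ M) {C : ℝ≥0∞} (hC : C ≠ ⊤)
    (hν : ν ≤ C • volume) : LogFinite μ ν := by
  refine ⟨?_, measurable_log_abs_sub.aestronglyMeasurable, ?_⟩
  · refine (Measure.ae_prod_iff_ae_ae (p := fun p : ℝ × ℝ => p.1 ≠ p.2)
      (measurableSet_eq_fun measurable_fst measurable_snd).compl).2 ?_
    exact Eventually.of_forall fun x => (ae_ne_of_le hν x).mono fun y hy => hy.symm
  · rw [HasFiniteIntegral, lintegral_prod _ (by fun_prop)]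
    refine lt_of_le_of_lt (b := C * logConst + ENNReal.ofReal (2 * Real.log (1 + M))) ?_
      (ENNReal.add_lt_top.2 ⟨ENNReal.mul_lt_top hC.lt_top lintegral_neg_log_ne_top.lt_top,
        ENNReal.ofReal_lt_top⟩)
    calc ∫⁻ x, ∫⁻ y, ‖Real.log |x - y|‖ₑ ∂ν ∂μ
        ≤ ∫⁻ _, (C * logConst + ENNReal.ofReal (2 * Real.log (1 + M))) ∂μ := by
          refine lintegral_mono_ae (hμ.mono fun x hx => ?_)
          calc ∫⁻ y, ‖Real.log |x - y|‖ₑ ∂ν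
              ≤ ∫⁻ y, (ENNReal.ofReal (-Real.log |x - y|)
                  + ENNReal.ofReal (2 * Real.log (1 + M))) ∂ν := by
                refine lintegral_mono_ae (hνM.mono fun y hy => ?_)
                rw [Real.enorm_eq_ofReal_abs]
                have h1 : Real.log |x - y| ≤ 2 * Real.log (1 + M) := by
                  rcases eq_or_ne x y with rfl | hxy
                  · simpa using Real.log_nonneg (by linarith [abs_nonneg x])
                  · have h2 := Real.log_le_log (abs_pos.2 (sub_ne_zero.2 hxy))
                      (by linarith : |x - y| ≤ 1 + |x - y|)
                    linarith [log_one_add_abs_sub_le x y, log_one_add_abs_le hx,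
                      log_one_add_abs_le hy]
                rcases le_total 0 (Real.log |x - y|) with h | h
                · rw [abs_of_nonneg h]
                  exact le_add_left (ENNReal.ofReal_le_ofReal h1)
                · rw [abs_of_nonpos h]
                  exact le_self_add
            _ ≤ _ := by
                rw [lintegral_add_right _ measurable_const]
                simp only [lintegral_const, measure_univ, mul_one]
                gcongr
                exact lintegral_neg_log_le hν x
      _ = _ := by simp

/-- Averaging `-log |z + t (u - w)|` over `u ∈ [a, b]` increases `-log |z|` by at most a constant,
uniformly in `z`, `t` and `w` in a bounded set. -/
lemma lintegral_avg_neg_log_le (hab : a < b) (ht : 0 < t) {K : ℝ} (hK : 0 < K)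
    {z w c : ℝ} (hz : z ≠ 0) (hw : ∀ u ∈ Set.Icc a b, |u - w| ≤ K) :
    ∫⁻ u, ENNReal.ofReal (-Real.log |z + t * (u - w)| + c) ∂(unif a b) ≤
      ENNReal.ofReal (-Real.log |z| + c) +
        (ENNReal.ofReal (Real.log 2) + ENNReal.ofReal |Real.log (2 * K)| +
          (ENNReal.ofReal (b - a))⁻¹ * logConst) := by
  have := isProbabilityMeasure_unif hab
  have hz0 := abs_pos.2 hz
  rcases le_or_gt (2 * t * K) |z| with h | h
  · -- far from the origin: the perturbation at most halves `|z|`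
    calc ∫⁻ u, ENNReal.ofReal (-Real.log |z + t * (u - w)| + c) ∂(unif a b)
        ≤ ∫⁻ _, (ENNReal.ofReal (-Real.log |z| + c) + ENNReal.ofReal (Real.log 2))
            ∂(unif a b) := by
          refine lintegral_mono_ae (ae_unif_mem.mono fun u hu => ?_)
          refine le_trans (ENNReal.ofReal_le_ofReal ?_) ENNReal.ofReal_add_le
          have h1 : |z| / 2 ≤ |z + t * (u - w)| := by
            have h2 : |t * (u - w)| ≤ t * K := by
              rw [abs_mul, abs_of_pos ht]
              exact mul_le_mul_of_nonneg_left (hw u hu) ht.le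
            have h3 := abs_sub_abs_le_abs_sub z (-(t * (u - w)))
            rw [abs_neg, sub_neg_eq_add] at h3
            linarith
          have h2 := Real.log_le_log (by positivity) h1
          rw [Real.log_div hz0.ne' two_ne_zero] at h2
          linarith
      _ = ENNReal.ofReal (-Real.log |z| + c) + ENNReal.ofReal (Real.log 2) := by simp
      _ ≤ _ := by
          gcongr
          rw [add_assoc]
          exact le_self_add
  · -- close to the origin: rescale by `t`
    calc ∫⁻ u, ENNReal.ofReal (-Real.log |z + t * (u - w)| + c) ∂(unif a b)
        ≤ ∫⁻ u, ((ENNReal.ofReal (-Real.log |z| + c) + ENNReal.ofReal |Real.log (2 * K)|)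
            + ENNReal.ofReal (-Real.log |(w - z / t) - u|)) ∂(unif a b) := by
          refine lintegral_mono_ae ((ae_ne_of_le unif_le (w - z / t)).mono fun u hu => ?_)
          refine le_trans (ENNReal.ofReal_le_ofReal (q := (-Real.log |z| + c) +
            |Real.log (2 * K)| + -Real.log |(w - z / t) - u|) ?_)
            (ENNReal.ofReal_add_le.trans (add_le_add_left ENNReal.ofReal_add_le _))
          have h1 : Real.log |z| ≤ Real.log t + |Real.log (2 * K)| := by
            have h2 := Real.log_le_log hz0 h.le
            rw [show 2 * t * K = t * (2 * K) by ring, Real.log_mul ht.ne' (by positivity)] at h2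
            linarith [le_abs_self (Real.log (2 * K))]
          have h3 : z + t * (u - w) = -(t * ((w - z / t) - u)) := by field_simp; ring
          rw [h3, abs_neg, abs_mul, abs_of_pos ht]
          rw [Real.log_mul ht.ne' (abs_pos.2 (sub_ne_zero.2 hu.symm)).ne']
          linarith
      _ ≤ _ := by
          rw [lintegral_add_left measurable_const]
          simp only [lintegral_const, measure_univ, mul_one]
          rw [add_assoc]
          gcongr
          · exact le_add_self
          exact lintegral_neg_log_le unif_le _

end Smoothing

section Convergence

variable {a b : ℝ}

/-- The averages of `-log |z + t (u - w)|` over `u ∈ [a, b]` converge in mean to `-log |z|` as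
`t` tends to zero. The shift `c` makes the integrands nonnegative in the applications. -/
lemma tendsto_lintegral_avg_neg_log {Y : Type*} [MeasurableSpace Y] (Q : Measure Y)
    [IsFiniteMeasure Q] (hab : a < b) {z w : Y → ℝ} (hzm : Measurable z) (hwm : Measurable w)
    {K c : ℝ} (hK : 0 < K) (hz : ∀ᵐ y ∂Q, z y ≠ 0)
    (hw : ∀ᵐ y ∂Q, ∀ u ∈ Set.Icc a b, |u - w y| ≤ K)
    (hfin : ∫⁻ y, ENNReal.ofReal (-Real.log |z y| + c) ∂Q ≠ ⊤) :
    Tendsto (fun t : ℝ => ∫⁻ y, ∫⁻ u, ENNReal.ofReal (-Real.log |z y + t * (u - w y)| + c)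
      ∂(unif a b) ∂Q) (𝓝[>] 0) (𝓝 (∫⁻ y, ENNReal.ofReal (-Real.log |z y| + c) ∂Q)) := by
  have := isProbabilityMeasure_unif hab
  refine tendsto_lintegral_filter_of_dominated_convergence
    (fun y => ENNReal.ofReal (-Real.log |z y| + c) +
        (ENNReal.ofReal (Real.log 2) + ENNReal.ofReal |Real.log (2 * K)| +
          (ENNReal.ofReal (b - a))⁻¹ * logConst)) ?_ ?_ ?_ ?_
  · refine Eventually.of_forall fun t => ?_
    exact Measurable.lintegral_prod_right'
      (f := fun p : Y × ℝ => ENNReal.ofReal (-Real.log |z p.1 + t * (p.2 - w p.1)| + c))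
      (by fun_prop)
  · filter_upwards [self_mem_nhdsWithin] with t ht
    filter_upwards [hz, hw] with y hy hwy
    exact lintegral_avg_neg_log_le hab ht hK hy hwy
  · rw [lintegral_add_right _ measurable_const]
    refine ENNReal.add_ne_top.2 ⟨hfin, ?_⟩
    rw [lintegral_const]
    refine ENNReal.mul_ne_top ?_ (measure_ne_top _ _)
    refine ENNReal.add_ne_top.2 ⟨ENNReal.add_ne_top.2
      ⟨ENNReal.ofReal_ne_top, ENNReal.ofReal_ne_top⟩, ENNReal.mul_ne_top ?_
        lintegral_neg_log_ne_top⟩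
    exact ENNReal.inv_ne_top.2 (by simpa using hab)
  · filter_upwards [hz, hw] with y hy hwy
    have hy0 := abs_pos.2 hy
    have hlim : Tendsto (fun t : ℝ => ∫⁻ u, ENNReal.ofReal (-Real.log |z y + t * (u - w y)| + c)
        ∂(unif a b)) (𝓝[>] 0) (𝓝 (∫⁻ _, ENNReal.ofReal (-Real.log |z y| + c) ∂(unif a b))) := by
      refine tendsto_lintegral_filter_of_dominated_convergence
        (fun _ => ENNReal.ofReal (-Real.log (|z y| / 2) + c)) ?_ ?_ ?_ ?_
      · exact Eventually.of_forall fun t => by fun_prop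
      · have h1 : ∀ᶠ t : ℝ in 𝓝[>] 0, t < |z y| / (2 * K) :=
          (eventually_lt_nhds (by positivity)).filter_mono nhdsWithin_le_nhds
        filter_upwards [self_mem_nhdsWithin, h1] with t ht ht1
        refine ae_unif_mem.mono fun u hu => ENNReal.ofReal_le_ofReal ?_
        have ht0 : (0 : ℝ) < t := ht
        have h2 : |t * (u - w y)| ≤ t * K := by
          rw [abs_mul, abs_of_pos ht0]
          exact mul_le_mul_of_nonneg_left (hwy u hu) ht0.le
        have h3 := abs_sub_abs_le_abs_sub (z y) (-(t * (u - w y)))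
        rw [abs_neg, sub_neg_eq_add] at h3
        rw [lt_div_iff₀ (by positivity)] at ht1
        have h4 := Real.log_le_log (by positivity : 0 < |z y| / 2)
          (by linarith : |z y| / 2 ≤ |z y + t * (u - w y)|)
        linarith
      · simp
      · refine Eventually.of_forall fun u => ?_
        have hc : ContinuousAt (fun t : ℝ =>
            ENNReal.ofReal (-Real.log |z y + t * (u - w y)| + c)) 0 := by
          refine ENNReal.continuous_ofReal.continuousAt.comp ?_
          refine ContinuousAt.add (ContinuousAt.neg (ContinuousAt.log (by fun_prop) ?_))
            continuousAt_const
          simpa using hy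
        have h5 := hc.tendsto.mono_left (nhdsWithin_le_nhds (s := Set.Ioi 0))
        simpa using h5
    simpa using hlim

lemma lintegral_smoothing_prod {t : ℝ} {P : Measure ℝ} [IsProbabilityMeasure P] (hab : a < b)
    {Z : Type*} [MeasurableSpace Z] (ρ : Measure Z) [IsFiniteMeasure ρ] {G : ℝ → Z → ℝ≥0∞}
    (hG : Measurable (Function.uncurry G)) :
    ∫⁻ y, ∫⁻ q, G y q ∂ρ ∂(smoothing a b t P)
      = ∫⁻ p : ℝ × Z, ∫⁻ u, G ((1 - t) * p.1 + t * u) p.2 ∂(unif a b) ∂(P.prod ρ) := by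
  have := isProbabilityMeasure_unif hab
  rw [smoothing, lintegral_map hG.lintegral_prod_right (by fun_prop), lintegral_prod,
    lintegral_prod]
  · refine lintegral_congr fun x => ?_
    dsimp only
    refine lintegral_lintegral_swap (f := fun u q => G ((1 - t) * x + t * u) q)
      (Measurable.aemeasurable ?_)
    exact hG.comp ((by fun_prop : Measurable fun p : ℝ × Z => (1 - t) * x + t * p.1).prodMk
      measurable_snd)
  · refine (Measurable.lintegral_prod_right'
      (f := fun r : (ℝ × Z) × ℝ => G ((1 - t) * r.1.1 + t * r.2) r.1.2) ?_).aemeasurable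
    exact hG.comp ((by fun_prop :
      Measurable fun r : (ℝ × Z) × ℝ => (1 - t) * r.1.1 + t * r.2).prodMk
      (measurable_snd.comp measurable_fst))
  · exact (hG.lintegral_prod_right.comp (by fun_prop :
      Measurable fun p : ℝ × ℝ => (1 - t) * p.1 + t * p.2)).aemeasurable

/-- On measures carried by `[-M, M]` the shifted kernel `-log |x - y| + 2 log (1 + M)` is
nonnegative, which turns the mutual energy into a Lebesgue integral. -/
lemma LogFinite.lintegral_eq {μ ν : Measure ℝ} [IsProbabilityMeasure μ] [IsProbabilityMeasure ν]
    {M : ℝ} (hμ : ∀ᵐ x ∂μ, |x| ≤ M) (hν : ∀ᵐ x ∂ν, |x| ≤ M) (h : LogFinite μ ν) :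
    ∫⁻ p, ENNReal.ofReal (-Real.log |p.1 - p.2| + 2 * Real.log (1 + M)) ∂(μ.prod ν)
      = ENNReal.ofReal (2 * Real.log (1 + M) - ∫ p, Real.log |p.1 - p.2| ∂(μ.prod ν)) ∧
    0 ≤ 2 * Real.log (1 + M) - ∫ p, Real.log |p.1 - p.2| ∂(μ.prod ν) := by
  have hint : Integrable (fun p : ℝ × ℝ => -Real.log |p.1 - p.2| + 2 * Real.log (1 + M))
      (μ.prod ν) := h.2.neg.add (integrable_const _)
  have hnn : 0 ≤ᵐ[μ.prod ν] fun p => -Real.log |p.1 - p.2| + 2 * Real.log (1 + M) := by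
    filter_upwards [h.1, ae_prod_mem hμ hν] with p hp hp2
    have h1 := regLog_le_neg_log one_pos (sub_ne_zero.2 hp)
    have h2 := neg_log_add_le_regLog one_pos le_rfl p.1 p.2
    have h3 := log_one_add_abs_le hp2.1
    have h4 := log_one_add_abs_le hp2.2
    simp only [Pi.zero_apply]
    linarith
  have heq : ∫ p, (-Real.log |p.1 - p.2| + 2 * Real.log (1 + M)) ∂(μ.prod ν)
      = 2 * Real.log (1 + M) - ∫ p, Real.log |p.1 - p.2| ∂(μ.prod ν) := by
    rw [integral_add (show Integrable (fun p : ℝ × ℝ => -Real.log |p.1 - p.2|) _ from h.2.neg)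
      (integrable_const _), integral_neg]
    simp; ring
  rw [← ofReal_integral_eq_lintegral_ofReal hint hnn, heq]
  exact ⟨rfl, heq ▸ integral_nonneg_of_ae hnn⟩

variable {P μ : Measure ℝ} [IsProbabilityMeasure P] [IsProbabilityMeasure μ] {M : ℝ}

lemma ae_smoothing_abs_le {t : ℝ} (hab : a < b) (ht : 0 < t) (ht1 : t ≤ 1)
    (hM : Set.Icc a b ⊆ Set.Icc (-M) M) (hP : ∀ᵐ x ∂P, |x| ≤ M) :
    ∀ᵐ x ∂(smoothing a b t P), |x| ≤ M :=
  (ae_smoothing_mem hab ht ht1 measurableSet_Icc (convex_Icc (-M) M) hM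
    (hP.mono fun _ hx => abs_le.1 hx)).mono fun _ hx => abs_le.2 hx

lemma logFinite_smoothing {t : ℝ} (hab : a < b) (ht : 0 < t) (ht1 : t ≤ 1)
    (hM : Set.Icc a b ⊆ Set.Icc (-M) M) (hP : ∀ᵐ x ∂P, |x| ≤ M) (hμ : ∀ᵐ x ∂μ, |x| ≤ M) :
    LogFinite μ (smoothing a b t P) := by
  have := isProbabilityMeasure_smoothing (t := t) (P := P) hab
  exact logFinite_of_le hμ (ae_smoothing_abs_le hab ht ht1 hM hP) ENNReal.ofReal_ne_top
    (smoothing_le hab ht)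

lemma LogFinite.symm {μ ν : Measure ℝ} [SFinite μ] [SFinite ν] (h : LogFinite μ ν) :
    LogFinite ν μ := by
  have hq : Measure.QuasiMeasurePreserving Prod.swap (ν.prod μ) (μ.prod ν) :=
    Measure.measurePreserving_swap.quasiMeasurePreserving
  refine ⟨(hq.ae h.1).mono fun p hp => fun h => hp h.symm, ?_⟩
  refine h.2.swap.congr (Eventually.of_forall fun p => ?_)
  simp only [Function.comp, Prod.fst_swap, Prod.snd_swap]
  rw [abs_sub_comm]

lemma integral_log_symm (μ ν : Measure ℝ) [SFinite μ] [SFinite ν] :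
    ∫ p, Real.log |p.1 - p.2| ∂(ν.prod μ) = ∫ p, Real.log |p.1 - p.2| ∂(μ.prod ν) := by
  rw [← integral_prod_swap]
  refine integral_congr_ae (Eventually.of_forall fun p => ?_)
  simp only [Prod.fst_swap, Prod.snd_swap]
  rw [abs_sub_comm]

/-- Smoothing one of two measures changes their mutual logarithmic energy by little. -/
lemma tendsto_integral_log_smoothing_left (hab : a < b) (hM : Set.Icc a b ⊆ Set.Icc (-M) M)
    (hP : ∀ᵐ x ∂P, |x| ≤ M) (hμ : ∀ᵐ x ∂μ, |x| ≤ M) (hfin : LogFinite P μ) :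
    Tendsto (fun t => ∫ p, Real.log |p.1 - p.2| ∂((smoothing a b t P).prod μ)) (𝓝[>] 0)
      (𝓝 (∫ p, Real.log |p.1 - p.2| ∂(P.prod μ))) := by
  have hM0 : 0 ≤ M := by
    have := (hM (Set.left_mem_Icc.2 hab.le))
    linarith [this.1, this.2]
  set c := 2 * Real.log (1 + M) with hc
  have hlim := tendsto_lintegral_avg_neg_log (P.prod μ) hab
    (z := fun p => p.1 - p.2) (w := fun p => p.1) (K := 2 * M + 1) (c := c) (by fun_prop)
    (by fun_prop) (by linarith) (hfin.1.mono fun p hp => sub_ne_zero.2 hp)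
    ((ae_prod_mem hP hμ).mono fun p hp u hu => by
      have h1 := abs_le.1 (show |p.1| ≤ M from hp.1)
      have h2 := hM hu
      rw [abs_le]; constructor <;> linarith [h2.1, h2.2])
    (by rw [(hfin.lintegral_eq hP hμ).1]; exact ENNReal.ofReal_ne_top)
  rw [(hfin.lintegral_eq hP hμ).1] at hlim
  have h2 := (ENNReal.tendsto_toReal ENNReal.ofReal_ne_top).comp hlim
  rw [ENNReal.toReal_ofReal (hfin.lintegral_eq hP hμ).2] at h2
  have h3 := h2.const_sub c
  rw [sub_sub_cancel] at h3
  refine h3.congr' ?_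
  have h1 : ∀ᶠ t : ℝ in 𝓝[>] 0, t < 1 :=
    (eventually_lt_nhds one_pos).filter_mono nhdsWithin_le_nhds
  filter_upwards [self_mem_nhdsWithin, h1] with t ht ht1
  have := isProbabilityMeasure_smoothing (t := t) (P := P) hab
  have hf := (logFinite_smoothing (M := M) (μ := μ) hab ht ht1.le hM hP hμ).symm
  have hsm := ae_smoothing_abs_le (P := P) hab ht ht1.le hM hP
  have h4 := hf.lintegral_eq hsm hμ
  have h5 := lintegral_smoothing_prod (t := t) (P := P) hab μ
    (G := fun x y => ENNReal.ofReal (-Real.log |x - y| + c)) (by fun_prop)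
  rw [lintegral_prod _ (by fun_prop), h5] at h4
  simp only [Function.comp]
  have h6 : ∀ p : ℝ × ℝ, ∀ u, p.1 - p.2 + t * (u - p.1) = (1 - t) * p.1 + t * u - p.2 :=
    fun p u => by ring
  simp_rw [h6]
  rw [h4.1, ENNReal.toReal_ofReal h4.2, sub_sub_cancel]

/-- Smoothing a measure changes its logarithmic energy by little. -/
lemma tendsto_integral_log_smoothing (hab : a < b) (hM : Set.Icc a b ⊆ Set.Icc (-M) M)
    (hP : ∀ᵐ x ∂P, |x| ≤ M) (hfin : LogFinite P P) :
    Tendsto (fun t => ∫ p, Real.log |p.1 - p.2| ∂((smoothing a b t P).prod (smoothing a b t P)))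
      (𝓝[>] 0) (𝓝 (∫ p, Real.log |p.1 - p.2| ∂(P.prod P))) := by
  have := isProbabilityMeasure_unif hab
  have hM0 : 0 ≤ M := by
    have := (hM (Set.left_mem_Icc.2 hab.le))
    linarith [this.1, this.2]
  set c := 2 * Real.log (1 + M) with hc
  have hbase : ∫⁻ q : ℝ × (ℝ × ℝ), ENNReal.ofReal (-Real.log |q.1 - q.2.1| + c)
      ∂(P.prod (P.prod (unif a b)))
      = ENNReal.ofReal (c - ∫ p, Real.log |p.1 - p.2| ∂(P.prod P)) := by
    rw [← (hfin.lintegral_eq hP hP).1, lintegral_prod _ (by fun_prop),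
      lintegral_prod _ (by fun_prop)]
    refine lintegral_congr fun x => ?_
    dsimp only
    rw [lintegral_prod _ (by fun_prop)]
    simp only [lintegral_const, measure_univ, mul_one, hc]
  -- the second smoothed point is `(1 - t) y + t v`: the difference of the two smoothed points is
  -- `x - y + t (u - (x - y + v))`, and only the variable `u` is averaged
  have hlim := tendsto_lintegral_avg_neg_log (P.prod (P.prod (unif a b))) hab
    (z := fun q => q.1 - q.2.1) (w := fun q => q.1 - q.2.1 + q.2.2) (K := 4 * M + 1) (c := c)
    (by fun_prop) (by fun_prop) (by linarith) (by
      refine (Measure.ae_prod_iff_ae_ae (p := fun q : ℝ × (ℝ × ℝ) => q.1 - q.2.1 ≠ 0)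
        (measurableSet_eq_fun (by fun_prop) (by fun_prop)).compl).2 ?_
      filter_upwards [Measure.ae_ae_of_ae_prod hfin.1] with x hx
      exact Measure.quasiMeasurePreserving_fst.ae (hx.mono fun y hy => sub_ne_zero.2 hy))
    ((ae_prod_mem hP (ae_prod_mem hP (ae_unif_mem (a := a) (b := b)))).mono fun q hq u hu => by
      have h1 := abs_le.1 (show |q.1| ≤ M from hq.1)
      have h2 := hM hu
      have h3 := abs_le.1 (show |q.2.1| ≤ M from hq.2.1)
      have h4 := hM hq.2.2
      rw [abs_le]; constructor <;> linarith [h2.1, h2.2, h4.1, h4.2])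
    (by rw [hbase]; exact ENNReal.ofReal_ne_top)
  rw [hbase] at hlim
  have h2 := (ENNReal.tendsto_toReal ENNReal.ofReal_ne_top).comp hlim
  rw [ENNReal.toReal_ofReal (hfin.lintegral_eq hP hP).2] at h2
  have h3 := h2.const_sub c
  rw [sub_sub_cancel] at h3
  refine h3.congr' ?_
  have h1 : ∀ᶠ t : ℝ in 𝓝[>] 0, t < 1 :=
    (eventually_lt_nhds one_pos).filter_mono nhdsWithin_le_nhds
  filter_upwards [self_mem_nhdsWithin, h1] with t ht ht1
  have := isProbabilityMeasure_smoothing (t := t) (P := P) hab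
  have hsm := ae_smoothing_abs_le (P := P) hab ht ht1.le hM hP
  have hf := (logFinite_smoothing (M := M) (μ := smoothing a b t P) hab ht ht1.le hM hP hsm)
  have h4 := hf.lintegral_eq hsm hsm
  have h5 := lintegral_smoothing_prod (t := t) (P := P) hab (P.prod (unif a b))
    (G := fun x q => ENNReal.ofReal (-Real.log |x - ((1 - t) * q.1 + t * q.2)| + c)) (by fun_prop)
  rw [lintegral_prod _ (by fun_prop)] at h4
  have h7 : ∀ x, ∫⁻ y, ENNReal.ofReal (-Real.log |x - y| + c) ∂(smoothing a b t P)
      = ∫⁻ q, ENNReal.ofReal (-Real.log |x - ((1 - t) * q.1 + t * q.2)| + c)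
        ∂(P.prod (unif a b)) := fun x => by
    rw [smoothing, lintegral_map (by fun_prop) (by fun_prop)]
  rw [← hc] at h4
  simp only [h7] at h4
  rw [h5] at h4
  simp only [Function.comp]
  have h6 : ∀ q : ℝ × (ℝ × ℝ), ∀ u, q.1 - q.2.1 + t * (u - (q.1 - q.2.1 + q.2.2))
      = (1 - t) * q.1 + t * u - ((1 - t) * q.2.1 + t * q.2.2) := fun p u => by ring
  simp_rw [h6]
  rw [h4.1, ENNReal.toReal_ofReal h4.2, sub_sub_cancel]

lemma tendsto_integral_smoothing (hab : a < b) (hM : Set.Icc a b ⊆ Set.Icc (-M) M)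
    (hP : ∀ᵐ x ∂P, |x| ≤ M) {V : ℝ → ℝ} (hV : Continuous V) :
    Tendsto (fun t => ∫ x, V x ∂(smoothing a b t P)) (𝓝[>] 0) (𝓝 (∫ x, V x ∂P)) := by
  have := isProbabilityMeasure_unif hab
  obtain ⟨C, hC⟩ := (isCompact_Icc (a := -M) (b := M)).exists_bound_of_continuousOn
    hV.continuousOn
  have h0 : ∫ x, V x ∂P = ∫ p : ℝ × ℝ, V p.1 ∂(P.prod (unif a b)) := by
    rw [integral_fun_fst]; simp
  rw [h0]
  have h1 : ∀ᶠ t : ℝ in 𝓝[>] 0, t < 1 :=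
    (eventually_lt_nhds one_pos).filter_mono nhdsWithin_le_nhds
  have key : Tendsto (fun t : ℝ => ∫ p : ℝ × ℝ, V ((1 - t) * p.1 + t * p.2) ∂(P.prod (unif a b)))
      (𝓝[>] 0) (𝓝 (∫ p : ℝ × ℝ, V p.1 ∂(P.prod (unif a b)))) := by
    refine tendsto_integral_filter_of_dominated_convergence (fun _ => C) ?_ ?_
      (integrable_const _) ?_
    · exact Eventually.of_forall fun t =>
        (hV.comp (by fun_prop)).measurable.aestronglyMeasurable
    · filter_upwards [self_mem_nhdsWithin, h1] with t ht ht1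
      filter_upwards [ae_prod_mem hP (ae_unif_mem (a := a) (b := b))] with p hp
      have ht0 : (0 : ℝ) < t := ht
      exact hC _ (convex_Icc (-M) M (abs_le.1 hp.1) (hM hp.2) (sub_nonneg.2 ht1.le) ht0.le
        (by ring))
    · refine Eventually.of_forall fun p => ?_
      have hc : Continuous fun t : ℝ => V ((1 - t) * p.1 + t * p.2) := hV.comp (by fun_prop)
      have h5 := hc.continuousAt.tendsto.mono_left (nhdsWithin_le_nhds (a := 0) (s := Set.Ioi 0))
      simpa using h5
  refine key.congr fun t => ?_
  rw [smoothing, integral_map (by fun_prop) hV.aestronglyMeasurable]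

end Convergence

/-! ### The variational problem -/

section Energy

variable {V : ℝ → ℝ} {M : ℝ}

/-- The logarithmic mutual energy `∬ log |x - y| dμ(x) dν(y)` with a plus sign. -/
noncomputable def logEnergy (μ ν : Measure ℝ) : ℝ := ∫ p, Real.log |p.1 - p.2| ∂(μ.prod ν)

lemma integrable_of_abs_le (hV : Continuous V) {μ : Measure ℝ} [IsProbabilityMeasure μ]
    (hμ : ∀ᵐ x ∂μ, |x| ≤ M) : Integrable V μ :=
  integrable_of_continuous_of_ae_mem hV isCompact_Icc (hμ.mono fun _ h => abs_le.1 h)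

lemma energy_eq (hV : Continuous V) {ν : Measure ℝ} [IsProbabilityMeasure ν]
    (hν : ∀ᵐ x ∂ν, |x| ≤ M) (h : LogFinite ν ν) :
    energy V ν = ((∫ x, V x ∂ν - logEnergy ν ν : ℝ) : EReal) := by
  have hVi := integrable_of_abs_le hV hν
  have h1 : Integrable (fun p : ℝ × ℝ => V p.1 / 2) (ν.prod ν) := (hVi.div_const 2).comp_fst ν
  have h2 : Integrable (fun p : ℝ × ℝ => V p.2 / 2) (ν.prod ν) := (hVi.div_const 2).comp_snd ν
  have h3 : ∫ p : ℝ × ℝ, (V p.1 / 2 + V p.2 / 2 - Real.log |p.1 - p.2|) ∂(ν.prod ν)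
      = ∫ x, V x ∂ν - logEnergy ν ν := by
    rw [integral_sub (show Integrable (fun p : ℝ × ℝ => V p.1 / 2 + V p.2 / 2) _ from h1.add h2)
      h.2, integral_add h1 h2,
      integral_fun_fst (f := fun x => V x / 2), integral_fun_snd (f := fun x => V x / 2),
      integral_div, logEnergy]
    simp
  rw [energy, extIntegral_of_ae_eq (g := fun p : ℝ × ℝ =>
    V p.1 / 2 + V p.2 / 2 - Real.log |p.1 - p.2|) ((h1.add h2).sub h.2), h3]
  refine h.1.mono fun p hp => ?_
  rw [logDist_of_ne hp, EReal.coe_sub]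

lemma logFinite_of_energy_ne_top (hV : Continuous V) {μ : Measure ℝ} [IsProbabilityMeasure μ]
    (hμ : ∀ᵐ x ∂μ, |x| ≤ M) (h : energy V μ ≠ ⊤) : LogFinite μ μ := by
  set f : ℝ × ℝ → EReal :=
    fun p => ((V p.1 / 2 + V p.2 / 2 : ℝ) : EReal) - logDist p.1 p.2 with hf
  have hVm := hV.measurable
  have hlm := measurable_logDist
  have hfm : Measurable f := by
    have h1 : Measurable fun p : ℝ × ℝ => ((V p.1 / 2 + V p.2 / 2 : ℝ) : EReal) :=
      measurable_coe_real_ereal.comp (by fun_prop)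
    simp only [hf, sub_eq_add_neg]
    exact h1.add hlm.neg
  obtain ⟨C, hC⟩ := (isCompact_Icc (a := -M) (b := M)).exists_bound_of_continuousOn
    hV.continuousOn
  have hn : ∫⁻ p, (-f p).toENNReal ∂(μ.prod μ) ≠ ⊤ := by
    refine ne_top_of_le_ne_top (b := ENNReal.ofReal (C + 2 * Real.log (1 + M)))
      ENNReal.ofReal_ne_top ?_
    calc ∫⁻ p, (-f p).toENNReal ∂(μ.prod μ)
        ≤ ∫⁻ _, ENNReal.ofReal (C + 2 * Real.log (1 + M)) ∂(μ.prod μ) := by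
          refine lintegral_mono_ae ((ae_prod_mem hμ hμ).mono fun p hp => ?_)
          rw [← EReal.real_coe_toENNReal]
          refine EReal.toENNReal_le_toENNReal ?_
          have h1 := hC p.1 (abs_le.1 hp.1)
          have h2 := hC p.2 (abs_le.1 hp.2)
          have h3 := log_one_add_abs_le hp.1
          have h4 := log_one_add_abs_le hp.2
          rw [Real.norm_eq_abs, abs_le] at h1 h2
          have h5 := logDist_le p.1 p.2
          simp only [hf]
          rw [EReal.neg_le]
          refine le_trans ?_ (EReal.sub_le_sub le_rfl h5)
          rw [← EReal.coe_sub, ← EReal.coe_neg, EReal.coe_le_coe_iff]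
          linarith [h1.1, h2.1]
      _ = _ := by simp
  have hp : ∫⁻ p, (f p).toENNReal ∂(μ.prod μ) ≠ ⊤ := by
    intro hp
    apply h
    rw [energy, extIntegral, hp, ← EReal.coe_ennreal_toReal hn]
    rfl
  obtain ⟨h1, h2⟩ := ae_eq_toReal_of_lintegral_ne_top hfm hp hn
  have hne : ∀ᵐ p ∂(μ.prod μ), p.1 ≠ p.2 := h1.mono fun p hpp hxe => hpp.1 (by
    simp [hf, hxe, logDist_self])
  refine ⟨hne, ?_⟩
  have hVi := integrable_of_abs_le hV hμ
  have h3 : Integrable (fun p : ℝ × ℝ => V p.1 / 2) (μ.prod μ) := (hVi.div_const 2).comp_fst μ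
  have h4 : Integrable (fun p : ℝ × ℝ => V p.2 / 2) (μ.prod μ) := (hVi.div_const 2).comp_snd μ
  refine ((h3.add h4).sub h2).congr (hne.mono fun p hp => ?_)
  simp only [hf, Pi.sub_apply, Pi.add_apply, logDist_of_ne hp, ← EReal.coe_sub, EReal.toReal_coe]
  ring

end Energy

section Mixture

variable {μ ρ : Measure ℝ} [IsProbabilityMeasure μ] [IsProbabilityMeasure ρ]

lemma prod_mixture (c d : ℝ≥0∞) (hc : c ≠ ⊤) (hd : d ≠ ⊤) :
    (c • μ + d • ρ).prod (c • μ + d • ρ)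
      = ((c * c) • μ.prod μ + (c * d) • μ.prod ρ)
        + ((d * c) • ρ.prod μ + (d * d) • ρ.prod ρ) := by
  have := μ.smul_finite hc
  have := ρ.smul_finite hd
  rw [Measure.add_prod, Measure.prod_add, Measure.prod_add]
  simp only [Measure.prod_smul_left, Measure.prod_smul_right, smul_smul]
  rw [mul_comm d c]

lemma LogFinite.mixture (h1 : LogFinite μ μ) (h2 : LogFinite μ ρ) (h3 : LogFinite ρ ρ)
    {t : ℝ} (ht : 0 ≤ t) (ht1 : t ≤ 1) :
    LogFinite (ENNReal.ofReal (1 - t) • μ + ENNReal.ofReal t • ρ)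
      (ENNReal.ofReal (1 - t) • μ + ENNReal.ofReal t • ρ) ∧
    logEnergy (ENNReal.ofReal (1 - t) • μ + ENNReal.ofReal t • ρ)
      (ENNReal.ofReal (1 - t) • μ + ENNReal.ofReal t • ρ)
      = (1 - t) ^ 2 * logEnergy μ μ + 2 * (t * (1 - t)) * logEnergy μ ρ
        + t ^ 2 * logEnergy ρ ρ := by
  unfold LogFinite logEnergy
  rw [prod_mixture _ _ ENNReal.ofReal_ne_top ENNReal.ofReal_ne_top]
  have hfin : ∀ x y : ℝ, ENNReal.ofReal x * ENNReal.ofReal y ≠ ⊤ := fun x y =>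
    ENNReal.mul_ne_top ENNReal.ofReal_ne_top ENNReal.ofReal_ne_top
  have i1 := h1.2.smul_measure (hfin (1 - t) (1 - t))
  have i2 := h2.2.smul_measure (hfin (1 - t) t)
  have i3 := h2.symm.2.smul_measure (hfin t (1 - t))
  have i4 := h3.2.smul_measure (hfin t t)
  refine ⟨⟨?_, (i1.add_measure i2).add_measure (i3.add_measure i4)⟩, ?_⟩
  · simp only [ae_add_measure_iff]
    exact ⟨⟨Measure.ae_smul_measure h1.1 _, Measure.ae_smul_measure h2.1 _⟩,
      Measure.ae_smul_measure h2.symm.1 _, Measure.ae_smul_measure h3.1 _⟩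
  · rw [integral_add_measure (i1.add_measure i2) (i3.add_measure i4),
      integral_add_measure i1 i2, integral_add_measure i3 i4]
    simp only [integral_smul_measure, ENNReal.toReal_mul, ENNReal.toReal_ofReal ht,
      ENNReal.toReal_ofReal (sub_nonneg.2 ht1), smul_eq_mul]
    rw [integral_log_symm μ ρ]
    ring

/-- First-order optimality of an equilibrium measure, tested against a measure of finite
logarithmic energy. -/
lemma IsEquilibriumMeasure.le_of_logFinite {V : ℝ → ℝ} {S : Set ℝ} {M : ℝ} (hV : Continuous V)
    (hμ : IsEquilibriumMeasure V S μ) (hμM : ∀ᵐ x ∂μ, |x| ≤ M) (hρM : ∀ᵐ x ∂ρ, |x| ≤ M)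
    (hρS : ∀ᵐ x ∂ρ, x ∈ S) (h1 : LogFinite μ μ) (h2 : LogFinite μ ρ) (h3 : LogFinite ρ ρ) :
    (∫ x, V x ∂μ) / 2 - logEnergy μ μ ≤ (∫ x, V x ∂ρ) / 2 - logEnergy μ ρ := by
  have key : ∀ t : ℝ, 0 < t → t ≤ 1 →
      0 ≤ ((∫ x, V x ∂ρ) - (∫ x, V x ∂μ) + 2 * logEnergy μ μ - 2 * logEnergy μ ρ)
        + t * (2 * logEnergy μ ρ - logEnergy μ μ - logEnergy ρ ρ) := by
    intro t ht ht1
    set ν := ENNReal.ofReal (1 - t) • μ + ENNReal.ofReal t • ρ with hν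
    have hprob : IsProbabilityMeasure ν := ⟨by
      simp only [hν, Measure.add_apply, Measure.smul_apply, measure_univ, smul_eq_mul, mul_one]
      rw [← ENNReal.ofReal_add (sub_nonneg.2 ht1) ht.le]
      simp⟩
    have hνM : ∀ᵐ x ∂ν, |x| ≤ M := by
      rw [hν, ae_add_measure_iff]
      exact ⟨Measure.ae_smul_measure hμM _, Measure.ae_smul_measure hρM _⟩
    have hνS : ν Sᶜ = 0 := by
      have h4 : ρ Sᶜ = 0 := hρS
      simp only [hν, Measure.add_apply, Measure.smul_apply, hμ.2.1, h4, smul_zero, add_zero]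
    obtain ⟨h5, h6⟩ := h1.mixture h2 h3 ht.le ht1
    have h7 := hμ.2.2 ν hprob hνS
    rw [energy_eq hV hμM h1, energy_eq hV hνM h5, h6, EReal.coe_le_coe_iff, hν,
      integral_add_measure ((integrable_of_abs_le hV hμM).smul_measure ENNReal.ofReal_ne_top)
        ((integrable_of_abs_le hV hρM).smul_measure ENNReal.ofReal_ne_top)] at h7
    simp only [integral_smul_measure, ENNReal.toReal_ofReal ht.le,
      ENNReal.toReal_ofReal (sub_nonneg.2 ht1), smul_eq_mul] at h7
    by_contra! hneg
    nlinarith [mul_neg_of_pos_of_neg ht hneg]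
  have hlim : Tendsto (fun t : ℝ =>
      ((∫ x, V x ∂ρ) - (∫ x, V x ∂μ) + 2 * logEnergy μ μ - 2 * logEnergy μ ρ)
        + t * (2 * logEnergy μ ρ - logEnergy μ μ - logEnergy ρ ρ)) (𝓝[>] 0)
      (𝓝 (((∫ x, V x ∂ρ) - (∫ x, V x ∂μ) + 2 * logEnergy μ μ - 2 * logEnergy μ ρ)
        + 0 * (2 * logEnergy μ ρ - logEnergy μ μ - logEnergy ρ ρ))) :=
    (Continuous.tendsto (by fun_prop) 0).mono_left nhdsWithin_le_nhds
  have h1 : ∀ᶠ t : ℝ in 𝓝[>] 0, t < 1 :=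
    (eventually_lt_nhds one_pos).filter_mono nhdsWithin_le_nhds
  have := ge_of_tendsto hlim (by
    filter_upwards [self_mem_nhdsWithin, h1] with t ht ht1 using key t ht ht1.le)
  linarith

end Mixture

/-! ### The minimum of the effective potential -/

section Minimum

variable {V : ℝ → ℝ} {S : Set ℝ} {μ : Measure ℝ} [IsProbabilityMeasure μ] {M κ C : ℝ}

lemma growth_regPot (hμ : ∀ᵐ ξ ∂μ, |ξ| ≤ M)
    (hconf : ∀ x ∈ S, (1 + κ) * Real.log (1 + |x|) - C ≤ V x / 2) {h : ℝ} (hh : 0 < h)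
    (h1 : h ≤ 1) {x : ℝ} (hx : x ∈ S) :
    κ * Real.log (1 + |x|) - (C + Real.log (1 + M)) ≤ regPot h V μ x := by
  have := le_regPot (V := V) hh h1 hμ x
  linarith [hconf x hx]

lemma exists_log_one_add_gt (hκ : 0 < κ) (B : ℝ) :
    ∃ r : ℝ, 0 ≤ r ∧ ∀ x : ℝ, r < |x| → B < κ * Real.log (1 + |x|) := by
  refine ⟨Real.exp (B / κ), (Real.exp_pos _).le, fun x hx => ?_⟩
  rw [← div_lt_iff₀' hκ, Real.lt_log_iff_exp_lt (by positivity)]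
  linarith

lemma scale_pos (n : ℕ) : 0 < 1 / ((n : ℝ) + 1) := Nat.one_div_pos_of_nat

lemma scale_le_one (n : ℕ) : 1 / ((n : ℝ) + 1) ≤ 1 := by
  have : (1 : ℝ) ≤ n + 1 := by linarith [n.cast_nonneg (α := ℝ)]
  exact (div_le_one (by linarith)).2 this

/-- The effective potential is lower semicontinuous and confining, so it has a minimizer. -/
lemma exists_min_effPotential (hS : IsClosed S) (hV : Continuous V) (hμ : ∀ᵐ ξ ∂μ, |ξ| ≤ M)
    (hμS : ∀ᵐ ξ ∂μ, ξ ∈ S) (hκ : 0 < κ)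
    (hconf : ∀ x ∈ S, (1 + κ) * Real.log (1 + |x|) - C ≤ V x / 2) (hfin : LogFinite μ μ) :
    ∃ x₀ ∈ S, ∃ m : ℝ, effPotential V S μ x₀ = m ∧ ∀ y, (m : EReal) ≤ effPotential V S μ y := by
  obtain ⟨x₁, hx₁S, hx₁ne, hx₁int⟩ : ∃ x₁, x₁ ∈ S ∧ (∀ᵐ ξ ∂μ, x₁ ≠ ξ) ∧
      Integrable (fun ξ => Real.log |x₁ - ξ|) μ :=
    (hμS.and ((Measure.ae_ae_of_ae_prod hfin.1).and hfin.2.prod_right_ae)).exists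
  set m₁ := V x₁ / 2 - ∫ ξ, Real.log |x₁ - ξ| ∂μ with hm₁
  have hJ₁ : effPotential V S μ x₁ = m₁ := effPotential_of_integrable hx₁S hx₁ne hx₁int
  obtain ⟨r, hr, hr2⟩ := exists_log_one_add_gt hκ (C + Real.log (1 + M) + m₁)
  let F : ℝ → EReal := fun x => ⨆ n : ℕ, (regPot (1 / ((n : ℝ) + 1)) V μ x : EReal)
  have hF : LowerSemicontinuous F := lowerSemicontinuous_iSup fun n =>
    (continuous_coe_real_ereal.comp (continuous_regPot (scale_pos n) hV hμ)).lowerSemicontinuous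
  have hFJ : ∀ x ∈ S, F x = effPotential V S μ x := by
    intro x hx
    refine le_antisymm (iSup_le fun n => regPot_le_effPotential (scale_pos n) hμ x) ?_
    rcases eq_or_ne (F x) ⊤ with htop | htop
    · rw [htop]; exact le_top
    · have h0 : (regPot (1 / (((0 : ℕ) : ℝ) + 1)) V μ x : EReal) ≤ F x :=
        le_iSup (fun n : ℕ => (regPot (1 / ((n : ℝ) + 1)) V μ x : EReal)) 0
      have hbot : F x ≠ ⊥ := ne_bot_of_le_ne_bot (EReal.coe_ne_bot _) h0
      rw [← EReal.coe_toReal htop hbot]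
      refine effPotential_le_of_regPot_le hμ hx fun n => ?_
      rw [← EReal.coe_le_coe_iff, EReal.coe_toReal htop hbot]
      exact le_iSup (fun n : ℕ => (regPot (1 / ((n : ℝ) + 1)) V μ x : EReal)) n
  have hout : ∀ x, x ∉ S ∩ Set.Icc (-(max r |x₁|)) (max r |x₁|) →
      effPotential V S μ x₁ ≤ effPotential V S μ x := by
    intro x hx
    by_cases hxS : x ∈ S
    · have hxr : r < |x| := by
        by_contra! h
        exact hx ⟨hxS, abs_le.1 (h.trans (le_max_left _ _))⟩
      refine le_trans ?_ (regPot_le_effPotential one_pos hμ x)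
      rw [hJ₁, EReal.coe_le_coe_iff]
      linarith [growth_regPot hμ hconf one_pos le_rfl hxS, hr2 x hxr]
    · rw [effPotential, effPotential, if_neg hxS]; exact le_top
  have hK : IsCompact (S ∩ Set.Icc (-(max r |x₁|)) (max r |x₁|)) :=
    isCompact_Icc.inter_left hS
  obtain ⟨x₀, hx₀, hmin⟩ := LowerSemicontinuousOn.exists_isMinOn
    (s := S ∩ Set.Icc (-(max r |x₁|)) (max r |x₁|))
    ⟨x₁, hx₁S, abs_le.1 (le_max_right _ _)⟩ hK (hF.lowerSemicontinuousOn _)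
  have hle : ∀ y, effPotential V S μ x₀ ≤ effPotential V S μ y := by
    have h1 : ∀ y ∈ S ∩ Set.Icc (-(max r |x₁|)) (max r |x₁|),
        effPotential V S μ x₀ ≤ effPotential V S μ y := fun y hy => by
      rw [← hFJ x₀ hx₀.1, ← hFJ y hy.1]; exact hmin hy
    intro y
    by_cases hy : y ∈ S ∩ Set.Icc (-(max r |x₁|)) (max r |x₁|)
    · exact h1 y hy
    · exact (h1 x₁ ⟨hx₁S, abs_le.1 (le_max_right _ _)⟩).trans (hout y hy)
  have htop : effPotential V S μ x₀ ≠ ⊤ :=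
    ne_top_of_le_ne_top (hJ₁ ▸ EReal.coe_ne_top _) (hle x₁)
  have hbot : effPotential V S μ x₀ ≠ ⊥ :=
    ne_bot_of_le_ne_bot (EReal.coe_ne_bot _) (regPot_le_effPotential one_pos hμ x₀)
  refine ⟨x₀, hx₀.1, (effPotential V S μ x₀).toReal, (EReal.coe_toReal htop hbot).symm, ?_⟩
  rw [EReal.coe_toReal htop hbot]
  exact hle

/-- The minimum of the regularized effective potential converges to the minimum of the effective
potential, by Dini's compactness argument. -/
lemma exists_regPot_ge (hS : IsClosed S) (hV : Continuous V) (hμ : ∀ᵐ ξ ∂μ, |ξ| ≤ M)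
    (hκ : 0 < κ) (hconf : ∀ x ∈ S, (1 + κ) * Real.log (1 + |x|) - C ≤ V x / 2) {m : ℝ}
    (hm : ∀ y, (m : EReal) ≤ effPotential V S μ y) {s : ℝ} (hs : 0 < s) :
    ∃ h₀ : ℝ, 0 < h₀ ∧ ∀ h, 0 < h → h ≤ h₀ → ∀ x ∈ S, m - s ≤ regPot h V μ x := by
  obtain ⟨r, hr, hr2⟩ := exists_log_one_add_gt hκ (C + Real.log (1 + M) + m)
  have hK : IsCompact (S ∩ Set.Icc (-r) r) := isCompact_Icc.inter_left hS
  obtain ⟨n, hn⟩ := hK.elim_directed_cover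
    (fun n : ℕ => {x | m - s < regPot (1 / ((n : ℝ) + 1)) V μ x})
    (fun n => isOpen_lt continuous_const (continuous_regPot (scale_pos n) hV hμ))
    (by
      intro x hx
      by_contra! hcon
      simp only [Set.mem_iUnion, Set.mem_ofPred_eq, not_exists, not_lt] at hcon
      have h1 := (hm x).trans (effPotential_le_of_regPot_le hμ hx.1 hcon)
      rw [EReal.coe_le_coe_iff] at h1
      linarith)
    (by
      refine Monotone.directed_le fun i j hij x hx => ?_
      exact lt_of_lt_of_le hx
        (regPot_anti (scale_pos j) (Nat.one_div_le_one_div hij) hμ x))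
  refine ⟨1 / ((n : ℝ) + 1), scale_pos n, fun h hh hle x hx => ?_⟩
  refine le_trans ?_ (regPot_anti hh hle hμ x)
  by_cases hxr : |x| ≤ r
  · exact (hn ⟨hx, abs_le.1 hxr⟩).le
  · push Not at hxr
    linarith [growth_regPot hμ hconf (scale_pos n) (scale_le_one n) hx, hr2 x hxr]

/-- On a closed set away from the support that contains no minimizer, the effective potential
exceeds its minimum by a positive gap, which moreover grows logarithmically. -/
lemma exists_gap {A : Set ℝ} (hA : IsClosed A) (hAS : A ⊆ S) (hV : Continuous V)
    (hμ : ∀ᵐ ξ ∂μ, |ξ| ≤ M) (hκ : 0 < κ)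
    (hconf : ∀ x ∈ S, (1 + κ) * Real.log (1 + |x|) - C ≤ V x / 2) {m : ℝ} {ε : ℝ}
    (hε : 0 < ε) (hε1 : ε ≤ 1) (hfar : ∀ x ∈ A, ∀ᵐ ξ ∂μ, ε ≤ |x - ξ|)
    (hmA : ∀ y ∈ A, (m : EReal) < effPotential V S μ y) :
    ∃ δ > 0, ∃ κ' > 0, ∀ x ∈ A, m + δ + κ' * Real.log (1 + |x|) ≤ regPot ε V μ x := by
  have heq : ∀ x ∈ A, ∀ h, 0 < h → regPot h V μ x ≤ regPot ε V μ x := by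
    intro x hx h hh
    rcases le_total ε h with hle | hle
    · exact regPot_anti hε hle hμ x
    · unfold regPot
      refine le_of_eq ?_
      congr 1
      refine integral_congr_ae ((hfar x hx).mono fun ξ hξ => ?_)
      dsimp only
      rw [regLog_of_le hε hξ, regLog_of_le hh (hle.trans hξ)]
  have hlt : ∀ x ∈ A, m < regPot ε V μ x := by
    intro x hx
    have h1 := effPotential_le_of_regPot_le hμ (hAS hx) fun n => heq x hx _ (scale_pos n)
    exact EReal.coe_lt_coe_iff.1 ((hmA x hx).trans_le h1)
  obtain ⟨r, hr, hr2⟩ := exists_log_one_add_gt (half_pos hκ) (C + Real.log (1 + M) + m + 1)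
  have hK : IsCompact (A ∩ Set.Icc (-r) r) := isCompact_Icc.inter_left hA
  obtain ⟨δ₀, hδ₀, hδ₀2⟩ : ∃ δ₀ > 0, ∀ x ∈ A ∩ Set.Icc (-r) r, m + δ₀ ≤ regPot ε V μ x := by
    rcases (A ∩ Set.Icc (-r) r).eq_empty_or_nonempty with he | hne
    · exact ⟨1, one_pos, by simp [he]⟩
    · obtain ⟨y, hy, hmin⟩ := hK.exists_isMinOn hne (continuous_regPot hε hV hμ).continuousOn
      refine ⟨regPot ε V μ y - m, sub_pos.2 (hlt y hy.1), fun x hx => ?_⟩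
      have := hmin hx
      simp only [Set.mem_ofPred_eq] at this
      linarith
  have hlr : 0 ≤ Real.log (1 + r) := Real.log_nonneg (by linarith)
  refine ⟨min 1 (δ₀ / 2), by positivity, min (κ / 2) (δ₀ / (2 * (Real.log (1 + r) + 1))),
    by positivity, fun x hx => ?_⟩
  have hlx := log_one_add_abs_nonneg x
  by_cases hxr : |x| ≤ r
  · have h1 := hδ₀2 x ⟨hx, abs_le.1 hxr⟩
    have h2 := log_one_add_abs_le hxr
    have h3 : min (κ / 2) (δ₀ / (2 * (Real.log (1 + r) + 1))) * Real.log (1 + |x|) ≤ δ₀ / 2 := by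
      calc min (κ / 2) (δ₀ / (2 * (Real.log (1 + r) + 1))) * Real.log (1 + |x|)
          ≤ δ₀ / (2 * (Real.log (1 + r) + 1)) * (Real.log (1 + r) + 1) :=
            mul_le_mul (min_le_right _ _) (by linarith) hlx (by positivity)
        _ = δ₀ / 2 := by field_simp
    linarith [min_le_right 1 (δ₀ / 2)]
  · push Not at hxr
    have h1 := growth_regPot hμ hconf hε hε1 (hAS hx)
    have h2 := hr2 x hxr
    have h3 : min (κ / 2) (δ₀ / (2 * (Real.log (1 + r) + 1))) * Real.log (1 + |x|)
        ≤ κ / 2 * Real.log (1 + |x|) := mul_le_mul_of_nonneg_right (min_le_left _ _) hlx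
    linarith [min_le_left 1 (δ₀ / 2)]

end Minimum

/-! ### Trial measures with bounded density -/

section Trial

variable {V : ℝ → ℝ} {S : Set ℝ} {μ : Measure ℝ} [IsProbabilityMeasure μ] {M a b : ℝ}

/-- A probability measure on `S ∩ [-M, M]` with bounded density. -/
structure IsTrial (S : Set ℝ) (M : ℝ) (ρ : Measure ℝ) : Prop where
  prob : IsProbabilityMeasure ρ
  ae_mem : ∀ᵐ x ∂ρ, x ∈ S
  abs_le : ∀ᵐ x ∂ρ, |x| ≤ M
  density : ∃ C : ℝ, 0 < C ∧ ρ ≤ ENNReal.ofReal C • volume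

lemma isTrial_smoothing (hS : IsClosed S) (hconv : Convex ℝ S) (hab : a < b)
    (habS : Set.Icc a b ⊆ S) (habM : Set.Icc a b ⊆ Set.Icc (-M) M) {P : Measure ℝ}
    [IsProbabilityMeasure P] (hP : ∀ᵐ x ∂P, |x| ≤ M) (hPS : ∀ᵐ x ∂P, x ∈ S) {t : ℝ} (ht : 0 < t)
    (ht1 : t ≤ 1) : IsTrial S M (smoothing a b t P) where
  prob := isProbabilityMeasure_smoothing hab
  ae_mem := ae_smoothing_mem hab ht ht1 hS.measurableSet hconv habS hPS
  abs_le := ae_smoothing_abs_le hab ht ht1 habM hP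
  density := ⟨_, by have := sub_pos.2 hab; positivity, smoothing_le hab ht⟩

lemma IsTrial.logFinite {ρ : Measure ℝ} (h : IsTrial S M ρ) (hμ : ∀ᵐ x ∂μ, |x| ≤ M) :
    LogFinite μ ρ := by
  have := h.prob
  obtain ⟨C, -, hC⟩ := h.density
  exact logFinite_of_le hμ h.abs_le ENNReal.ofReal_ne_top hC

/-- The energy of the equilibrium measure is finite. -/
lemma IsEquilibriumMeasure.logFinite (hS : IsClosed S) (hV : Continuous V) (hconv : Convex ℝ S)
    (hab : a < b) (habS : Set.Icc a b ⊆ S) (habM : Set.Icc a b ⊆ Set.Icc (-M) M)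
    (hμ : IsEquilibriumMeasure V S μ) (hμM : ∀ᵐ x ∂μ, |x| ≤ M) : LogFinite μ μ := by
  have hρ := isTrial_smoothing hS hconv hab habS habM hμM hμ.2.1 one_pos le_rfl
  have := hρ.prob
  refine logFinite_of_energy_ne_top hV hμM (ne_top_of_le_ne_top ?_ (hμ.2.2 _ hρ.prob hρ.ae_mem))
  rw [energy_eq hV hρ.abs_le (hρ.logFinite hρ.abs_le)]
  exact EReal.coe_ne_top _

lemma exists_small_scale {f : ℝ → ℝ} {l s : ℝ} (hf : Tendsto f (𝓝[>] 0) (𝓝 l)) (hs : 0 < s) :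
    ∃ t : ℝ, 0 < t ∧ t ≤ 1 ∧ f t ≤ l + s := by
  have h1 : ∀ᶠ t : ℝ in 𝓝[>] 0, t < 1 :=
    (eventually_lt_nhds one_pos).filter_mono nhdsWithin_le_nhds
  have h2 : ∀ᶠ t : ℝ in 𝓝[>] 0, 0 < t := self_mem_nhdsWithin
  obtain ⟨t, ht1, ht, hft⟩ := (h1.and (h2.and (hf.eventually_lt_const (by linarith :
    l < l + s)))).exists
  exact ⟨t, ht, ht1.le, hft.le⟩

lemma exists_trial_energy (hS : IsClosed S) (hV : Continuous V) (hconv : Convex ℝ S)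
    (hab : a < b) (habS : Set.Icc a b ⊆ S) (habM : Set.Icc a b ⊆ Set.Icc (-M) M)
    (hμS : ∀ᵐ x ∂μ, x ∈ S) (hμM : ∀ᵐ x ∂μ, |x| ≤ M) (hfin : LogFinite μ μ) {s : ℝ}
    (hs : 0 < s) :
    ∃ ν, IsTrial S M ν ∧
      ∫ x, V x ∂ν - logEnergy ν ν ≤ ∫ x, V x ∂μ - logEnergy μ μ + s := by
  obtain ⟨t, ht, ht1, hle⟩ := exists_small_scale ((tendsto_integral_smoothing hab habM hμM hV).sub
    (tendsto_integral_log_smoothing hab habM hμM hfin)) hs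
  exact ⟨_, isTrial_smoothing hS hconv hab habS habM hμM hμS ht ht1, hle⟩

lemma exists_trial_potential (hS : IsClosed S) (hV : Continuous V) (hconv : Convex ℝ S)
    (hab : a < b) (habS : Set.Icc a b ⊆ S) (habM : Set.Icc a b ⊆ Set.Icc (-M) M)
    (hμM : ∀ᵐ x ∂μ, |x| ≤ M) {x₀ m : ℝ} (hx₀M : |x₀| ≤ M)
    (hx₀ : effPotential V S μ x₀ = m) {s : ℝ} (hs : 0 < s) :
    ∃ ρ, IsTrial S M ρ ∧ (∫ x, V x ∂ρ) / 2 - logEnergy ρ μ ≤ m + s := by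
  obtain ⟨hx₀S, hne, hint⟩ := of_effPotential_ne_top hμM (hx₀ ▸ EReal.coe_ne_top m)
  have hdM : ∀ᵐ x ∂(Measure.dirac x₀), |x| ≤ M := by
    rw [ae_dirac_iff (measurableSet_le (by fun_prop) (by fun_prop))]; exact hx₀M
  have hdS : ∀ᵐ x ∂(Measure.dirac x₀), x ∈ S := (ae_dirac_iff hS.measurableSet).2 hx₀S
  have hfin : LogFinite (Measure.dirac x₀) μ := by
    unfold LogFinite
    rw [Measure.dirac_prod]
    refine ⟨(ae_map_iff (p := fun p : ℝ × ℝ => p.1 ≠ p.2) (by fun_prop)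
      (measurableSet_eq_fun measurable_fst measurable_snd).compl).2 hne, ?_⟩
    rw [integrable_map_measure measurable_log_abs_sub.aestronglyMeasurable (by fun_prop)]
    exact hint
  have hlog : logEnergy (Measure.dirac x₀) μ = ∫ ξ, Real.log |x₀ - ξ| ∂μ := by
    rw [logEnergy, Measure.dirac_prod,
      integral_map (by fun_prop) measurable_log_abs_sub.aestronglyMeasurable]
  rw [effPotential_of_integrable hx₀S hne hint, EReal.coe_eq_coe_iff] at hx₀
  obtain ⟨t, ht, ht1, hle⟩ := exists_small_scale
    (((tendsto_integral_smoothing hab habM hdM hV).div_const 2).sub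
    (tendsto_integral_log_smoothing_left hab habM hdM hμM hfin)) hs
  refine ⟨_, isTrial_smoothing hS hconv hab habS habM hdM hdS ht ht1, ?_⟩
  have h2 : ∫ p, Real.log |p.1 - p.2| ∂((Measure.dirac x₀).prod μ) = ∫ ξ, Real.log |x₀ - ξ| ∂μ :=
    hlog
  rw [integral_dirac, h2, hx₀] at hle
  exact hle

/-- The Euler-Lagrange inequality: the mean of the effective potential under the equilibrium
measure does not exceed its minimum. -/
lemma IsEquilibriumMeasure.mean_le (hS : IsClosed S) (hV : Continuous V) (hconv : Convex ℝ S)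
    (hab : a < b) (habS : Set.Icc a b ⊆ S) (habM : Set.Icc a b ⊆ Set.Icc (-M) M)
    (hμ : IsEquilibriumMeasure V S μ) (hμM : ∀ᵐ x ∂μ, |x| ≤ M) (hfin : LogFinite μ μ)
    {x₀ m : ℝ} (hx₀M : |x₀| ≤ M) (hx₀ : effPotential V S μ x₀ = m) :
    (∫ x, V x ∂μ) / 2 - logEnergy μ μ ≤ m := by
  refine le_of_forall_pos_le_add fun s hs => ?_
  obtain ⟨ρ, hρ, hle⟩ :=
    exists_trial_potential hS hV hconv hab habS habM hμM hx₀M hx₀ hs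
  have := hρ.prob
  have h1 := hμ.le_of_logFinite hV hμM hρ.abs_le hρ.ae_mem hfin (hρ.logFinite hμM)
    (hρ.logFinite hρ.abs_le)
  have h2 : logEnergy ρ μ = logEnergy μ ρ := integral_log_symm μ ρ
  linarith

end Trial

/-! ### Configurations of points as measures -/

/-- The regularized mutual energy `∬ regLog h (x - y) dP(x) dQ(y)`. -/
noncomputable def regEnergy (h : ℝ) (P Q : Measure ℝ) : ℝ := ∫ x, ∫ y, regLog h (x - y) ∂Q ∂P

/-- The normalized empirical measure of a configuration of points. -/
noncomputable def empirical {n : ℕ} (l : Fin n → ℝ) : Measure ℝ :=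
  (n : ℝ≥0∞)⁻¹ • ∑ j, Measure.dirac (l j)

section Empirical

variable {n : ℕ} (l : Fin n → ℝ)

lemma isProbabilityMeasure_empirical (hn : 0 < n) : IsProbabilityMeasure (empirical l) := ⟨by
  simp only [empirical, Measure.smul_apply, Measure.finsetSum_apply, measure_univ, Finset.sum_const,
    Finset.card_univ, Fintype.card_fin, nsmul_eq_mul, mul_one, smul_eq_mul]
  exact ENNReal.inv_mul_cancel (by exact_mod_cast hn.ne') (ENNReal.natCast_ne_top n)⟩

lemma ae_empirical {p : ℝ → Prop} (hp : MeasurableSet {x | p x}) (h : ∀ j, p (l j)) :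
    ∀ᵐ x ∂(empirical l), p x := by
  refine Measure.ae_smul_measure ?_ _
  rw [ae_iff, Measure.finsetSum_apply, Finset.sum_eq_zero]
  exact fun j _ => (ae_dirac_iff hp).2 (h j)

lemma exists_abs_le_empirical : ∃ r : ℝ, ∀ᵐ x ∂(empirical l), |x| ≤ r := by
  refine ⟨∑ j, |l j|, ae_empirical l (measurableSet_le (by fun_prop) (by fun_prop)) fun j => ?_⟩
  exact Finset.single_le_sum (f := fun j => |l j|) (fun _ _ => abs_nonneg _) (Finset.mem_univ j)

lemma integral_empirical (f : ℝ → ℝ) : ∫ x, f x ∂(empirical l) = (n : ℝ)⁻¹ * ∑ j, f (l j) := by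
  rw [empirical, integral_smul_measure, integral_finsetSum_measure]
  · simp
  · exact fun j _ => integrable_dirac (by simp)

lemma integrable_empirical (f : ℝ → ℝ) : Integrable f (empirical l) := by
  rcases Nat.eq_zero_or_pos n with rfl | hn
  · simp [empirical]
  · refine Integrable.smul_measure ?_ (ENNReal.inv_ne_top.2 (by exact_mod_cast hn.ne'))
    rw [integrable_finsetSum_measure]
    exact fun j _ => integrable_dirac (by simp)

end Empirical

section RegEnergy

variable {h M M' : ℝ} {P Q : Measure ℝ} [IsProbabilityMeasure P] [IsProbabilityMeasure Q]

lemma regEnergy_symm (hh : 0 < h) (hP : ∀ᵐ x ∂P, |x| ≤ M) (hQ : ∀ᵐ x ∂Q, |x| ≤ M') :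
    regEnergy h P Q = regEnergy h Q P := by
  unfold regEnergy
  rw [integral_integral_swap (integrable_regLog hh hP hQ)]
  simp_rw [regLog_symm]

lemma regEnergy_le (hh : 0 < h) (hP : ∀ᵐ x ∂P, |x| ≤ M) (hQ : ∀ᵐ x ∂Q, |x| ≤ M') :
    regEnergy h P Q ≤ 1 - Real.log h := by
  unfold regEnergy
  rw [integral_integral (integrable_regLog hh hP hQ)]
  have := integral_mono (integrable_regLog hh hP hQ) (integrable_const (1 - Real.log h))
    fun p => regLog_le hh _
  simpa using this

lemma regEnergy_le_neg_logEnergy (hh : 0 < h) (hP : ∀ᵐ x ∂P, |x| ≤ M)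
    (hQ : ∀ᵐ x ∂Q, |x| ≤ M') (hfin : LogFinite P Q) : regEnergy h P Q ≤ -logEnergy P Q := by
  unfold regEnergy
  rw [integral_integral (integrable_regLog hh hP hQ), logEnergy, ← integral_neg]
  exact integral_mono_ae (integrable_regLog hh hP hQ) hfin.2.neg
    (hfin.1.mono fun p hp => regLog_le_neg_log hh (sub_ne_zero.2 hp))

lemma lintegral_log_div_le (hh : 0 < h) :
    ∫⁻ z : ℝ, ENNReal.ofReal (Real.log h - Real.log |z|) ≤ ENNReal.ofReal (2 * h) := by
  have h1 : ∀ z : ℝ, ENNReal.ofReal (Real.log h - Real.log |z|)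
      ≤ Set.indicator (Set.Ioc (-h) h) (fun z => ENNReal.ofReal (Real.log h - Real.log z)) z := by
    intro z
    by_cases hz : z ∈ Set.Ioc (-h) h
    · rw [Set.indicator_of_mem hz, Real.log_abs]
    · rw [Set.indicator_of_notMem hz]
      have h2 : h ≤ |z| := by
        by_contra! h
        exact hz ⟨(abs_lt.1 h).1, (abs_lt.1 h).2.le⟩
      rw [ENNReal.ofReal_of_nonpos (by linarith [Real.log_le_log hh h2])]
  refine (lintegral_mono h1).trans ?_
  have hi : IntervalIntegrable (fun z => Real.log h - Real.log z) volume (-h) h :=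
    intervalIntegrable_const.sub intervalIntegral.intervalIntegrable_log'
  rw [lintegral_indicator measurableSet_Ioc, ← ofReal_integral_eq_lintegral_ofReal
    ((intervalIntegrable_iff_integrableOn_Ioc_of_le (by linarith)).1 hi)]
  · rw [← intervalIntegral.integral_of_le (by linarith), intervalIntegral.integral_sub
      intervalIntegrable_const intervalIntegral.intervalIntegrable_log', integral_log,
      Real.log_neg_eq_log]
    refine ENNReal.ofReal_le_ofReal (le_of_eq ?_)
    simp
    ring
  · rw [EventuallyLE, ae_restrict_iff' measurableSet_Ioc]
    have h0 : ∀ᵐ z : ℝ, z ≠ 0 := by simp [ae_iff]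
    filter_upwards [h0] with z hz0 hz
    have := Real.log_le_log (abs_pos.2 hz0) (abs_le.2 ⟨hz.1.le, hz.2⟩)
    rw [Real.log_abs] at this
    simpa using this

/-- The tangent-line truncation costs an amount proportional to the scale, for measures with
bounded density. -/
lemma neg_integral_log_le {C : ℝ} (hC : 0 < C) {ρ : Measure ℝ} [IsProbabilityMeasure ρ]
    (hρ : ρ ≤ ENNReal.ofReal C • volume) (hρM : ∀ᵐ x ∂ρ, |x| ≤ M) (hh : 0 < h) (y : ℝ) :
    Integrable (fun x => Real.log |x - y|) ρ ∧
    -∫ x, Real.log |x - y| ∂ρ ≤ ∫ x, regLog h (x - y) ∂ρ + C * (2 * h) := by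
  have hreg : Integrable (fun x => regLog h (x - y)) ρ := by
    simpa only [regLog_symm] using integrable_regLog_right hh hρM y
  have hnn : 0 ≤ᵐ[ρ] fun x => -Real.log |x - y| - regLog h (x - y) :=
    (ae_ne_of_le hρ y).mono fun x hx => sub_nonneg.2 (regLog_le_neg_log hh (sub_ne_zero.2 hx))
  have hm : Measurable fun x => -Real.log |x - y| - regLog h (x - y) := by
    have := (continuous_regLog hh).measurable
    fun_prop
  have hbd : ∫⁻ x, ENNReal.ofReal (-Real.log |x - y| - regLog h (x - y)) ∂ρ
      ≤ ENNReal.ofReal (C * (2 * h)) := by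
    calc ∫⁻ x, ENNReal.ofReal (-Real.log |x - y| - regLog h (x - y)) ∂ρ
        ≤ ∫⁻ x, ENNReal.ofReal (Real.log h - Real.log |x - y|) ∂ρ := by
          refine lintegral_mono_ae ((ae_ne_of_le hρ y).mono fun x hx => ?_)
          have hxy := sub_ne_zero.2 hx
          rcases le_total h |x - y| with hle | hle
          · rw [regLog_of_le hh hle, sub_self, ENNReal.ofReal_zero]
            exact zero_le
          · refine ENNReal.ofReal_le_ofReal ?_
            rw [regLog_of_ge hle]
            have : |x - y| / h ≤ 1 := (div_le_one hh).2 hle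
            linarith
      _ ≤ ∫⁻ x, ENNReal.ofReal (Real.log h - Real.log |x - y|)
            ∂(ENNReal.ofReal C • volume) := lintegral_mono' hρ le_rfl
      _ = ENNReal.ofReal C * ∫⁻ z : ℝ, ENNReal.ofReal (Real.log h - Real.log |z|) := by
          rw [lintegral_smul_measure, smul_eq_mul]
          congr 1
          exact lintegral_sub_right_eq_self
            (fun z => ENNReal.ofReal (Real.log h - Real.log |z|)) y
      _ ≤ ENNReal.ofReal (C * (2 * h)) := by
          rw [ENNReal.ofReal_mul hC.le]
          gcongr
          exact lintegral_log_div_le hh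
  have hgap : Integrable (fun x => -Real.log |x - y| - regLog h (x - y)) ρ := by
    refine ⟨hm.aestronglyMeasurable, ?_⟩
    rw [hasFiniteIntegral_iff_ofReal hnn]
    exact hbd.trans_lt ENNReal.ofReal_lt_top
  have hlog : Integrable (fun x => Real.log |x - y|) ρ := by
    convert (hgap.add hreg).neg using 1
    ext x; simp
  refine ⟨hlog, ?_⟩
  rw [← ofReal_integral_eq_lintegral_ofReal hgap hnn,
    ENNReal.ofReal_le_ofReal_iff (by positivity),
    integral_sub (show Integrable (fun x => -Real.log |x - y|) ρ from hlog.neg) hreg,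
    integral_neg] at hbd
  linarith

end RegEnergy

/-! ### Deterministic energy estimates -/

section Deterministic

variable {V : ℝ → ℝ} {S : Set ℝ} {μ : Measure ℝ} [IsProbabilityMeasure μ] {M M' : ℝ}

/-- The squared distance between two probability measures in the energy norm of the kernel. -/
noncomputable def regDist (h : ℝ) (P Q : Measure ℝ) : ℝ :=
  regEnergy h P P - 2 * regEnergy h P Q + regEnergy h Q Q

lemma regDist_anti {h h' : ℝ} (hh : 0 < h) (hle : h ≤ h') {P Q : Measure ℝ}
    [IsProbabilityMeasure P] [IsProbabilityMeasure Q] (hP : ∀ᵐ x ∂P, |x| ≤ M)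
    (hQ : ∀ᵐ x ∂Q, |x| ≤ M) : regDist h' P Q ≤ regDist h P Q := by
  have hpr : ∀ i : Fin 2, IsProbabilityMeasure (![P, Q] i) := by
    intro i; fin_cases i <;> assumption
  have hM : ∀ i : Fin 2, ∀ᵐ x ∂(![P, Q] i), |x| ≤ M := by
    intro i; fin_cases i <;> assumption
  have key := regForm_anti hh hle ![P, Q] hM ![1, -1]
  have h1 := regEnergy_symm hh hP hQ
  have h2 := regEnergy_symm (hh.trans_le hle) hP hQ
  simp only [regForm, Fin.sum_univ_two, Matrix.cons_val_zero, Matrix.cons_val_one,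
    ← regEnergy.eq_def] at key
  unfold regDist
  linarith

/-- The inequality between the geometric and the arithmetic mean for the energy pairing of
`P₁ - P₂` with `P₃ - P₄`. -/
lemma regEnergy_pairing_ge {h : ℝ} (hh : 0 < h) {P₁ P₂ P₃ P₄ : Measure ℝ}
    [IsProbabilityMeasure P₁] [IsProbabilityMeasure P₂] [IsProbabilityMeasure P₃]
    [IsProbabilityMeasure P₄] (h1 : ∀ᵐ x ∂P₁, |x| ≤ M) (h2 : ∀ᵐ x ∂P₂, |x| ≤ M)
    (h3 : ∀ᵐ x ∂P₃, |x| ≤ M) (h4 : ∀ᵐ x ∂P₄, |x| ≤ M) {c : ℝ} :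
    0 ≤ regDist h P₁ P₂ + c ^ 2 * regDist h P₃ P₄ +
      2 * c * (regEnergy h P₃ P₁ - regEnergy h P₄ P₁ - regEnergy h P₃ P₂ + regEnergy h P₄ P₂) := by
  have hpr : ∀ i : Fin 4, IsProbabilityMeasure (![P₁, P₂, P₃, P₄] i) := by
    intro i; fin_cases i <;> assumption
  have hM : ∀ i : Fin 4, ∀ᵐ x ∂(![P₁, P₂, P₃, P₄] i), |x| ≤ M := by
    intro i; fin_cases i <;> assumption
  have key := regForm_nonneg hh ![P₁, P₂, P₃, P₄] hM ![1, -1, c, -c] (by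
    simp [Fin.sum_univ_four])
  simp only [regForm, Fin.sum_univ_four, Matrix.cons_val_zero, Matrix.cons_val_one,
    Matrix.cons_val, ← regEnergy.eq_def] at key
  have e1 := regEnergy_symm hh h1 h2
  have e2 := regEnergy_symm hh h1 h3
  have e3 := regEnergy_symm hh h1 h4
  have e4 := regEnergy_symm hh h2 h3
  have e5 := regEnergy_symm hh h2 h4
  have e6 := regEnergy_symm hh h3 h4
  rw [← e1, e2, e3, e4, e5, ← e6] at key
  unfold regDist
  linarith

/-- If the empirical measure is close to the equilibrium measure in energy norm, then its effective
potential on `A` exceeds its mean under the trial measure `ρ` by a definite amount. -/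
lemma regPot_gap_of_regDist_le {A : Set ℝ} {ε δ κ' m h : ℝ} (hδ : 0 < δ) (hκ' : 0 < κ')
    (hh : 0 < h) (hh1 : h ≤ 1) (hhε : h ≤ ε) (hM0 : 0 ≤ M)
    (hμ : ∀ᵐ x ∂μ, |x| ≤ M)
    (hgap : ∀ x ∈ A, m + δ + κ' * Real.log (1 + |x|) ≤ regPot ε V μ x)
    {ρ : Measure ℝ} (hρ : IsTrial S M ρ)
    (hρm : (∫ x, V x ∂ρ) / 2 - logEnergy ρ μ ≤ m + δ / 8) :
    ∃ δ' > 0, ∀ L : Measure ℝ, IsProbabilityMeasure L → (∃ r : ℝ, ∀ᵐ x ∂L, |x| ≤ r) →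
      regDist h L μ ≤ δ' → ∀ x ∈ A,
        (∫ x, V x ∂ρ) / 2 + regEnergy h ρ L + 5 / 8 * δ + κ' / 2 * Real.log (1 + |x|)
          ≤ regPot h V L x := by
  have := hρ.prob
  set D := 2 * (1 - Real.log h) + 2 * Real.log (1 + M) with hD
  have hD0 : 0 < D := by
    have h1 := Real.log_nonpos hh.le hh1
    have h2 := Real.log_nonneg (by linarith : 1 ≤ 1 + M)
    linarith
  -- the weight of `δ_x - ρ` in the pairing inequality: its energy norm, of order
  -- `D + log (1 + |x|)`, must cost at most a part of `δ` and half of the logarithmic growth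
  set c := min (κ' / 2) (δ / (4 * D)) with hc
  have hc0 : 0 < c := by positivity
  refine ⟨c * δ / 4, by positivity, fun L hL ⟨r, hr⟩ hdist x hx => ?_⟩
  have hlx := log_one_add_abs_nonneg x
  set R := max (max M r) |x| with hR
  have hdx : ∀ᵐ y ∂(Measure.dirac x), |y| ≤ R := by
    rw [ae_dirac_iff (measurableSet_le (by fun_prop) (by fun_prop))]
    exact le_max_right _ _
  have hMR : M ≤ R := (le_max_left _ _).trans (le_max_left _ _)
  have hLR : ∀ᵐ y ∂L, |y| ≤ R :=
    hr.mono fun y hy => hy.trans ((le_max_right _ _).trans (le_max_left _ _))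
  have hμR : ∀ᵐ y ∂μ, |y| ≤ R := hμ.mono fun y hy => hy.trans hMR
  have hρR : ∀ᵐ y ∂ρ, |y| ≤ R := hρ.abs_le.mono fun y hy => hy.trans hMR
  have key := regEnergy_pairing_ge hh hLR hμR hdx hρR (c := c)
  -- the energy norm of `δ_x - ρ` grows at most logarithmically in `x`
  have hself : regDist h (Measure.dirac x) ρ ≤ D + 2 * Real.log (1 + |x|) := by
    have h1 := regEnergy_le hh hdx hdx
    have h2 := regEnergy_le hh hρR hρR
    have h3 := integral_mono_ae (integrable_const (-(Real.log (1 + |x|) + Real.log (1 + M))))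
      (integrable_regLog_right hh hρR x) (hρ.abs_le.mono fun ξ hξ => by
        have := neg_log_add_le_regLog hh hh1 x ξ
        have := log_one_add_abs_le hξ
        dsimp only
        linarith)
    simp only [integral_const, probReal_univ, one_smul] at h3
    unfold regDist
    rw [show regEnergy h (Measure.dirac x) ρ = ∫ y, regLog h (x - y) ∂ρ from integral_dirac _ _]
    linarith
  have hpot : ∀ P : Measure ℝ, regPot h V P x = V x / 2 + regEnergy h (Measure.dirac x) P :=
    fun P => by rw [regEnergy, integral_dirac, regPot]
  have h1 := hgap x hx
  have h2 : regPot ε V μ x ≤ regPot h V μ x := regPot_anti hh hhε hμ x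
  have h3 := regEnergy_le_neg_logEnergy hh hρ.abs_le hμ
    (LogFinite.symm (hρ.logFinite hμ))
  rw [hpot] at h2 ⊢
  have h4 : c ^ 2 * regDist h (Measure.dirac x) ρ ≤ c ^ 2 * (D + 2 * Real.log (1 + |x|)) :=
    mul_le_mul_of_nonneg_left hself (sq_nonneg c)
  have h5 : c * D ≤ δ / 4 := by
    calc c * D ≤ δ / (4 * D) * D := mul_le_mul_of_nonneg_right (min_le_right _ _) hD0.le
      _ = δ / 4 := by field_simp
  have h6 : c * Real.log (1 + |x|) ≤ κ' / 2 * Real.log (1 + |x|) :=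
    mul_le_mul_of_nonneg_right (min_le_left _ _) hlx
  have h7 : 0 ≤ c * (δ / 4 + c * D + 2 * (c * Real.log (1 + |x|)) +
      2 * (regEnergy h (Measure.dirac x) L - regEnergy h ρ L - regEnergy h (Measure.dirac x) μ
        + regEnergy h ρ μ)) := by
    refine (key.trans (add_le_add_left (add_le_add hdist h4) _)).trans (le_of_eq ?_)
    ring
  have h8 := (mul_nonneg_iff_of_pos_left hc0).1 h7
  linarith

/-- If the empirical measure is far from the equilibrium measure in energy norm, then its energy
exceeds the minimum by a definite amount. -/
lemma energy_ge_of_regDist {h δ' m s : ℝ} (hh : 0 < h) (hμ : ∀ᵐ x ∂μ, |x| ≤ M)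
    (hfin : LogFinite μ μ) (hmean : (∫ x, V x ∂μ) / 2 - logEnergy μ μ ≤ m)
    (hge : ∀ x ∈ S, m - s ≤ regPot h V μ x) {n : ℕ} (hn : 0 < n) {l : Fin n → ℝ}
    (hl : ∀ j, l j ∈ S) (hdist : δ' ≤ regDist h (empirical l) μ) :
    (n : ℝ) ^ 2 * (∫ x, V x ∂μ - logEnergy μ μ + δ' - 2 * s) ≤
      ∑ i, ∑ j, ((V (l i) + V (l j)) / 2 + regLog h (l i - l j)) := by
  have := isProbabilityMeasure_empirical l hn
  obtain ⟨r, hr⟩ := exists_abs_le_empirical l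
  have hn0 : (0 : ℝ) < n := by exact_mod_cast hn
  have h1 : ∑ i, ∑ j, ((V (l i) + V (l j)) / 2 + regLog h (l i - l j))
      = (n : ℝ) ^ 2 * (∫ x, V x ∂(empirical l) + regEnergy h (empirical l) (empirical l)) := by
    simp only [regEnergy, integral_empirical, ← Finset.mul_sum]
    simp only [Finset.sum_add_distrib, ← Finset.sum_div, Finset.sum_const, Finset.card_univ,
      Fintype.card_fin, nsmul_eq_mul, ← Finset.mul_sum]
    field_simp
    ring
  have h2 : m - s ≤ (∫ x, V x ∂(empirical l)) / 2 + regEnergy h (empirical l) μ := by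
    have h3 : ∫ x, regPot h V μ x ∂(empirical l)
        = (∫ x, V x ∂(empirical l)) / 2 + regEnergy h (empirical l) μ := by
      unfold regPot regEnergy
      rw [integral_add (integrable_empirical l _) (integrable_empirical l _), integral_div]
    rw [← h3, integral_empirical]
    rw [← div_eq_inv_mul, le_div_iff₀ hn0]
    calc (m - s) * n = ∑ _j : Fin n, (m - s) := by simp; ring
      _ ≤ _ := Finset.sum_le_sum fun j _ => hge _ (hl j)
  have h3 := regEnergy_le_neg_logEnergy hh hμ hμ hfin
  rw [h1]
  refine mul_le_mul_of_nonneg_left ?_ (sq_nonneg _)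
  unfold regDist at hdist
  linarith

end Deterministic

/-! ### The Gibbs weight -/

section Weight

variable {N n : ℕ} {β : ℝ} {V : ℝ → ℝ}

lemma gibbsWeight_nonneg (l : Fin N → ℝ) : 0 ≤ gibbsWeight N β V l := by
  unfold gibbsWeight
  exact mul_nonneg (Finset.prod_nonneg fun _ _ => (Real.exp_pos _).le)
    (Finset.prod_nonneg fun _ _ => Finset.prod_nonneg fun _ _ =>
      Real.rpow_nonneg (abs_nonneg _) _)

lemma continuous_gibbsWeight (hβ : 0 < β) (hV : Continuous V) :
    Continuous (gibbsWeight N β V) := by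
  unfold gibbsWeight
  refine Continuous.mul (by fun_prop) ?_
  refine continuous_finsetProd _ fun i _ => continuous_finsetProd _ fun j _ => ?_
  exact Continuous.rpow_const (by fun_prop) fun l => Or.inr hβ.le

/-- The interaction as a product over ordered pairs. -/
lemma prod_interaction (hβ : 0 < β) (l : Fin N → ℝ) :
    ∏ i, ∏ j ∈ Finset.Ioi i, |l i - l j| ^ β
      = ∏ i, ∏ j, if i = j then 1 else |l i - l j| ^ (β / 2) := by
  have h1 := Finset.prod_prod_Ioi_mul_eq_prod_prod_off_diag
    (fun i j : Fin N => |l i - l j| ^ (β / 2))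
  have h2 : ∀ i j : Fin N, |l j - l i| ^ (β / 2) * |l i - l j| ^ (β / 2) = |l i - l j| ^ β := by
    intro i j
    rw [abs_sub_comm (l j), ← Real.rpow_add' (abs_nonneg _) (by linarith), add_halves]
  simp_rw [h2] at h1
  rw [h1]
  have h3 : ∀ i j : Fin N, (if i = j then 1 else |l i - l j| ^ (β / 2))
      = if j ∈ ({i}ᶜ : Finset (Fin N)) then |l j - l i| ^ (β / 2) else 1 := by
    intro i j
    by_cases h : i = j
    · simp [h]
    · rw [if_neg h, if_pos (by simpa using Ne.symm h), abs_sub_comm]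
  simp_rw [h3]
  refine Finset.prod_congr rfl fun i _ => ?_
  rw [Finset.prod_ite_mem, Finset.univ_inter]

/-- The conditional weight of one point at `x` given the other points `l`. -/
noncomputable def pointWeight (N : ℕ) (β : ℝ) (V : ℝ → ℝ) (l : Fin n → ℝ) (x : ℝ) : ℝ :=
  Real.exp (-((N : ℝ) * β / 2) * V x) * ∏ j, |x - l j| ^ β

/-- The weight of the other points, still with the potential of the full ensemble. -/
noncomputable def restWeight (N : ℕ) (β : ℝ) (V : ℝ → ℝ) (l : Fin n → ℝ) : ℝ :=
  (∏ j, Real.exp (-((N : ℝ) * β / 2) * V (l j))) *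
    ∏ i, ∏ j, if i = j then 1 else |l i - l j| ^ (β / 2)

lemma pointWeight_nonneg (l : Fin n → ℝ) (x : ℝ) : 0 ≤ pointWeight N β V l x :=
  mul_nonneg (Real.exp_pos _).le (Finset.prod_nonneg fun _ _ => Real.rpow_nonneg (abs_nonneg _) _)

lemma continuous_pointWeight (hβ : 0 < β) (hV : Continuous V) (l : Fin n → ℝ) :
    Continuous (pointWeight N β V l) := by
  unfold pointWeight
  refine Continuous.mul (by fun_prop) ?_
  exact continuous_finsetProd _ fun j _ =>
    Continuous.rpow_const (by fun_prop) fun l => Or.inr hβ.le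

lemma gibbsWeight_insertNth (hβ : 0 < β) (i : Fin (n + 1)) (x : ℝ) (l : Fin n → ℝ) :
    gibbsWeight (n + 1) β V (i.insertNth x l)
      = pointWeight (n + 1) β V l x * restWeight (n + 1) β V l := by
  have h1 : ∀ j : Fin n, |x - l j| ^ (β / 2) * |l j - x| ^ (β / 2) = |x - l j| ^ β := by
    intro j
    rw [abs_sub_comm (l j), ← Real.rpow_add' (abs_nonneg _) (by linarith), add_halves]
  rw [gibbsWeight, prod_interaction hβ, Fin.prod_univ_succAbove _ i,
    Fin.prod_univ_succAbove (fun a => ∏ b, _) i]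
  simp only [Fin.prod_univ_succAbove (fun b => if _ = b then (1 : ℝ) else _) i,
    Fin.insertNth_apply_same, Fin.insertNth_apply_succAbove, if_true, one_mul,
    Fin.succAbove_ne, (Fin.succAbove_ne i _).symm, if_false, Fin.succAbove_right_inj,
    Finset.prod_mul_distrib, pointWeight, restWeight]
  have h2 : ∏ j, |x - l j| ^ β = (∏ j, |x - l j| ^ (β / 2)) * ∏ j, |l j - x| ^ (β / 2) := by
    rw [← Finset.prod_mul_distrib]
    exact Finset.prod_congr rfl fun j _ => (h1 j).symm
  rw [h2]
  ring

lemma rpow_abs_le_exp {h : ℝ} (hh : 0 < h) {p : ℝ} (hp : 0 ≤ p) (z : ℝ) :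
    |z| ^ p ≤ Real.exp (-(p * regLog h z)) := by
  calc |z| ^ p ≤ Real.exp (-regLog h z) ^ p :=
        Real.rpow_le_rpow (abs_nonneg _) (abs_le_exp_neg_regLog hh z) hp
    _ = _ := by rw [← Real.exp_mul]; congr 1; ring

/-- Upper bound of the weight by the regularized energy. The double sum runs over all pairs, the
diagonal included, which is why the potential appears with the factor `N` and a correction linear
in `N` is present. -/
lemma gibbsWeight_le (hβ : 0 < β) {h : ℝ} (hh : 0 < h) (l : Fin N → ℝ) :
    gibbsWeight N β V l ≤ Real.exp (-(β / 2) *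
      ((∑ i, ∑ j, ((V (l i) + V (l j)) / 2 + regLog h (l i - l j))) - N * (1 - Real.log h))) := by
  have h1 : ∏ i, ∏ j, (if i = j then 1 else |l i - l j| ^ (β / 2))
      ≤ Real.exp (-(β / 2) * ((∑ i, ∑ j, regLog h (l i - l j)) - N * (1 - Real.log h))) := by
    calc ∏ i, ∏ j, (if i = j then 1 else |l i - l j| ^ (β / 2))
        ≤ ∏ i, ∏ j, Real.exp (-(β / 2) *
            (regLog h (l i - l j) - if i = j then 1 - Real.log h else 0)) := by
          refine Finset.prod_le_prod (fun i _ => Finset.prod_nonneg fun j _ => ?_)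
            fun i _ => Finset.prod_le_prod (fun j _ => ?_) fun j _ => ?_
          · split_ifs
            exacts [zero_le_one, Real.rpow_nonneg (abs_nonneg _) _]
          · split_ifs
            exacts [zero_le_one, Real.rpow_nonneg (abs_nonneg _) _]
          · split_ifs with hij
            · simp [hij, regLog_zero hh]
            · refine (rpow_abs_le_exp hh (by positivity) _).trans (le_of_eq ?_)
              congr 1; ring
      _ = _ := by
          simp_rw [← Real.exp_sum, ← Finset.mul_sum, Finset.sum_sub_distrib]
          simp only [Finset.sum_ite_eq, Finset.mem_univ, if_true, Finset.sum_const,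
            Finset.card_univ, Fintype.card_fin, nsmul_eq_mul]
  rw [gibbsWeight, prod_interaction hβ, ← Real.exp_sum]
  refine (mul_le_mul_of_nonneg_left h1 (Real.exp_pos _).le).trans (le_of_eq ?_)
  rw [← Real.exp_add]
  congr 1
  simp only [Finset.sum_add_distrib, ← Finset.sum_div, Finset.sum_const, Finset.card_univ,
    Fintype.card_fin, nsmul_eq_mul, ← Finset.mul_sum]
  ring

lemma pointWeight_le (hβ : 0 < β) {h : ℝ} (hh : 0 < h) (l : Fin n → ℝ) (x : ℝ) :
    pointWeight N β V l x
      ≤ Real.exp (-β * (N * (V x / 2) + ∑ j, regLog h (x - l j))) := by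
  have h1 : ∏ j, |x - l j| ^ β ≤ ∏ j, Real.exp (-(β * regLog h (x - l j))) :=
    Finset.prod_le_prod (fun j _ => Real.rpow_nonneg (abs_nonneg _) _)
      fun j _ => rpow_abs_le_exp hh hβ.le _
  refine (mul_le_mul_of_nonneg_left h1 (Real.exp_pos _).le).trans (le_of_eq ?_)
  rw [← Real.exp_sum, ← Real.exp_add]
  congr 1
  rw [Finset.sum_neg_distrib, ← Finset.mul_sum]
  ring

lemma pointWeight_eq (l : Fin n → ℝ) {x : ℝ} (hx : ∀ j, x ≠ l j) :
    pointWeight N β V l x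
      = Real.exp (-β * (N * (V x / 2) - ∑ j, Real.log |x - l j|)) := by
  have h1 : ∏ j, |x - l j| ^ β = ∏ j, Real.exp (β * Real.log |x - l j|) :=
    Finset.prod_congr rfl fun j _ => by
      rw [Real.rpow_def_of_pos (abs_pos.2 (sub_ne_zero.2 (hx j))), mul_comm]
  rw [pointWeight, h1, ← Real.exp_sum, ← Real.exp_add, ← Finset.mul_sum]
  congr 1
  ring

lemma gibbsWeight_eq_exp (hβ : 0 < β) {l : Fin N → ℝ} (hl : ∀ i j, i ≠ j → l i ≠ l j) :
    gibbsWeight N β V l = Real.exp (-(β / 2) *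
      (N * ∑ i, V (l i) - ∑ i, ∑ j, Real.log |l i - l j|)) := by
  have h1 : ∏ i, ∏ j, (if i = j then 1 else |l i - l j| ^ (β / 2))
      = ∏ i, ∏ j, Real.exp (β / 2 * Real.log |l i - l j|) := by
    refine Finset.prod_congr rfl fun i _ => Finset.prod_congr rfl fun j _ => ?_
    split_ifs with hij
    · simp [hij]
    · rw [Real.rpow_def_of_pos (abs_pos.2 (sub_ne_zero.2 (hl i j hij))), mul_comm]
  rw [gibbsWeight, prod_interaction hβ, h1]
  simp_rw [← Real.exp_sum]
  rw [← Real.exp_add]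
  congr 1
  simp only [← Finset.mul_sum]
  ring

end Weight

/-! ### Lower bound of the partition function -/

lemma measure_pi_mono {ι : Type*} [Fintype ι] {α : ι → Type*} [∀ i, MeasurableSpace (α i)]
    {μ ν : ∀ i, Measure (α i)} (h : ∀ i, μ i ≤ ν i) : Measure.pi μ ≤ Measure.pi ν := by
  have hle : OuterMeasure.pi (fun i => (μ i).toOuterMeasure)
      ≤ OuterMeasure.pi fun i => (ν i).toOuterMeasure := by
    rw [OuterMeasure.le_pi]
    intro s _
    exact (OuterMeasure.pi_pi_le _ _).trans (Finset.prod_le_prod' fun i _ => h i (s i))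
  refine Measure.le_iff.2 fun s hs => ?_
  rw [Measure.pi_def, Measure.pi_def, toMeasure_apply _ _ hs, toMeasure_apply _ _ hs]
  exact hle s

lemma measure_pi_smul (N : ℕ) (c : ℝ≥0∞) (hc : c ≠ ⊤) (μ : Measure ℝ) [SigmaFinite μ] :
    Measure.pi (fun _ : Fin N => c • μ) = c ^ N • Measure.pi fun _ : Fin N => μ := by
  have : SigmaFinite (c • μ) := by
    lift c to NNReal using hc
    exact inferInstanceAs (SigmaFinite (c • μ))
  refine Measure.pi_eq fun s _ => ?_
  simp [Measure.pi_pi, Finset.prod_mul_distrib]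

lemma map_pair_pi {N : ℕ} (ν : Measure ℝ) [IsProbabilityMeasure ν] {i j : Fin N} (hij : i ≠ j) :
    MeasurePreserving (fun l : Fin N → ℝ => (l i, l j)) (Measure.pi fun _ => ν) (ν.prod ν) := by
  refine ⟨by fun_prop, ?_⟩
  have h1 := (ProbabilityTheory.iIndepFun_pi (μ := fun _ : Fin N => ν)
    (X := fun _ x => x) fun _ => by fun_prop).indepFun hij
  rw [ProbabilityTheory.indepFun_iff_map_prod_eq_prod_map_map
    (measurable_pi_apply i).aemeasurable (measurable_pi_apply j).aemeasurable] at h1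
  have h2 : ∀ k : Fin N, (Measure.pi fun _ : Fin N => ν).map (fun l => l k) = ν :=
    fun k => (measurePreserving_eval (fun _ : Fin N => ν) k).map_eq
  rw [h1, h2, h2]

variable {β : ℝ} {V : ℝ → ℝ} {S : Set ℝ}

lemma partitionFunction_eq (N : ℕ) (β : ℝ) (V : ℝ → ℝ) (S : Set ℝ) :
    partitionFunction N β V S
      = ∫⁻ l in Set.univ.pi fun _ : Fin N => S, ENNReal.ofReal (gibbsWeight N β V l) := by
  rw [partitionFunction, gibbsMeasure, withDensity_apply _ MeasurableSet.univ,
    Measure.restrict_univ]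

/-- Jensen's inequality, applied to the law of independent points distributed according to a trial
measure, bounds the partition function from below. -/
lemma partitionFunction_ge (hβ : 0 < β) (hV : Continuous V) {M C : ℝ}
    {ν : Measure ℝ} [IsProbabilityMeasure ν] (hνS : ∀ᵐ x ∂ν, x ∈ S) (hνM : ∀ᵐ x ∂ν, |x| ≤ M)
    (hC : 0 < C) (hν : ν ≤ ENNReal.ofReal C • volume) (hfin : LogFinite ν ν) (N : ℕ) :
    ENNReal.ofReal (C⁻¹ ^ N * Real.exp (-(β / 2) *
      ((N : ℝ) ^ 2 * ∫ x, V x ∂ν - N * (N - 1) * logEnergy ν ν)))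
      ≤ partitionFunction N β V S := by
  set Q := Measure.pi fun _ : Fin N => ν with hQ
  have hdom : Q ≤ ENNReal.ofReal C ^ N •
      (volume : Measure (Fin N → ℝ)).restrict (Set.univ.pi fun _ => S) := by
    have h1 : ν ≤ ENNReal.ofReal C • volume.restrict S := by
      rw [← Measure.restrict_smul, ← Measure.restrict_eq_self_of_ae_mem hνS]
      exact Measure.restrict_mono le_rfl hν
    refine (measure_pi_mono fun _ => h1).trans (le_of_eq ?_)
    rw [measure_pi_smul N _ ENNReal.ofReal_ne_top, ← Measure.restrict_pi_pi]
    rfl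
  have hmeas := (continuous_gibbsWeight (N := N) hβ hV).measurable
  have hZ : ∫⁻ l, ENNReal.ofReal (gibbsWeight N β V l) ∂Q
      ≤ ENNReal.ofReal C ^ N * partitionFunction N β V S := by
    refine (lintegral_mono' hdom le_rfl).trans (le_of_eq ?_)
    rw [lintegral_smul_measure, smul_eq_mul, partitionFunction_eq]
  have hVi := integrable_of_abs_le hV hνM
  have hVk : ∀ k : Fin N, Integrable (fun l : Fin N → ℝ => V (l k)) Q ∧
      ∫ l, V (l k) ∂Q = ∫ x, V x ∂ν := by
    intro k
    have hmp := measurePreserving_eval (fun _ : Fin N => ν) k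
    refine ⟨hmp.integrable_comp_of_integrable hVi, ?_⟩
    have h2 := integral_map (μ := Q) (φ := Function.eval k) hmp.measurable.aemeasurable (f := V)
      hV.aestronglyMeasurable
    rw [hmp.map_eq] at h2
    exact h2.symm
  have hlog : ∀ i j : Fin N, Integrable (fun l : Fin N → ℝ => Real.log |l i - l j|) Q ∧
      ∫ l, Real.log |l i - l j| ∂Q = if i = j then 0 else logEnergy ν ν := by
    intro i j
    rcases eq_or_ne i j with rfl | hij
    · simp
    · have hmp := map_pair_pi ν hij
      refine ⟨hmp.integrable_comp_of_integrable hfin.2, ?_⟩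
      rw [if_neg hij, logEnergy, ← hmp.map_eq, integral_map hmp.measurable.aemeasurable
        measurable_log_abs_sub.aestronglyMeasurable]
  have hdist : ∀ᵐ l ∂Q, ∀ i j, i ≠ j → l i ≠ l j := by
    rw [ae_all_iff]; intro i
    rw [ae_all_iff]; intro j
    rcases eq_or_ne i j with rfl | hij
    · simp
    · filter_upwards [(map_pair_pi ν hij).quasiMeasurePreserving.ae hfin.1] with l hl _
      exact hl
  set F : (Fin N → ℝ) → ℝ := fun l =>
    -(β / 2) * (N * ∑ i, V (l i) - ∑ i, ∑ j, Real.log |l i - l j|) with hF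
  have hi1 : Integrable (fun l : Fin N → ℝ => ∑ i, V (l i)) Q :=
    integrable_finsetSum _ fun i _ => (hVk i).1
  have hi2 : Integrable (fun l : Fin N → ℝ => ∑ i, ∑ j, Real.log |l i - l j|) Q :=
    integrable_finsetSum _ fun i _ => integrable_finsetSum _ fun j _ => (hlog i j).1
  have hFi : Integrable F Q := ((hi1.const_mul _).sub hi2).const_mul _
  have hFint : ∫ l, F l ∂Q = -(β / 2) *
      ((N : ℝ) ^ 2 * ∫ x, V x ∂ν - N * (N - 1) * logEnergy ν ν) := by
    rw [hF, integral_const_mul, integral_sub (hi1.const_mul _) hi2, integral_const_mul,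
      integral_finsetSum _ fun i _ => (hVk i).1,
      integral_finsetSum _ fun i _ => integrable_finsetSum _ fun j _ => (hlog i j).1]
    have h3 : ∀ i : Fin N, ∫ l, ∑ j, Real.log |l i - l j| ∂Q = (N - 1) * logEnergy ν ν := by
      intro i
      rw [integral_finsetSum _ fun j _ => (hlog i j).1]
      simp_rw [(hlog i _).2]
      have h4 : ∀ j : Fin N, (if i = j then 0 else logEnergy ν ν)
          = logEnergy ν ν - if i = j then logEnergy ν ν else 0 := by
        intro j; split_ifs <;> simp
      simp_rw [h4, Finset.sum_sub_distrib]
      simp; ring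
    simp_rw [h3, (hVk _).2]
    simp only [Finset.sum_const, Finset.card_univ, Fintype.card_fin, nsmul_eq_mul]
    ring
  have hexp : ∀ᵐ l ∂Q, gibbsWeight N β V l = Real.exp (F l) :=
    hdist.mono fun l hl => gibbsWeight_eq_exp hβ hl
  have hmem : ∀ᵐ l ∂Q, l ∈ Set.univ.pi fun _ : Fin N => Set.Icc (-M) M := by
    have h5 : ∀ᵐ l ∂Q, ∀ k, |l k| ≤ M := by
      rw [ae_all_iff]
      exact fun k => (measurePreserving_eval (fun _ : Fin N => ν) k).quasiMeasurePreserving.ae hνM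
    exact h5.mono fun l hl k _ => abs_le.1 (hl k)
  have hwi : Integrable (gibbsWeight N β V) Q :=
    integrable_of_continuous_of_ae_mem (continuous_gibbsWeight hβ hV)
      (isCompact_univ_pi fun _ => isCompact_Icc) hmem
  have hjensen : Real.exp (∫ l, F l ∂Q) ≤ ∫ l, gibbsWeight N β V l ∂Q := by
    rw [integral_congr_ae hexp]
    exact convexOn_exp.map_integral_le Real.continuous_exp.continuousOn isClosed_univ
      (by simp) hFi (hwi.congr hexp)
  have h6 : ENNReal.ofReal (Real.exp (∫ l, F l ∂Q))
      ≤ ENNReal.ofReal C ^ N * partitionFunction N β V S := by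
    refine le_trans (ENNReal.ofReal_le_ofReal hjensen) (le_trans (le_of_eq ?_) hZ)
    exact ofReal_integral_eq_lintegral_ofReal hwi
      (Eventually.of_forall fun l => gibbsWeight_nonneg l)
  rw [← hFint, ENNReal.ofReal_mul (by positivity), ENNReal.ofReal_pow (by positivity),
    ENNReal.ofReal_inv_of_pos hC]
  refine (mul_le_mul_right h6 _).trans (le_of_eq ?_)
  rw [← mul_assoc, ← mul_pow, ENNReal.inv_mul_cancel (by simpa using hC) ENNReal.ofReal_ne_top,
    one_pow, one_mul]

/-! ### Conditional law of one point -/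

/-- The integrable weight `(1 + |x|)⁻²`. -/
noncomputable def tailWeight (x : ℝ) : ℝ := Real.exp (-2 * Real.log (1 + |x|))

lemma tailWeight_pos (x : ℝ) : 0 < tailWeight x := Real.exp_pos _

lemma integrable_tailWeight : Integrable tailWeight := by
  have h := integrable_one_add_norm (E := ℝ) (μ := volume) (r := 2) (by simp)
  refine h.congr (Eventually.of_forall fun x => ?_)
  have : 0 < 1 + ‖x‖ := by positivity
  dsimp only
  rw [Real.rpow_def_of_pos this, tailWeight, Real.norm_eq_abs, mul_comm]

/-- `∫ (1 + |x|)⁻² dx`. -/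
noncomputable def tailConst : ℝ := ∫ x, tailWeight x

lemma tailConst_nonneg : 0 ≤ tailConst := integral_nonneg fun x => (tailWeight_pos x).le

lemma exp_neg_mul_log_le {c : ℝ} (hc : 2 ≤ c) (x : ℝ) :
    Real.exp (-c * Real.log (1 + |x|)) ≤ tailWeight x := by
  refine Real.exp_le_exp.2 ?_
  have := log_one_add_abs_nonneg x
  nlinarith

section Conditional

variable {V : ℝ → ℝ} {S A : Set ℝ} {M β κ C : ℝ}

lemma neg_le_of_confining (hκ : 0 < κ)
    (hconf : ∀ x ∈ S, (1 + κ) * Real.log (1 + |x|) - C ≤ V x / 2) {x : ℝ} (hx : x ∈ S) :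
    -C ≤ V x / 2 := by
  have h1 := mul_nonneg (by linarith : 0 ≤ 1 + κ) (log_one_add_abs_nonneg x)
  linarith [hconf x hx]

/-- Jensen's inequality bounds the normalization of the conditional law of one point from below by
the mean of the exponent under a trial measure. -/
lemma lintegral_pointWeight_ge (hβ : 0 < β) (hV : Continuous V) {ρ : Measure ℝ}
    [IsProbabilityMeasure ρ] (hρS : ∀ᵐ x ∂ρ, x ∈ S) (hρM : ∀ᵐ x ∂ρ, |x| ≤ M) {Cρ : ℝ}
    (hCρ : 0 < Cρ) (hρ : ρ ≤ ENNReal.ofReal Cρ • volume) {h : ℝ} (hh : 0 < h) {n : ℕ} (hn : 0 < n)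
    (l : Fin n → ℝ) :
    ENNReal.ofReal (Cρ⁻¹ * Real.exp (-β * ((n + 1) * ((∫ x, V x ∂ρ) / 2) +
      n * (regEnergy h ρ (empirical l) + Cρ * (2 * h)))))
      ≤ ∫⁻ x in S, ENNReal.ofReal (pointWeight (n + 1) β V l x) := by
  have hn0 : (0 : ℝ) < n := by exact_mod_cast hn
  have hdom : ρ ≤ ENNReal.ofReal Cρ • volume.restrict S := by
    rw [← Measure.restrict_smul, ← Measure.restrict_eq_self_of_ae_mem hρS]
    exact Measure.restrict_mono le_rfl hρ
  have hw := continuous_pointWeight (N := n + 1) hβ hV l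
  have hwi : Integrable (pointWeight (n + 1) β V l) ρ :=
    integrable_of_continuous_of_ae_mem hw isCompact_Icc (hρM.mono fun _ h => abs_le.1 h)
  set F : ℝ → ℝ := fun x =>
    -β * (((n + 1 : ℕ) : ℝ) * (V x / 2) - ∑ j, Real.log |x - l j|) with hF
  have hlog := fun j => neg_integral_log_le hCρ hρ hρM hh (l j)
  have hVi : Integrable (fun x => ((n + 1 : ℕ) : ℝ) * (V x / 2)) ρ :=
    ((integrable_of_abs_le hV hρM).div_const 2).const_mul _
  have hli : Integrable (fun x => ∑ j, Real.log |x - l j|) ρ :=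
    integrable_finsetSum _ fun j _ => (hlog j).1
  have hFi : Integrable F ρ := (hVi.sub hli).const_mul _
  have hexp : ∀ᵐ x ∂ρ, pointWeight (n + 1) β V l x = Real.exp (F x) := by
    have h1 : ∀ᵐ x ∂ρ, ∀ j, x ≠ l j := by
      rw [ae_all_iff]; exact fun j => ae_ne_of_le hρ (l j)
    exact h1.mono fun x hx => pointWeight_eq l hx
  have hFint : -β * ((n + 1) * ((∫ x, V x ∂ρ) / 2) +
      n * (regEnergy h ρ (empirical l) + Cρ * (2 * h))) ≤ ∫ x, F x ∂ρ := by
    rw [hF, integral_const_mul, integral_sub hVi hli, integral_const_mul, integral_div,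
      integral_finsetSum _ fun j _ => (hlog j).1]
    have h1 : n * regEnergy h ρ (empirical l) = ∑ j, ∫ x, regLog h (x - l j) ∂ρ := by
      unfold regEnergy
      simp_rw [integral_empirical]
      rw [integral_const_mul, integral_finsetSum]
      · field_simp
      · intro j _
        simpa only [regLog_symm] using integrable_regLog_right hh hρM (l j)
    have h2 : -∑ j, ∫ x, Real.log |x - l j| ∂ρ
        ≤ n * (regEnergy h ρ (empirical l) + Cρ * (2 * h)) := by
      rw [mul_add, h1, ← Finset.sum_neg_distrib]
      calc ∑ j, -∫ x, Real.log |x - l j| ∂ρ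
          ≤ ∑ j, (∫ x, regLog h (x - l j) ∂ρ + Cρ * (2 * h)) :=
            Finset.sum_le_sum fun j _ => (hlog j).2
        _ = _ := by rw [Finset.sum_add_distrib]; simp
    push_cast
    nlinarith
  have hjensen : Real.exp (∫ x, F x ∂ρ) ≤ ∫ x, pointWeight (n + 1) β V l x ∂ρ := by
    rw [integral_congr_ae hexp]
    exact convexOn_exp.map_integral_le Real.continuous_exp.continuousOn isClosed_univ
      (by simp) hFi (hwi.congr hexp)
  have h6 : ENNReal.ofReal (Real.exp (∫ x, F x ∂ρ)) ≤
      ENNReal.ofReal Cρ * ∫⁻ x in S, ENNReal.ofReal (pointWeight (n + 1) β V l x) := by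
    refine le_trans (ENNReal.ofReal_le_ofReal hjensen) ?_
    rw [ofReal_integral_eq_lintegral_ofReal hwi
      (Eventually.of_forall fun x => pointWeight_nonneg l x), ← smul_eq_mul,
      ← lintegral_smul_measure]
    exact lintegral_mono' hdom le_rfl
  rw [ENNReal.ofReal_mul (by positivity), ENNReal.ofReal_inv_of_pos hCρ]
  refine (mul_le_mul_right ((ENNReal.ofReal_le_ofReal (Real.exp_le_exp.2 hFint)).trans h6) _).trans
    (le_of_eq ?_)
  rw [← mul_assoc, ENNReal.inv_mul_cancel (by simpa using hCρ) ENNReal.ofReal_ne_top, one_mul]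

/-- If the effective potential created by the other points is larger on `A` than its mean under
the trial measure, then the conditional probability that a point lies in `A` is exponentially
small. -/
lemma lintegral_pointWeight_le (hβ : 0 < β) (hV : Continuous V) (hκ : 0 < κ)
    (hconf : ∀ x ∈ S, (1 + κ) * Real.log (1 + |x|) - C ≤ V x / 2) (hA : MeasurableSet A)
    (hAS : A ⊆ S) {ρ : Measure ℝ} [IsProbabilityMeasure ρ] (hρS : ∀ᵐ x ∂ρ, x ∈ S)
    (hρM : ∀ᵐ x ∂ρ, |x| ≤ M) {Cρ : ℝ}
    (hCρ : 0 < Cρ) (hρ : ρ ≤ ENNReal.ofReal Cρ • volume) {h δ κ' : ℝ} (hh : 0 < h)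
    (hδ : Cρ * (2 * h) ≤ δ / 8) {n : ℕ} (hn : 0 < n) (hnκ : 2 ≤ β * n * (κ' / 2))
    (l : Fin n → ℝ)
    (hgap : ∀ x ∈ A, (∫ x, V x ∂ρ) / 2 + regEnergy h ρ (empirical l) + 5 / 8 * δ
      + κ' / 2 * Real.log (1 + |x|) ≤ regPot h V (empirical l) x) :
    ∫⁻ x in A, ENNReal.ofReal (pointWeight (n + 1) β V l x) ≤
      ENNReal.ofReal (Cρ * tailConst * Real.exp (β * (C + (∫ x, V x ∂ρ) / 2))
        * Real.exp (-(β * δ / 2) * n)) *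
      ∫⁻ x in S, ENNReal.ofReal (pointWeight (n + 1) β V l x) := by
  have hn0 : (0 : ℝ) < n := by exact_mod_cast hn
  set T := (∫ x, V x ∂ρ) / 2 + regEnergy h ρ (empirical l) with hT
  set E := Real.exp (-β * (n * (T + 5 / 8 * δ) - C)) with hE
  have hup : ∀ x ∈ A, pointWeight (n + 1) β V l x ≤ E * tailWeight x := by
    intro x hx
    have h1 : ∑ j, regLog h (x - l j) = n * (regPot h V (empirical l) x - V x / 2) := by
      rw [regPot, integral_empirical]
      field_simp; ring
    refine (pointWeight_le hβ hh l x).trans ?_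
    rw [h1]
    refine le_trans ?_ (mul_le_mul_of_nonneg_left (exp_neg_mul_log_le hnκ x) (Real.exp_pos _).le)
    rw [← Real.exp_add]
    refine Real.exp_le_exp.2 ?_
    have h2 := mul_le_mul_of_nonneg_left (hgap x hx) (mul_nonneg hβ.le hn0.le)
    have h3 := mul_le_mul_of_nonneg_left (neg_le_of_confining hκ hconf (hAS hx)) hβ.le
    push_cast
    nlinarith
  have hlow := lintegral_pointWeight_ge hβ hV hρS hρM hCρ hρ hh hn l
  calc ∫⁻ x in A, ENNReal.ofReal (pointWeight (n + 1) β V l x)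
      ≤ ∫⁻ x in A, ENNReal.ofReal (E * tailWeight x) :=
        setLIntegral_mono' hA fun x hx => ENNReal.ofReal_le_ofReal (hup x hx)
    _ ≤ ∫⁻ x, ENNReal.ofReal (E * tailWeight x) := setLIntegral_le_lintegral _ _
    _ = ENNReal.ofReal (E * tailConst) := by
        rw [← ofReal_integral_eq_lintegral_ofReal (integrable_tailWeight.const_mul _)
          (Eventually.of_forall fun x => mul_nonneg (Real.exp_pos _).le (tailWeight_pos x).le),
          integral_const_mul, tailConst]
    _ ≤ ENNReal.ofReal (Cρ * tailConst * Real.exp (β * (C + (∫ x, V x ∂ρ) / 2))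
        * Real.exp (-(β * δ / 2) * n)) *
        ENNReal.ofReal (Cρ⁻¹ * Real.exp (-β * ((n + 1) * ((∫ x, V x ∂ρ) / 2) +
      n * (regEnergy h ρ (empirical l) + Cρ * (2 * h))))) := by
        rw [← ENNReal.ofReal_mul (by have := tailConst_nonneg; positivity)]
        refine ENNReal.ofReal_le_ofReal ?_
        have h4 : Cρ * tailConst * Real.exp (β * (C + (∫ x, V x ∂ρ) / 2))
            * Real.exp (-(β * δ / 2) * n) * (Cρ⁻¹ * Real.exp (-β * ((n + 1) *
              ((∫ x, V x ∂ρ) / 2) + n * (regEnergy h ρ (empirical l) + Cρ * (2 * h)))))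
            = Real.exp (β * (C + (∫ x, V x ∂ρ) / 2) + -(β * δ / 2) * n + -β * ((n + 1) *
              ((∫ x, V x ∂ρ) / 2) + n * (regEnergy h ρ (empirical l) + Cρ * (2 * h))))
              * tailConst := by
          rw [Real.exp_add, Real.exp_add]
          field_simp
        rw [h4]
        refine mul_le_mul_of_nonneg_right (Real.exp_le_exp.2 ?_) tailConst_nonneg
        have h5 := mul_le_mul_of_nonneg_left hδ (mul_nonneg hβ.le hn0.le)
        rw [hT]
        nlinarith
    _ ≤ _ := by gcongr

end Conditional

/-! ### Configurations far from equilibrium -/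

section Far

variable {V : ℝ → ℝ} {S : Set ℝ} {M β κ C : ℝ}

lemma pair_energy_ge (hconf : ∀ x ∈ S, (1 + κ) * Real.log (1 + |x|) - C ≤ V x / 2) {h : ℝ}
    (hh : 0 < h) (h1 : h ≤ 1) {x y : ℝ} (hx : x ∈ S) (hy : y ∈ S) :
    κ * (Real.log (1 + |x|) + Real.log (1 + |y|)) - 2 * C
      ≤ (V x + V y) / 2 + regLog h (x - y) := by
  linarith [hconf x hx, hconf y hy, neg_log_add_le_regLog hh h1 x y]

lemma sum_pair_energy_ge (hconf : ∀ x ∈ S, (1 + κ) * Real.log (1 + |x|) - C ≤ V x / 2) {h : ℝ}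
    (hh : 0 < h) (h1 : h ≤ 1) {n : ℕ} {l : Fin n → ℝ} (hl : ∀ j, l j ∈ S) :
    2 * κ * n * (∑ j, Real.log (1 + |l j|)) - 2 * C * (n : ℝ) ^ 2
      ≤ ∑ i, ∑ j, ((V (l i) + V (l j)) / 2 + regLog h (l i - l j)) := by
  calc 2 * κ * n * (∑ j, Real.log (1 + |l j|)) - 2 * C * (n : ℝ) ^ 2
      = ∑ i, ∑ j, (κ * (Real.log (1 + |l i|) + Real.log (1 + |l j|)) - 2 * C) := by
        simp only [Finset.sum_sub_distrib, ← Finset.mul_sum, Finset.sum_add_distrib,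
          Finset.sum_const, Finset.card_univ, Fintype.card_fin, nsmul_eq_mul]
        ring
    _ ≤ _ := Finset.sum_le_sum fun i _ => Finset.sum_le_sum fun j _ =>
        pair_energy_ge hconf hh h1 (hl i) (hl j)

lemma exp_neg_sum_log_le {N : ℕ} {c : ℝ} (hc : 2 ≤ c) (l : Fin N → ℝ) :
    Real.exp (-c * ∑ j, Real.log (1 + |l j|)) ≤ ∏ j, tailWeight (l j) := by
  rw [Finset.mul_sum, Real.exp_sum]
  exact Finset.prod_le_prod (fun _ _ => (Real.exp_pos _).le) fun j _ => exp_neg_mul_log_le hc _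

lemma lintegral_prod_tailWeight (N : ℕ) (K : ℝ) (hK : 0 ≤ K) :
    ∫⁻ l : Fin N → ℝ, ENNReal.ofReal (K * ∏ j, tailWeight (l j))
      = ENNReal.ofReal (K * tailConst ^ N) := by
  have hi : Integrable (fun l : Fin N → ℝ => K * ∏ j, tailWeight (l j)) :=
    (Integrable.fintype_prod fun _ => integrable_tailWeight).const_mul K
  rw [← ofReal_integral_eq_lintegral_ofReal hi (Eventually.of_forall fun l =>
    mul_nonneg hK (Finset.prod_nonneg fun j _ => (tailWeight_pos _).le)), integral_const_mul,
    integral_fintype_prod_volume_eq_prod (fun _ => tailWeight)]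
  simp [tailConst]

/-- For a confining potential the partition function is finite as soon as `N` is large. -/
lemma partitionFunction_ne_top (hβ : 0 < β) (hS : MeasurableSet S)
    (hconf : ∀ x ∈ S, (1 + κ) * Real.log (1 + |x|) - C ≤ V x / 2) {N : ℕ}
    (hN : 2 ≤ β * κ * N) : partitionFunction N β V S ≠ ⊤ := by
  rw [partitionFunction_eq]
  set K := Real.exp (β / 2 * (2 * C * (N : ℝ) ^ 2 + N)) with hK
  refine ne_top_of_le_ne_top (b := ENNReal.ofReal (K * tailConst ^ N)) ENNReal.ofReal_ne_top ?_
  rw [← lintegral_prod_tailWeight N K (Real.exp_pos _).le]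
  refine le_trans (setLIntegral_mono' (MeasurableSet.univ_pi fun _ => hS) fun l hl => ?_)
    (setLIntegral_le_lintegral _ _)
  refine ENNReal.ofReal_le_ofReal ((gibbsWeight_le hβ one_pos l).trans ?_)
  refine le_trans ?_ (mul_le_mul_of_nonneg_left (exp_neg_sum_log_le hN l) (Real.exp_pos _).le)
  rw [← Real.exp_add]
  refine Real.exp_le_exp.2 ?_
  have h1 := sum_pair_energy_ge hconf one_pos le_rfl (l := l) fun j => hl j (Set.mem_univ j)
  have h2 := mul_le_mul_of_nonneg_left h1 (half_pos hβ).le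
  rw [Real.log_one]
  nlinarith

/-- The weight of a configuration whose points other than the `i`-th one have an energy exceeding
`n² e`. A fraction `θ` of the energy is spent on making the bound integrable. -/
lemma gibbsWeight_le_of_energy_ge (hβ : 0 < β) (hκ : 0 < κ) (hC : 0 ≤ C)
    (hconf : ∀ x ∈ S, (1 + κ) * Real.log (1 + |x|) - C ≤ V x / 2) {h e e' θ : ℝ} (hh : 0 < h)
    (h1 : h ≤ 1) (hθ : 0 < θ) (hθ1 : θ ≤ 1) (he : e' + θ * (e + 2 * C) ≤ e) {n : ℕ}
    (hn : 2 ≤ β * θ * κ * n) (i : Fin (n + 1)) {x : ℝ} (hx : x ∈ S) {l : Fin n → ℝ}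
    (hl : ∀ j, l j ∈ S)
    (hen : (n : ℝ) ^ 2 * e ≤ ∑ i, ∑ j, ((V (l i) + V (l j)) / 2 + regLog h (l i - l j))) :
    gibbsWeight (n + 1) β V (i.insertNth x l) ≤
      Real.exp (-(β / 2) * ((n : ℝ) ^ 2 * e' - (4 * C + (1 - Real.log h)) * (n + 1))) *
        ∏ j, tailWeight ((i.insertNth x l : Fin (n + 1) → ℝ) j) := by
  refine (gibbsWeight_le hβ hh _).trans ?_
  refine le_trans ?_ (mul_le_mul_of_nonneg_left (exp_neg_sum_log_le hn _) (Real.exp_pos _).le)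
  rw [← Real.exp_add]
  refine Real.exp_le_exp.2 ?_
  simp only [Fin.sum_univ_succAbove _ i, Fin.insertNth_apply_same, Fin.insertNth_apply_succAbove,
    sub_self, regLog_zero hh, Finset.sum_add_distrib (s := Finset.univ) (f := fun j : Fin n =>
      (V (l j) + V x) / 2 + regLog h (l j - x))]
  have hsymm : ∑ j, ((V (l j) + V x) / 2 + regLog h (l j - x))
      = ∑ j, ((V x + V (l j)) / 2 + regLog h (x - l j)) :=
    Finset.sum_congr rfl fun j _ => by rw [regLog_symm, add_comm (V x)]
  have hcross : κ * n * Real.log (1 + |x|) - 2 * C * n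
      ≤ ∑ j, ((V x + V (l j)) / 2 + regLog h (x - l j)) := by
    calc κ * n * Real.log (1 + |x|) - 2 * C * n
        = ∑ _j : Fin n, (κ * Real.log (1 + |x|) - 2 * C) := by simp; ring
      _ ≤ _ := Finset.sum_le_sum fun j _ => by
          have := pair_energy_ge hconf hh h1 hx (hl j)
          have := mul_nonneg hκ.le (log_one_add_abs_nonneg (l j))
          linarith
  have hself := neg_le_of_confining hκ hconf hx
  have hsum := sum_pair_energy_ge hconf hh h1 hl
  have hlx := log_one_add_abs_nonneg x
  have hn0 : (0 : ℝ) ≤ n := Nat.cast_nonneg n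
  set Q := ∑ i, ∑ j, ((V (l i) + V (l j)) / 2 + regLog h (l i - l j)) with hQ
  set X := ∑ j, ((V x + V (l j)) / 2 + regLog h (x - l j)) with hX
  set Λ := ∑ j, Real.log (1 + |l j|) with hΛ
  have hQ1 : (n : ℝ) ^ 2 * e' + 2 * θ * κ * n * Λ ≤ Q := by
    have a1 := mul_le_mul_of_nonneg_left hen (sub_nonneg.2 hθ1)
    have a2 := mul_le_mul_of_nonneg_left hsum hθ.le
    have a3 := mul_le_mul_of_nonneg_left he (sq_nonneg (n : ℝ))
    nlinarith
  have hX1 : 2 * θ * κ * n * Real.log (1 + |x|) - 4 * C * n ≤ X + X := by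
    have : θ * (κ * n * Real.log (1 + |x|)) ≤ 1 * (κ * n * Real.log (1 + |x|)) :=
      mul_le_mul_of_nonneg_right hθ1 (by positivity)
    linarith
  have hmain : (n : ℝ) ^ 2 * e' - (4 * C + (1 - Real.log h)) * (n + 1)
      + 2 * θ * κ * n * (Real.log (1 + |x|) + Λ)
      ≤ (V x + V x) / 2 + (1 - Real.log h) + X + (X + Q) - (n + 1 : ℕ) * (1 - Real.log h) := by
    have hg := Real.log_nonpos hh.le h1
    push_cast
    linarith
  have hfin := mul_le_mul_of_nonneg_left hmain (half_pos hβ).le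
  rw [hsymm]
  linarith

end Far

/-! ### Exponential decay of the probability of an outlier -/

lemma lintegral_pi_insertNth {n : ℕ} (S : Set ℝ) (i : Fin (n + 1))
    {F : (Fin (n + 1) → ℝ) → ℝ≥0∞} (hF : Measurable F) :
    ∫⁻ l in Set.univ.pi fun _ => S, F l
      = ∫⁻ l in Set.univ.pi fun _ : Fin n => S, ∫⁻ x in S, F (i.insertNth x l) := by
  have h1 : ∀ k : ℕ, (volume : Measure (Fin k → ℝ)).restrict (Set.univ.pi fun _ => S)
      = Measure.pi fun _ => volume.restrict S := fun k => Measure.restrict_pi_pi _ _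
  have hmp := (measurePreserving_piFinSuccAbove
    (fun _ : Fin (n + 1) => (volume : Measure ℝ).restrict S) i).symm
  rw [h1, h1, ← hmp.lintegral_comp hF, lintegral_prod_symm]
  · rfl
  · exact (hF.comp (MeasurableEquiv.measurable _)).aemeasurable

section Outlier

variable {V : ℝ → ℝ} {S A : Set ℝ} {β : ℝ}

/-- If every configuration of the other points either makes the conditional probability of `A`
small or has a small weight, then outliers in `A` are unlikely. -/
lemma gibbsMeasure_outlier_le (hβ : 0 < β) (hV : Continuous V) (hS : MeasurableSet S)
    (hA : MeasurableSet A) (hAS : A ⊆ S) {n : ℕ} {r K : ℝ} (hK : 0 ≤ K)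
    (H : ∀ l : Fin n → ℝ, (∀ j, l j ∈ S) →
      (∫⁻ x in A, ENNReal.ofReal (pointWeight (n + 1) β V l x) ≤
        ENNReal.ofReal r * ∫⁻ x in S, ENNReal.ofReal (pointWeight (n + 1) β V l x)) ∨
      ∀ i : Fin (n + 1), ∀ x ∈ S, gibbsWeight (n + 1) β V (i.insertNth x l) ≤
        K * ∏ j, tailWeight ((i.insertNth x l : Fin (n + 1) → ℝ) j)) :
    gibbsMeasure (n + 1) β V S {l | ∃ i, l i ∈ A} ≤
      (n + 1 : ℕ) * (ENNReal.ofReal r * partitionFunction (n + 1) β V S +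
        ENNReal.ofReal (K * tailConst ^ (n + 1))) := by
  have hw := (continuous_gibbsWeight (N := n + 1) hβ hV).measurable.ennreal_ofReal
  have htm : Measurable fun l : Fin (n + 1) → ℝ => ENNReal.ofReal (K * ∏ j, tailWeight (l j)) := by
    unfold tailWeight
    fun_prop
  have hone : ∀ i : Fin (n + 1), gibbsMeasure (n + 1) β V S {l | l i ∈ A} ≤
      ENNReal.ofReal r * partitionFunction (n + 1) β V S +
        ENNReal.ofReal (K * tailConst ^ (n + 1)) := by
    intro i
    have hAi : MeasurableSet {l : Fin (n + 1) → ℝ | l i ∈ A} := measurable_pi_apply i hA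
    rw [gibbsMeasure, withDensity_apply _ hAi, ← lintegral_indicator hAi,
      lintegral_pi_insertNth S i (hw.indicator hAi), partitionFunction_eq,
      lintegral_pi_insertNth S i hw, ← lintegral_prod_tailWeight (n + 1) K hK]
    have hbound : ∀ l ∈ Set.univ.pi fun _ : Fin n => S,
        ∫⁻ x in S, {l : Fin (n + 1) → ℝ | l i ∈ A}.indicator
          (fun l => ENNReal.ofReal (gibbsWeight (n + 1) β V l)) (i.insertNth x l) ≤
        (ENNReal.ofReal r *
            ∫⁻ x in S, ENNReal.ofReal (gibbsWeight (n + 1) β V (i.insertNth x l)))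
          + ∫⁻ x in S, ENNReal.ofReal
              (K * ∏ j, tailWeight ((i.insertNth x l : Fin (n + 1) → ℝ) j)) := by
      intro l hl
      have hpw := (continuous_pointWeight (N := n + 1) hβ hV l).measurable.ennreal_ofReal
      rcases H l fun j => hl j (Set.mem_univ j) with hgood | hbad
      · refine le_trans ?_ le_self_add
        have h1 : ∀ x, ENNReal.ofReal (gibbsWeight (n + 1) β V (i.insertNth x l))
            = ENNReal.ofReal (pointWeight (n + 1) β V l x)
              * ENNReal.ofReal (restWeight (n + 1) β V l) := by
          intro x
          rw [gibbsWeight_insertNth hβ, ENNReal.ofReal_mul (pointWeight_nonneg l x)]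
        have h2 : ∀ x, {l : Fin (n + 1) → ℝ | l i ∈ A}.indicator
            (fun l => ENNReal.ofReal (gibbsWeight (n + 1) β V l)) (i.insertNth x l)
            = A.indicator (fun x => ENNReal.ofReal (pointWeight (n + 1) β V l x)
              * ENNReal.ofReal (restWeight (n + 1) β V l)) x := by
          intro x
          by_cases hx : x ∈ A
          · rw [Set.indicator_of_mem (by simpa using hx), Set.indicator_of_mem hx, h1]
          · rw [Set.indicator_of_notMem (by simpa using hx), Set.indicator_of_notMem hx]
        simp_rw [h2, h1]
        rw [lintegral_indicator hA, Measure.restrict_restrict hA, Set.inter_eq_left.2 hAS,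
          lintegral_mul_const _ hpw, lintegral_mul_const _ hpw, ← mul_assoc]
        gcongr
      · refine le_trans ?_ le_add_self
        refine setLIntegral_mono' hS fun x hx => ?_
        refine (Set.indicator_le_self _ _ _).trans (ENNReal.ofReal_le_ofReal (hbad i x hx))
    refine (setLIntegral_mono' (MeasurableSet.univ_pi fun _ => hS) hbound).trans ?_
    have hjoint : Measurable fun p : (Fin n → ℝ) × ℝ =>
        (i.insertNth p.2 p.1 : Fin (n + 1) → ℝ) := by
      refine measurable_pi_lambda _ fun j => ?_
      rcases Fin.eq_self_or_eq_succAbove i j with rfl | ⟨k, rfl⟩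
      · simpa using measurable_snd
      · simp only [Fin.insertNth_apply_succAbove]
        fun_prop
    have hm1 : Measurable fun l : Fin n → ℝ =>
        ∫⁻ x in S, ENNReal.ofReal (gibbsWeight (n + 1) β V (i.insertNth x l)) :=
      (hw.comp hjoint).lintegral_prod_right'
    rw [lintegral_add_left (hm1.const_mul _), lintegral_const_mul _ hm1]
    gcongr
    rw [← lintegral_pi_insertNth S i htm]
    exact setLIntegral_le_lintegral _ _
  have hunion : {l : Fin (n + 1) → ℝ | ∃ i, l i ∈ A} = ⋃ i, {l | l i ∈ A} := by
    ext l; simp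
  rw [hunion]
  refine (measure_iUnion_fintype_le _ _).trans ((Finset.sum_le_sum fun i _ => hone i).trans ?_)
  simp only [Finset.sum_const, Finset.card_univ, Fintype.card_fin, nsmul_eq_mul]
  exact le_rfl

/-- A sum of an exponentially small term and a Gaussian term, each multiplied by the number of
points, is exponentially small. -/
lemma eventually_mul_exp_le {r a b K : ℝ} (ha : 0 < a) (hb : 0 < b) :
    ∀ᶠ n : ℕ in atTop, ((n + 1 : ℕ) : ℝ) * (r * Real.exp (-a * n) +
        Real.exp (-b * ((n + 1 : ℕ) : ℝ) ^ 2 + K * (n + 1 : ℕ)))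
      ≤ Real.exp (-(((n + 1 : ℕ) : ℝ) * (a / 2))) := by
  have hlim : Tendsto (fun n : ℕ => (|r| * Real.exp a + 1) *
      ((n : ℝ) ^ 1 * Real.exp (-(a / 2)) ^ n)) atTop (𝓝 ((|r| * Real.exp a + 1) * 0)) :=
    (tendsto_pow_const_mul_const_pow_of_abs_lt_one 1 (by
      rw [abs_of_pos (Real.exp_pos _), Real.exp_lt_one_iff]; linarith)).const_mul _
  rw [mul_zero] at hlim
  have h1 : ∀ᶠ N : ℕ in atTop, (|r| * Real.exp a + 1) *
      ((N : ℝ) ^ 1 * Real.exp (-(a / 2)) ^ N) < 1 := hlim.eventually_lt_const one_pos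
  have h2 : ∀ᶠ N : ℕ in atTop, (K + a) / b ≤ (N : ℝ) :=
    tendsto_natCast_atTop_atTop.eventually_ge_atTop _
  have h3 := (tendsto_add_atTop_nat 1).eventually (h1.and h2)
  filter_upwards [h3] with n hn
  obtain ⟨hn1, hn2⟩ := hn
  set N : ℝ := ((n + 1 : ℕ) : ℝ) with hN
  have hN0 : 0 ≤ N := Nat.cast_nonneg _
  rw [pow_one, ← Real.exp_nat_mul, ← hN] at hn1
  have hnN : (n : ℝ) = N - 1 := by rw [hN]; push_cast; ring
  rw [div_le_iff₀ hb] at hn2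
  have e1 : Real.exp (-b * N ^ 2 + K * N) ≤ Real.exp (-a * N) := by
    refine Real.exp_le_exp.2 ?_
    nlinarith
  have e2 : r * Real.exp (-a * n) ≤ |r| * Real.exp a * Real.exp (-a * N) := by
    rw [mul_assoc, ← Real.exp_add, hnN]
    have : -a * (N - 1) = a + -a * N := by ring
    rw [this]
    exact mul_le_mul_of_nonneg_right (le_abs_self r) (Real.exp_pos _).le
  have e3 : Real.exp (-a * N) = Real.exp (N * -(a / 2)) * Real.exp (-(N * (a / 2))) := by
    rw [← Real.exp_add]; congr 1; ring
  calc N * (r * Real.exp (-a * n) + Real.exp (-b * N ^ 2 + K * N))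
      ≤ N * (|r| * Real.exp a * Real.exp (-a * N) + Real.exp (-a * N)) := by gcongr
    _ = ((|r| * Real.exp a + 1) * (N * Real.exp (N * -(a / 2)))) * Real.exp (-(N * (a / 2))) := by
        rw [e3]; ring
    _ ≤ 1 * Real.exp (-(N * (a / 2))) :=
        mul_le_mul_of_nonneg_right hn1.le (Real.exp_pos _).le
    _ = _ := one_mul _

/-- Outliers are exponentially unlikely: if no minimizer of the effective potential lies in the
closed set `A`, which keeps a positive distance from the equilibrium measure, then the probability
that one of the points lies in `A` decays exponentially. -/
theorem exists_outlier_decay (hβ : 0 < β) (hV : Continuous V) (hS : IsClosed S)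
    (hconv : Convex ℝ S) {a b : ℝ} (hab : a < b) (habS : Set.Icc a b ⊆ S) {κ C : ℝ} (hκ : 0 < κ)
    (hconf : ∀ x ∈ S, (1 + κ) * Real.log (1 + |x|) - C ≤ V x / 2) {μ : Measure ℝ}
    (hμ : IsEquilibriumMeasure V S μ) {M₀ : ℝ} (hμM₀ : ∀ᵐ x ∂μ, |x| ≤ M₀) (hA : IsClosed A)
    (hAS : A ⊆ S) {ε₀ : ℝ} (hε₀ : 0 < ε₀) (hfar₀ : ∀ x ∈ A, ∀ᵐ ξ ∂μ, ε₀ ≤ |x - ξ|)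
    (hmin : ∀ x ∈ A, ¬ ∀ y, effPotential V S μ x ≤ effPotential V S μ y) :
    ∃ η > 0, ∀ᶠ N : ℕ in atTop, partitionFunction N β V S ≠ 0 ∧ partitionFunction N β V S ≠ ⊤ ∧
      gibbsMeasure N β V S {l | ∃ i, l i ∈ A} ≤
        ENNReal.ofReal (Real.exp (-((N : ℝ) * η))) * partitionFunction N β V S := by
  have hprob : IsProbabilityMeasure μ := hμ.1
  have hμS : ∀ᵐ x ∂μ, x ∈ S := hμ.2.1
  -- the constant in the confinement bound may be taken nonnegative
  wlog hC : 0 ≤ C generalizing C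
  · exact this (C := 0) (fun x hx => by linarith [hconf x hx]) le_rfl
  set ε := min ε₀ 1 with hεdef
  have hε : 0 < ε := lt_min hε₀ one_pos
  have hfar : ∀ x ∈ A, ∀ᵐ ξ ∂μ, ε ≤ |x - ξ| := fun x hx =>
    (hfar₀ x hx).mono fun ξ h => (min_le_left _ _).trans h
  set M₁ := max M₀ (max |a| |b|) with hM₁
  have hfin : LogFinite μ μ := by
    refine hμ.logFinite (M := M₁) hS hV hconv hab habS (Set.Icc_subset_Icc ?_ ?_)
      (hμM₀.mono fun x hx => hx.trans (le_max_left _ _))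
    · have := (le_max_left |a| |b|).trans (le_max_right M₀ _)
      linarith [neg_abs_le a]
    · exact (le_abs_self b).trans ((le_max_right _ _).trans (le_max_right _ _))
  obtain ⟨x₀, hx₀S, m, hx₀, hm⟩ := exists_min_effPotential hS hV hμM₀ hμS hκ hconf hfin
  set M := max M₁ |x₀| with hM
  have hM₁M : M₁ ≤ M := le_max_left _ _
  have hx₀M : |x₀| ≤ M := le_max_right _ _
  have hμM : ∀ᵐ x ∂μ, |x| ≤ M := hμM₀.mono fun x hx =>
    hx.trans ((le_max_left _ _).trans hM₁M)
  have habM : Set.Icc a b ⊆ Set.Icc (-M) M := by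
    refine Set.Icc_subset_Icc ?_ ?_
    · have := ((le_max_left |a| |b|).trans (le_max_right M₀ _)).trans hM₁M
      linarith [neg_abs_le a]
    · exact (le_abs_self b).trans (((le_max_right _ _).trans (le_max_right _ _)).trans hM₁M)
  have hM0 : 0 ≤ M := (abs_nonneg x₀).trans hx₀M
  have hmean := hμ.mean_le hS hV hconv hab habS habM hμM hfin hx₀M hx₀
  have hmA : ∀ y ∈ A, (m : EReal) < effPotential V S μ y := by
    intro y hy
    refine lt_of_le_of_ne (hm y) fun h => hmin y hy ?_
    rw [← h]
    exact hm
  obtain ⟨δ, hδ, κ', hκ', hgap⟩ :=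
    exists_gap hA hAS hV hμM hκ hconf hε (min_le_right _ _) hfar hmA
  obtain ⟨ρ, hρ, hρm⟩ := exists_trial_potential hS hV hconv hab habS habM hμM hx₀M hx₀
    (show 0 < δ / 8 by positivity)
  have := hρ.prob
  obtain ⟨Cρ, hCρ, hρle⟩ := hρ.density
  -- the scale at which closeness to the equilibrium measure is tested
  set h := min ε (δ / (16 * Cρ)) with hh
  have hh0 : 0 < h := lt_min hε (by positivity)
  have hh1 : h ≤ 1 := (min_le_left _ _).trans (min_le_right _ _)
  have hhδ : Cρ * (2 * h) ≤ δ / 8 := by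
    calc Cρ * (2 * h) ≤ Cρ * (2 * (δ / (16 * Cρ))) := by
          gcongr; exact min_le_right _ _
      _ = δ / 8 := by field_simp; ring
  obtain ⟨δ', hδ', hclose⟩ := regPot_gap_of_regDist_le hδ hκ' hh0 hh1 (min_le_left _ _) hM0 hμM
    hgap hρ hρm
  obtain ⟨h₁, hh₁, hge⟩ := exists_regPot_ge hS hV hμM hκ hconf hm (show 0 < δ' / 8 by positivity)
  -- the finer scale at which the energy of the other configurations is estimated
  set h₂ := min h h₁ with hh₂
  have hh₂0 : 0 < h₂ := lt_min hh0 hh₁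
  have hh₂1 : h₂ ≤ 1 := (min_le_left _ _).trans hh1
  -- `e` bounds from below the energy of the configurations far from equilibrium, and `e'` what is
  -- left of it after the fraction `θ` spent on integrability; `e'` still exceeds the energy of the
  -- trial measure `ν`, which is at most `e₀ + δ' / 4`
  set e₀ := ∫ x, V x ∂μ - logEnergy μ μ with he₀
  set e := e₀ + δ' - 2 * (δ' / 8) with he
  set e' := e₀ + δ' / 2 with he'
  set θ := min 1 (δ' / (4 * (|e| + 2 * C + 1))) with hθ
  have hθ0 : 0 < θ := lt_min one_pos (by positivity)
  have hθe : e' + θ * (e + 2 * C) ≤ e := by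
    have h1 : θ * (e + 2 * C) ≤ δ' / 4 := by
      calc θ * (e + 2 * C) ≤ θ * (|e| + 2 * C + 1) :=
            mul_le_mul_of_nonneg_left (by linarith [le_abs_self e]) hθ0.le
        _ ≤ δ' / (4 * (|e| + 2 * C + 1)) * (|e| + 2 * C + 1) := by
            gcongr; exact min_le_right _ _
        _ = δ' / 4 := by field_simp
    linarith
  obtain ⟨ν, hν, hνe⟩ := exists_trial_energy hS hV hconv hab habS habM hμS hμM hfin
    (show 0 < δ' / 4 by positivity)
  have := hν.prob
  obtain ⟨Cν, hCν, hνle⟩ := hν.density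
  set K₀ := 4 * C + (1 - Real.log h₂) with hK₀
  set r := Cρ * tailConst * Real.exp (β * (C + (∫ x, V x ∂ρ) / 2)) with hr
  have htc := tailConst_nonneg
  have hr0 : 0 ≤ r := by positivity
  set K₃ := β / 2 * (2 * |e'| + K₀ + |logEnergy ν ν|) + Cν * tailConst with hK₃
  refine ⟨β * δ / 2 / 2, by positivity, ?_⟩
  have hlarge : ∀ c : ℝ, 0 < c → ∀ᶠ n : ℕ in atTop, 2 ≤ c * n := fun c hc =>
    (tendsto_natCast_atTop_atTop.const_mul_atTop hc).eventually_ge_atTop 2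
  rw [← Filter.map_add_atTop_eq_nat 1, eventually_map]
  filter_upwards [eventually_gt_atTop 0, hlarge (β * (κ' / 2)) (by positivity),
    hlarge (β * θ * κ) (by positivity), hlarge (β * κ) (by positivity),
    eventually_mul_exp_le (r := r) (a := β * δ / 2) (b := β * δ' / 8) (K := K₃)
      (by positivity) (by positivity)] with n hn hn1 hn2 hn3 hn4
  have hZtop : partitionFunction (n + 1) β V S ≠ ⊤ := by
    refine partitionFunction_ne_top hβ hS.measurableSet hconf ?_
    push_cast
    have : 0 < β * κ := by positivity
    linarith
  have hZlow := partitionFunction_ge hβ hV hν.ae_mem hν.abs_le hCν hνle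
    (hν.logFinite hν.abs_le) (n + 1)
  set N : ℝ := ((n + 1 : ℕ) : ℝ) with hN
  have hnN : (n : ℝ) = N - 1 := by rw [hN]; push_cast; ring
  have hN1 : 1 ≤ N := by rw [hN]; push_cast; linarith [n.cast_nonneg (α := ℝ)]
  set z := Cν⁻¹ ^ (n + 1) * Real.exp (-(β / 2) *
      (N ^ 2 * ∫ x, V x ∂ν - N * (N - 1) * logEnergy ν ν)) with hz
  have hz0 : 0 < z := by positivity
  have hZ0 : partitionFunction (n + 1) β V S ≠ 0 := by
    intro h0
    rw [h0] at hZlow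
    simp [hz0.not_ge] at hZlow
  refine ⟨hZ0, hZtop, ?_⟩
  set K := Real.exp (-(β / 2) * ((n : ℝ) ^ 2 * e' - K₀ * (n + 1))) with hK
  have hout := gibbsMeasure_outlier_le (r := r * Real.exp (-(β * δ / 2) * n)) (K := K) hβ hV
    hS.measurableSet hA.measurableSet hAS (n := n) (Real.exp_pos _).le (by
      intro l hl
      have := isProbabilityMeasure_empirical l hn
      obtain ⟨R, hR⟩ := exists_abs_le_empirical l
      by_cases hdist : regDist h (empirical l) μ ≤ δ'
      · left
        exact lintegral_pointWeight_le hβ hV hκ hconf hA.measurableSet hAS hρ.ae_mem hρ.abs_le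
          hCρ hρle hh0 hhδ hn (by linarith) l (hclose (empirical l) this ⟨R, hR⟩ hdist)
      · right
        intro i x hx
        have hd : δ' ≤ regDist h₂ (empirical l) μ := by
          refine (not_le.1 hdist).le.trans (regDist_anti (M := max R M) hh₂0 (min_le_left _ _)
            (hR.mono fun x hx => hx.trans (le_max_left _ _))
            (hμM.mono fun x hx => hx.trans (le_max_right _ _)))
        have hen := energy_ge_of_regDist hh₂0 hμM hfin hmean (hge h₂ hh₂0 (min_le_right _ _)) hn hl
          hd
        exact gibbsWeight_le_of_energy_ge hβ hκ hC hconf hh₂0 hh₂1 hθ0 (min_le_left _ _) hθe hn2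
          i hx hl hen)
  refine hout.trans ?_
  -- the weight of the configurations far from equilibrium is negligible against the lower bound
  have hratio : K * tailConst ^ (n + 1) ≤ Real.exp (-(β * δ' / 8) * N ^ 2 + K₃ * N) * z := by
    have h1 : tailConst ^ (n + 1) ≤ Real.exp (Cν * tailConst * N) * Cν⁻¹ ^ (n + 1) := by
      have h2 : Cν * tailConst ≤ Real.exp (Cν * tailConst) := by
        linarith [Real.add_one_le_exp (Cν * tailConst)]
      have h3 := pow_le_pow_left₀ (by positivity) h2 (n + 1)
      rw [← Real.exp_nat_mul, mul_pow] at h3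
      rw [inv_pow, ← div_eq_mul_inv, le_div_iff₀ (by positivity), mul_comm (_ ^ _), hN,
        mul_comm _ (((n + 1 : ℕ) : ℝ))]
      exact h3
    have h4 : -(β / 2) * ((n : ℝ) ^ 2 * e' - K₀ * (n + 1)) + Cν * tailConst * N ≤
        -(β * δ' / 8) * N ^ 2 + K₃ * N + -(β / 2) *
          (N ^ 2 * ∫ x, V x ∂ν - N * (N - 1) * logEnergy ν ν) := by
      have h5 : N ^ 2 * (∫ x, V x ∂ν - logEnergy ν ν) ≤ N ^ 2 * (e' - δ' / 4) := by
        refine mul_le_mul_of_nonneg_left ?_ (sq_nonneg N)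
        linarith
      have h6 : N * logEnergy ν ν ≤ N * |logEnergy ν ν| :=
        mul_le_mul_of_nonneg_left (le_abs_self _) (by linarith)
      have h7 : (2 * N - 1) * e' ≤ 2 * N * |e'| := by
        have := mul_le_mul_of_nonneg_left (le_abs_self e') (by linarith : 0 ≤ 2 * N - 1)
        have := abs_nonneg e'
        linarith
      have h8 : (N ^ 2 * ∫ x, V x ∂ν - N * (N - 1) * logEnergy ν ν) + N ^ 2 * (δ' / 4)
          ≤ (n : ℝ) ^ 2 * e' + N * (2 * |e'| + |logEnergy ν ν|) := by
        rw [hnN]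
        linarith
      have h9 := mul_le_mul_of_nonneg_left h8 (half_pos hβ).le
      have h10 : (n : ℝ) + 1 = N := by rw [hnN]; ring
      rw [hK₃, h10]
      linarith
    calc K * tailConst ^ (n + 1)
        ≤ K * (Real.exp (Cν * tailConst * N) * Cν⁻¹ ^ (n + 1)) := by gcongr
      _ = Real.exp (-(β / 2) * ((n : ℝ) ^ 2 * e' - K₀ * (n + 1)) + Cν * tailConst * N)
            * Cν⁻¹ ^ (n + 1) := by rw [Real.exp_add]; ring
      _ ≤ Real.exp (-(β * δ' / 8) * N ^ 2 + K₃ * N + -(β / 2) *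
            (N ^ 2 * ∫ x, V x ∂ν - N * (N - 1) * logEnergy ν ν)) * Cν⁻¹ ^ (n + 1) := by
          gcongr
      _ = _ := by rw [hz, Real.exp_add]; ring
  calc ((n + 1 : ℕ) : ℝ≥0∞) * (ENNReal.ofReal (r * Real.exp (-(β * δ / 2) * n)) *
        partitionFunction (n + 1) β V S + ENNReal.ofReal (K * tailConst ^ (n + 1)))
      ≤ ((n + 1 : ℕ) : ℝ≥0∞) * (ENNReal.ofReal (r * Real.exp (-(β * δ / 2) * n)) *
        partitionFunction (n + 1) β V S + ENNReal.ofReal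
          (Real.exp (-(β * δ' / 8) * N ^ 2 + K₃ * N)) * partitionFunction (n + 1) β V S) := by
        gcongr
        refine (ENNReal.ofReal_le_ofReal hratio).trans ?_
        rw [ENNReal.ofReal_mul (Real.exp_pos _).le]
        gcongr
    _ = ENNReal.ofReal (N * (r * Real.exp (-(β * δ / 2) * n) +
          Real.exp (-(β * δ' / 8) * N ^ 2 + K₃ * N))) * partitionFunction (n + 1) β V S := by
        rw [ENNReal.ofReal_mul (show (0 : ℝ) ≤ N by linarith),
          ENNReal.ofReal_add (by positivity) (by positivity), hN, ENNReal.ofReal_natCast]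
        ring
    _ ≤ _ := by
        gcongr

end Outlier

/-! ### Cumulants under conditioning -/

section Cumulant

/-- Conditioning a probability measure on an event whose complement has probability `p` moves the
expectation of a function bounded by `B` by at most `2 p B`. -/
lemma norm_integral_sub_integral_cond_le {Ω : Type*} [MeasurableSpace Ω] {P : Measure Ω}
    [IsProbabilityMeasure P] {G : Set Ω} (hG : MeasurableSet G) (hG0 : P G ≠ 0) {f : Ω → ℂ}
    (hf : AEStronglyMeasurable f P) {B : ℝ} (hB : ∀ᵐ ω ∂P, ‖f ω‖ ≤ B) :
    ‖∫ ω, f ω ∂P - ∫ ω, f ω ∂(ProbabilityTheory.cond P G)‖ ≤ 2 * P.real Gᶜ * B := by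
  have hint : Integrable f P := Integrable.of_bound hf B hB
  have hPc : IsProbabilityMeasure (ProbabilityTheory.cond P G) :=
    ProbabilityTheory.cond_isProbabilityMeasure hG0
  have hcond : ∫ ω, f ω ∂(ProbabilityTheory.cond P G) = (P.real G)⁻¹ • ∫ ω in G, f ω ∂P := by
    rw [ProbabilityTheory.cond, integral_smul_measure, ENNReal.toReal_inv]; rfl
  have hpos : 0 < P.real G := ENNReal.toReal_pos hG0 (measure_ne_top _ _)
  have hsum : P.real G = 1 - P.real Gᶜ := by
    have := measureReal_compl (μ := P) hG
    rw [probReal_univ] at this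
    linarith
  have hin : ∫ ω in G, f ω ∂P = P.real G • ∫ ω, f ω ∂(ProbabilityTheory.cond P G) := by
    rw [hcond, smul_inv_smul₀ hpos.ne']
  have hsplit : ∫ ω, f ω ∂P - ∫ ω, f ω ∂(ProbabilityTheory.cond P G)
      = ∫ ω in Gᶜ, f ω ∂P - P.real Gᶜ • ∫ ω, f ω ∂(ProbabilityTheory.cond P G) := by
    rw [← integral_add_compl hG hint, hin, hsum, sub_smul, one_smul]
    abel
  have h1 : ‖∫ ω in Gᶜ, f ω ∂P‖ ≤ B * P.real Gᶜ :=
    norm_setIntegral_le_of_norm_le_const_ae' (measure_lt_top _ _) (hB.mono fun ω h _ => h)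
  have h2 : ‖∫ ω, f ω ∂(ProbabilityTheory.cond P G)‖ ≤ B := by
    have := norm_integral_le_of_norm_le_const
      (ProbabilityTheory.cond_absolutelyContinuous (s := G) |>.ae_le hB)
    simpa using this
  rw [hsplit]
  refine (norm_sub_le _ _).trans ?_
  rw [norm_smul, Real.norm_of_nonneg measureReal_nonneg]
  nlinarith [mul_le_mul_of_nonneg_left h2 (measureReal_nonneg (μ := P) (s := Gᶜ))]

lemma norm_prod_sub_prod_le {ι : Type*} (s : Finset ι) {a b : ι → ℂ} {M : ι → ℝ} {δ : ℝ}
    (hM : ∀ i ∈ s, 0 ≤ M i) (ha : ∀ i ∈ s, ‖a i‖ ≤ M i) (hb : ∀ i ∈ s, ‖b i‖ ≤ M i)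
    (hab : ∀ i ∈ s, ‖a i - b i‖ ≤ δ * M i) :
    ‖∏ i ∈ s, a i - ∏ i ∈ s, b i‖ ≤ s.card * δ * ∏ i ∈ s, M i := by
  classical
  induction s using Finset.induction_on with
  | empty => simp
  | insert i s hi ih =>
    simp only [Finset.forall_mem_insert] at hM ha hb hab
    rw [Finset.prod_insert hi, Finset.prod_insert hi, Finset.prod_insert hi,
      Finset.card_insert_of_notMem hi]
    have hPM : 0 ≤ ∏ i ∈ s, M i := Finset.prod_nonneg hM.2
    have hPb : ‖∏ i ∈ s, b i‖ ≤ ∏ i ∈ s, M i := by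
      rw [norm_prod]
      exact Finset.prod_le_prod (fun _ _ => norm_nonneg _) hb.2
    have ih' := ih hM.2 ha.2 hb.2 hab.2
    have h1 : a i * ∏ i ∈ s, a i - b i * ∏ i ∈ s, b i
        = a i * (∏ i ∈ s, a i - ∏ i ∈ s, b i) + (a i - b i) * ∏ i ∈ s, b i := by ring
    rw [h1]
    refine (norm_add_le _ _).trans ?_
    rw [norm_mul, norm_mul]
    calc ‖a i‖ * ‖∏ i ∈ s, a i - ∏ i ∈ s, b i‖ + ‖a i - b i‖ * ‖∏ i ∈ s, b i‖
        ≤ M i * (s.card * δ * ∏ i ∈ s, M i) + δ * M i * ∏ i ∈ s, M i :=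
          add_le_add (mul_le_mul ha.1 ih' (norm_nonneg _) hM.1)
            (mul_le_mul hab.1 hPb (norm_nonneg _) ((norm_nonneg _).trans hab.1))
      _ = _ := by push_cast; ring

/-- The combinatorial constant `∑_π |π| (|π| - 1)!` of the comparison of cumulants. -/
def partitionConst (n : ℕ) : ℝ :=
  ∑ π : Finpartition (Finset.univ : Finset (Fin n)),
    ((π.parts.card - 1).factorial : ℝ) * π.parts.card

lemma partitionConst_nonneg (n : ℕ) : 0 ≤ partitionConst n :=
  Finset.sum_nonneg fun _ _ => by positivity

/-- The joint cumulant of bounded random variables changes little under conditioning on an event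
of probability close to one: each block moment does, and the bounds on the blocks of a partition
multiply up to the same product `∏ᵢ Mᵢ`. -/
lemma norm_jointCumulant_sub_cond_le {Ω : Type*} [MeasurableSpace Ω] {P : Measure Ω}
    [IsProbabilityMeasure P] {G : Set Ω} (hG : MeasurableSet G) (hG0 : P G ≠ 0) {n : ℕ}
    {X : Fin n → Ω → ℂ} (hX : ∀ i, Measurable (X i)) {M : Fin n → ℝ} (hM0 : ∀ i, 0 ≤ M i)
    (hM : ∀ᵐ ω ∂P, ∀ i, ‖X i ω‖ ≤ M i) :
    ‖jointCumulant P X - jointCumulant (ProbabilityTheory.cond P G) X‖ ≤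
      partitionConst n * (2 * P.real Gᶜ) * ∏ i, M i := by
  have hPc : IsProbabilityMeasure (ProbabilityTheory.cond P G) :=
    ProbabilityTheory.cond_isProbabilityMeasure hG0
  have hMc : ∀ᵐ ω ∂(ProbabilityTheory.cond P G), ∀ i, ‖X i ω‖ ≤ M i :=
    ProbabilityTheory.cond_absolutelyContinuous (s := G) |>.ae_le hM
  have hblock : ∀ B : Finset (Fin n), ∀ ω, (∀ i, ‖X i ω‖ ≤ M i) →
      ‖∏ i ∈ B, X i ω‖ ≤ ∏ i ∈ B, M i := by
    intro B ω h
    rw [norm_prod]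
    exact Finset.prod_le_prod (fun _ _ => norm_nonneg _) fun i _ => h i
  have hmom : ∀ (Q : Measure Ω) [IsProbabilityMeasure Q], (∀ᵐ ω ∂Q, ∀ i, ‖X i ω‖ ≤ M i) →
      ∀ B : Finset (Fin n), ‖∫ ω, ∏ i ∈ B, X i ω ∂Q‖ ≤ ∏ i ∈ B, M i := by
    intro Q _ hQ B
    simpa using norm_integral_le_of_norm_le_const (hQ.mono fun ω h => hblock B ω h)
  rw [jointCumulant, jointCumulant, ← Finset.sum_sub_distrib, partitionConst, Finset.sum_mul,
    Finset.sum_mul]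
  refine (norm_sum_le _ _).trans (Finset.sum_le_sum fun π _ => ?_)
  have hprod : ∏ B ∈ π.parts, ∏ i ∈ B, M i = ∏ i, M i := by
    have := Finset.prod_biUnion (s := π.parts) (t := id) (f := M) π.disjoint
    rw [π.biUnion_parts] at this
    exact this.symm
  rw [← mul_sub, norm_mul, norm_mul, norm_pow, norm_neg, norm_one, one_pow, one_mul,
    Complex.norm_natCast, mul_assoc _ _ (2 * P.real Gᶜ), mul_assoc, ← hprod]
  refine mul_le_mul_of_nonneg_left ?_ (Nat.cast_nonneg _)
  refine norm_prod_sub_prod_le _ (fun B _ => Finset.prod_nonneg fun i _ => hM0 i)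
    (fun B _ => hmom P hM B) (fun B _ => hmom _ hMc B) fun B _ => ?_
  exact norm_integral_sub_integral_cond_le hG hG0
    (Finset.measurable_fun_prod _ fun i _ => hX i).aestronglyMeasurable
    (hM.mono fun ω h => hblock B ω h)

/-- Uniformly in `n`, the powers `Nⁿ` are dominated by an exponential, up to a factor depending
on `n` only. -/
lemma eventually_pow_le_mul_exp {η : ℝ} (hη : 0 < η) :
    ∀ᶠ N : ℕ in atTop, ∀ n : ℕ, 1 ≤ n →
      (N : ℝ) ^ n ≤ (n : ℝ) ^ (2 * n) * Real.exp (N * η) := by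
  have hlog : ∀ᶠ x : ℝ in atTop, Real.log x ≤ η * Real.sqrt x := by
    have := (isLittleO_log_rpow_atTop (show (0 : ℝ) < 1 / 2 by norm_num)).bound hη
    filter_upwards [this] with x h
    rw [Real.norm_eq_abs, Real.norm_eq_abs, ← Real.sqrt_eq_rpow,
      abs_of_nonneg (Real.sqrt_nonneg x)] at h
    exact (le_abs_self _).trans h
  filter_upwards [tendsto_natCast_atTop_atTop.eventually hlog, eventually_ge_atTop 1]
    with N hN hN1 n hn
  have hN0 : (0 : ℝ) < N := by exact_mod_cast hN1
  have hn1 : (1 : ℝ) ≤ n := by exact_mod_cast hn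
  rcases le_total (N : ℝ) ((n : ℝ) ^ 2) with h | h
  · calc (N : ℝ) ^ n ≤ ((n : ℝ) ^ 2) ^ n := by gcongr
      _ = (n : ℝ) ^ (2 * n) * 1 := by rw [← pow_mul, mul_one]
      _ ≤ _ := by gcongr; exact Real.one_le_exp (by positivity)
  · have hsq : (n : ℝ) ≤ Real.sqrt N := Real.le_sqrt_of_sq_le h
    calc (N : ℝ) ^ n = Real.exp (n * Real.log N) := by
          rw [Real.exp_nat_mul, Real.exp_log hN0]
      _ ≤ Real.exp (N * η) := by
          refine Real.exp_le_exp.2 ?_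
          calc (n : ℝ) * Real.log N ≤ n * (η * Real.sqrt N) := by gcongr
            _ ≤ Real.sqrt N * (η * Real.sqrt N) := by gcongr
            _ = (Real.sqrt N * Real.sqrt N) * η := by ring
            _ = N * η := by rw [Real.mul_self_sqrt hN0.le]
      _ ≤ _ := le_mul_of_one_le_left (Real.exp_pos _).le (one_le_pow₀ hn1)

end Cumulant

/-! ### Restricting the ensemble -/

section Restriction

variable {N : ℕ} {β : ℝ} {V : ℝ → ℝ} {S S' A : Set ℝ}

lemma gibbsMeasure_congr {V' : ℝ → ℝ} (hS : MeasurableSet S) (h : Set.EqOn V V' S) :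
    gibbsMeasure N β V S = gibbsMeasure N β V' S := by
  rw [gibbsMeasure, gibbsMeasure]
  refine withDensity_congr_ae ?_
  filter_upwards [ae_restrict_mem (MeasurableSet.univ_pi fun _ => hS)] with l hl
  have hVl : ∀ i, V (l i) = V' (l i) := fun i => h (hl i (Set.mem_univ i))
  simp only [gibbsWeight, hVl]

lemma gibbsMeasure_restrict (hS' : MeasurableSet S') (hsub : S' ⊆ S) :
    (gibbsMeasure N β V S).restrict (Set.univ.pi fun _ => S') = gibbsMeasure N β V S' := by
  rw [gibbsMeasure, gibbsMeasure, restrict_withDensity (MeasurableSet.univ_pi fun _ => hS'),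
    Measure.restrict_restrict (MeasurableSet.univ_pi fun _ => hS'),
    Set.inter_eq_left.2 (Set.pi_mono fun _ _ => hsub)]

lemma gibbsMeasure_pi (hS' : MeasurableSet S') (hsub : S' ⊆ S) :
    gibbsMeasure N β V S (Set.univ.pi fun _ => S') = partitionFunction N β V S' := by
  rw [partitionFunction, ← gibbsMeasure_restrict hS' hsub, Measure.restrict_apply_univ]

lemma isProbabilityMeasure_ensemble (h0 : partitionFunction N β V S ≠ 0)
    (htop : partitionFunction N β V S ≠ ⊤) : IsProbabilityMeasure (ensemble N β V S) :=
  ⟨by rw [ensemble, Measure.smul_apply, smul_eq_mul]; exact ENNReal.inv_mul_cancel h0 htop⟩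

lemma ae_ensemble_mem (hS : MeasurableSet S) : ∀ᵐ l ∂(ensemble N β V S), ∀ i, l i ∈ S := by
  refine Measure.ae_smul_measure ?_ _
  refine (withDensity_absolutelyContinuous _ _).ae_le ?_
  filter_upwards [ae_restrict_mem (MeasurableSet.univ_pi fun _ => hS)] with l hl i
  exact hl i (Set.mem_univ i)

/-- The ensemble on a smaller set is the ensemble conditioned on having all points there. -/
lemma ensemble_eq_cond (hS' : MeasurableSet S') (hsub : S' ⊆ S)
    (h0 : partitionFunction N β V S ≠ 0) (htop : partitionFunction N β V S ≠ ⊤) :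
    ensemble N β V S' = ProbabilityTheory.cond (ensemble N β V S) (Set.univ.pi fun _ => S') := by
  rw [ProbabilityTheory.cond, ensemble, ensemble, Measure.restrict_smul,
    gibbsMeasure_restrict hS' hsub, smul_smul, Measure.smul_apply, smul_eq_mul,
    gibbsMeasure_pi hS' hsub, ENNReal.mul_inv (Or.inl (ENNReal.inv_ne_zero.2 htop))
      (Or.inl (ENNReal.inv_ne_top.2 h0)), inv_inv, mul_right_comm, ENNReal.mul_inv_cancel h0 htop,
    one_mul]

lemma norm_sum_one_div_le {K : Set ℂ} {z : ℂ} (hz : 0 < Metric.infDist z K) {w : Fin N → ℂ}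
    (hw : ∀ k, w k ∈ K) : ‖∑ k, 1 / (z - w k)‖ ≤ N / Metric.infDist z K := by
  refine (norm_sum_le _ _).trans ?_
  calc ∑ k, ‖1 / (z - w k)‖ ≤ ∑ _k : Fin N, 1 / Metric.infDist z K := by
        refine Finset.sum_le_sum fun k _ => ?_
        rw [norm_div, norm_one, ← dist_eq_norm]
        exact one_div_le_one_div_of_le hz (Metric.infDist_le_dist_of_mem (hw k))
    _ = _ := by simp [div_eq_mul_inv]

/-- The constant of the comparison of the correlators of order `n`. -/
def correlatorConst (n : ℕ) : ℝ := 2 * partitionConst n * (n : ℝ) ^ (2 * n) + 1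

lemma correlatorConst_pos (n : ℕ) : 0 < correlatorConst n := by
  have := partitionConst_nonneg n
  unfold correlatorConst
  positivity

/-- If outliers in `A` are exponentially unlikely, then points of `A` may be removed from the
domain of the ensemble. Half of the exponential rate is spent on the powers of `N` which bound the
resolvent traces. -/
theorem expClose_of_outlier_decay (hS : IsClosed S) (hne : S.Nonempty) (hS' : MeasurableSet S')
    (hsub : S' ⊆ S) (hdiff : S \ S' ⊆ A) {η : ℝ} (hη : 0 < η)
    (hdecay : ∀ᶠ N : ℕ in atTop,
      partitionFunction N β V S ≠ 0 ∧ partitionFunction N β V S ≠ ⊤ ∧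
      gibbsMeasure N β V S {l | ∃ i, l i ∈ A} ≤
        ENNReal.ofReal (Real.exp (-((N : ℝ) * η))) * partitionFunction N β V S) :
    ExpClose correlatorConst β V S S' (η / 2) := by
  have hSm := hS.measurableSet
  have hhalf : ∀ᶠ N : ℕ in atTop, Real.exp (-((N : ℝ) * η)) ≤ 1 / 2 := by
    have h : Tendsto (fun N : ℕ => Real.exp (-((N : ℝ) * η))) atTop (𝓝 0) :=
      Real.tendsto_exp_neg_atTop_nhds_zero.comp (tendsto_natCast_atTop_atTop.atTop_mul_const hη)
    exact h.eventually_le_const (by norm_num)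
  -- the probability of the complement of `S'ᴺ` under the ensemble on `S`
  have hp : ∀ᶠ N : ℕ in atTop, partitionFunction N β V S ≠ 0 ∧ partitionFunction N β V S ≠ ⊤ ∧
      (ensemble N β V S).real (Set.univ.pi fun _ => S')ᶜ ≤ Real.exp (-((N : ℝ) * η)) := by
    filter_upwards [hdecay] with N hN
    obtain ⟨h0, htop, hle⟩ := hN
    refine ⟨h0, htop, ENNReal.toReal_le_of_le_ofReal (Real.exp_pos _).le ?_⟩
    calc ensemble N β V S (Set.univ.pi fun _ => S')ᶜ
        ≤ ensemble N β V S {l | ∃ i, l i ∈ A} := by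
          refine measure_mono_ae ?_
          filter_upwards [ae_ensemble_mem hSm] with l hl hlS
          by_contra hlA
          refine hlS fun i _ => ?_
          by_contra hi
          exact hlA ⟨i, hdiff ⟨hl i, hi⟩⟩
      _ ≤ (partitionFunction N β V S)⁻¹ *
          (ENNReal.ofReal (Real.exp (-((N : ℝ) * η))) * partitionFunction N β V S) := by
          rw [ensemble, Measure.smul_apply, smul_eq_mul]
          gcongr
      _ = _ := by
          rw [mul_left_comm, ENNReal.inv_mul_cancel h0 htop, mul_one]
  have hZ : ∀ᶠ N : ℕ in atTop, partitionFunction N β V S ≠ 0 ∧ partitionFunction N β V S ≠ ⊤ ∧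
      partitionFunction N β V S' ≠ 0 ∧ partitionFunction N β V S' ≠ ⊤ ∧
      (ensemble N β V S).real (Set.univ.pi fun _ => S')ᶜ ≤ Real.exp (-((N : ℝ) * η)) ∧
      (partitionFunction N β V S').toReal = (partitionFunction N β V S).toReal *
        (1 - (ensemble N β V S).real (Set.univ.pi fun _ => S')ᶜ) := by
    filter_upwards [hp, hhalf] with N hN hN2
    obtain ⟨h0, htop, hle⟩ := hN
    have hprob := isProbabilityMeasure_ensemble h0 htop
    have hG : MeasurableSet (Set.univ.pi fun _ : Fin N => S') :=
      MeasurableSet.univ_pi fun _ => hS'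
    have hcompl := measureReal_compl (μ := ensemble N β V S) hG
    rw [probReal_univ] at hcompl
    have hreal : (ensemble N β V S).real (Set.univ.pi fun _ => S')
        = (partitionFunction N β V S).toReal⁻¹ * (partitionFunction N β V S').toReal := by
      rw [Measure.real, ensemble, Measure.smul_apply, smul_eq_mul, gibbsMeasure_pi hS' hsub,
        ENNReal.toReal_mul, ENNReal.toReal_inv]
    have hZpos : 0 < (partitionFunction N β V S).toReal := ENNReal.toReal_pos h0 htop
    have heq : (partitionFunction N β V S').toReal = (partitionFunction N β V S).toReal *
        (1 - (ensemble N β V S).real (Set.univ.pi fun _ => S')ᶜ) := by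
      rw [hcompl, hreal]; field_simp; ring
    refine ⟨h0, htop, ?_, ?_, hle, heq⟩
    · intro h
      rw [h, ENNReal.toReal_zero] at heq
      have : 0 < (partitionFunction N β V S).toReal *
        (1 - (ensemble N β V S).real (Set.univ.pi fun _ => S')ᶜ) :=
        mul_pos hZpos (by linarith)
      linarith
    · rw [← gibbsMeasure_pi hS' hsub]
      exact ne_top_of_le_ne_top htop (measure_mono (Set.subset_univ _))
  refine ⟨hZ.mono fun N h => ⟨h.1, h.2.1, h.2.2.1, h.2.2.2.1⟩,
    ⟨fun N => (partitionFunction N β V S).toReal / (partitionFunction N β V S').toReal - 1,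
      ?_, ?_⟩, ?_⟩
  · refine Asymptotics.IsBigO.of_bound 2 ?_
    filter_upwards [hZ, hhalf] with N hN hN2
    obtain ⟨h0, htop, h0', htop', hle, heq⟩ := hN
    have hZpos : 0 < (partitionFunction N β V S).toReal := ENNReal.toReal_pos h0 htop
    set p := (ensemble N β V S).real (Set.univ.pi fun _ => S')ᶜ
    have hp0 : 0 ≤ p := measureReal_nonneg
    have hp1 : 0 < 1 - p := by linarith
    have hratio : (partitionFunction N β V S).toReal / (partitionFunction N β V S').toReal - 1
        = p / (1 - p) := by
      rw [heq]; field_simp; ring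
    rw [hratio, Real.norm_of_nonneg (by positivity), Real.norm_of_nonneg (Real.exp_pos _).le,
      div_le_iff₀ hp1]
    have h1 : Real.exp (-((N : ℝ) * η)) ≤ Real.exp (-((N : ℝ) * (η / 2))) := by
      refine Real.exp_le_exp.2 ?_
      have : 0 ≤ (N : ℝ) * η := by positivity
      linarith
    nlinarith [Real.exp_pos (-((N : ℝ) * (η / 2)))]
  · filter_upwards [hZ] with N hN
    obtain ⟨h0, htop, h0', htop', hle, heq⟩ := hN
    have := (ENNReal.toReal_pos h0' htop').ne'
    field_simp
    ring
  · filter_upwards [hZ, eventually_pow_le_mul_exp (half_pos hη)] with N hN hpow n hn x hx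
    obtain ⟨h0, htop, h0', htop', hle, heq⟩ := hN
    have hprob := isProbabilityMeasure_ensemble h0 htop
    have hG : MeasurableSet (Set.univ.pi fun _ : Fin N => S') :=
      MeasurableSet.univ_pi fun _ => hS'
    have hG0 : ensemble N β V S (Set.univ.pi fun _ => S') ≠ 0 := by
      rw [ensemble, Measure.smul_apply, smul_eq_mul, gibbsMeasure_pi hS' hsub]
      exact mul_ne_zero (ENNReal.inv_ne_zero.2 htop) h0'
    have hd : ∀ i, 0 < Metric.infDist (x i) (Complex.ofReal '' S) := fun i =>
      ((Complex.isometry_ofReal.isClosedEmbedding.isClosedMap S hS).notMem_iff_infDist_pos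
        (hne.image _)).1 (hx i)
    have hbound := norm_jointCumulant_sub_cond_le (P := ensemble N β V S) hG hG0
      (X := fun i l => ∑ k, 1 / (x i - (l k : ℂ))) (fun i => by fun_prop)
      (M := fun i => N / Metric.infDist (x i) (Complex.ofReal '' S))
      (fun i => div_nonneg (Nat.cast_nonneg _) (hd i).le)
      ((ae_ensemble_mem hSm).mono fun l hl i =>
        norm_sum_one_div_le (hd i) fun k => Set.mem_image_of_mem _ (hl k))
    rw [← ensemble_eq_cond hS' hsub h0 htop] at hbound
    refine hbound.trans ?_
    rw [Finset.prod_div_distrib, Finset.prod_const, Finset.card_univ, Fintype.card_fin,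
      ← mul_div_assoc]
    refine div_le_div_of_nonneg_right ?_ (Finset.prod_nonneg fun i _ => (hd i).le)
    have hK := partitionConst_nonneg n
    calc partitionConst n * (2 * (ensemble N β V S).real (Set.univ.pi fun _ => S')ᶜ) * (N : ℝ) ^ n
        ≤ partitionConst n * (2 * Real.exp (-((N : ℝ) * η))) *
            ((n : ℝ) ^ (2 * n) * Real.exp (N * (η / 2))) := by
          gcongr
          exact hpow n hn
      _ = 2 * partitionConst n * (n : ℝ) ^ (2 * n) *
            (Real.exp (-((N : ℝ) * η)) * Real.exp (N * (η / 2))) := by ring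
      _ = 2 * partitionConst n * (n : ℝ) ^ (2 * n) * Real.exp (-((N : ℝ) * (η / 2))) := by
          rw [← Real.exp_add]; congr 2; ring
      _ ≤ _ := by
          gcongr
          unfold correlatorConst
          linarith

end Restriction

/-! ### Confining potentials on an interval -/

section Interval

variable {bl br : EReal} {V : ℝ → ℝ}

lemma isClosed_realInterval (bl br : EReal) : IsClosed (realInterval bl br) :=
  (isClosed_le continuous_const continuous_coe_real_ereal).inter
    (isClosed_le continuous_coe_real_ereal continuous_const)

lemma convex_realInterval (bl br : EReal) : Convex ℝ (realInterval bl br) := by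
  refine Set.OrdConnected.convex ⟨fun x hx y hy z hz => ⟨hx.1.trans ?_, le_trans ?_ hy.2⟩⟩
  · exact EReal.coe_le_coe_iff.2 hz.1
  · exact EReal.coe_le_coe_iff.2 hz.2

lemma exists_Icc_subset_realInterval (h : bl < br) :
    ∃ a b : ℝ, a < b ∧ Set.Icc a b ⊆ realInterval bl br := by
  obtain ⟨a, ha, ha'⟩ := EReal.lt_iff_exists_real_btwn.1 h
  obtain ⟨b, hb, hb'⟩ := EReal.lt_iff_exists_real_btwn.1 ha'
  exact ⟨a, b, EReal.coe_lt_coe_iff.1 hb, fun x hx =>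
    ⟨ha.le.trans (EReal.coe_le_coe_iff.2 hx.1), (EReal.coe_le_coe_iff.2 hx.2).trans hb'.le⟩⟩

/-- The growth condition at infinity, in the form of a lower bound by a multiple of
`log (1 + |x|)` with a factor greater than one. -/
lemma exists_eventually_log_le {l : Filter ℝ} (hl : Tendsto (fun x : ℝ => |x|) l atTop)
    (h : 1 < liminf (fun x : ℝ => ((V x / (2 * Real.log |x|) : ℝ) : EReal)) l) :
    ∃ κ > 0, ∃ C : ℝ, ∀ᶠ x in l, (1 + κ) * Real.log (1 + |x|) - C ≤ V x / 2 := by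
  obtain ⟨r, hr1, hr⟩ := EReal.lt_iff_exists_real_btwn.1 h
  have hr1' : 1 < r := by exact_mod_cast hr1
  refine ⟨r - 1, by linarith, r * Real.log 2, ?_⟩
  filter_upwards [eventually_lt_of_lt_liminf hr, hl.eventually_gt_atTop 1] with x hx hx1
  have hx' : r < V x / (2 * Real.log |x|) := EReal.coe_lt_coe_iff.1 hx
  have hlog : 0 < Real.log |x| := Real.log_pos hx1
  rw [lt_div_iff₀ (by linarith)] at hx'
  have h2 : Real.log (1 + |x|) ≤ Real.log 2 + Real.log |x| := by
    rw [← Real.log_mul (by norm_num) (by linarith)]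
    exact Real.log_le_log (by linarith) (by linarith)
  have := mul_le_mul_of_nonneg_left h2 (show 0 ≤ r by linarith)
  linarith

lemma exists_confinement (hV : ContinuousOn V (realInterval bl br))
    (hl : bl = ⊥ → 1 < liminf (fun x : ℝ => ((V x / (2 * Real.log |x|) : ℝ) : EReal)) atBot)
    (hr : br = ⊤ → 1 < liminf (fun x : ℝ => ((V x / (2 * Real.log |x|) : ℝ) : EReal)) atTop) :
    ∃ κ > 0, ∃ C : ℝ, ∀ x ∈ realInterval bl br,
      (1 + κ) * Real.log (1 + |x|) - C ≤ V x / 2 := by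
  have hbot : ∃ κ > 0, ∃ C : ℝ, ∀ᶠ x in atBot, x ∈ realInterval bl br →
      (1 + κ) * Real.log (1 + |x|) - C ≤ V x / 2 := by
    by_cases hb : bl = ⊥
    · obtain ⟨κ, hκ, C, h⟩ := exists_eventually_log_le tendsto_abs_atBot_atTop (hl hb)
      exact ⟨κ, hκ, C, h.mono fun x hx _ => hx⟩
    · obtain ⟨a, -, ha⟩ := EReal.lt_iff_exists_real_btwn.1 (bot_lt_iff_ne_bot.2 hb)
      refine ⟨1, one_pos, 0, (eventually_le_atBot a).mono fun x hx hxS => ?_⟩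
      exact absurd (hxS.1.trans (EReal.coe_le_coe_iff.2 hx)) ha.not_ge
  have htop : ∃ κ > 0, ∃ C : ℝ, ∀ᶠ x in atTop, x ∈ realInterval bl br →
      (1 + κ) * Real.log (1 + |x|) - C ≤ V x / 2 := by
    by_cases hb : br = ⊤
    · obtain ⟨κ, hκ, C, h⟩ := exists_eventually_log_le tendsto_abs_atTop_atTop (hr hb)
      exact ⟨κ, hκ, C, h.mono fun x hx _ => hx⟩
    · obtain ⟨b, hb', -⟩ := EReal.lt_iff_exists_real_btwn.1 (lt_top_iff_ne_top.2 hb)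
      refine ⟨1, one_pos, 0, (eventually_ge_atTop b).mono fun x hx hxS => ?_⟩
      exact absurd ((EReal.coe_le_coe_iff.2 hx).trans hxS.2) hb'.not_ge
  obtain ⟨κ₁, hκ₁, C₁, h₁⟩ := hbot
  obtain ⟨κ₂, hκ₂, C₂, h₂⟩ := htop
  obtain ⟨u, hu⟩ := eventually_atBot.1 h₁
  obtain ⟨v, hv⟩ := eventually_atTop.1 h₂
  set κ := min κ₁ κ₂ with hκ
  have hcont : ContinuousOn (fun x => (1 + κ) * Real.log (1 + |x|) - V x / 2)
      (realInterval bl br ∩ Set.Icc u v) := by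
    refine ContinuousOn.sub (Continuous.continuousOn ?_)
      ((hV.mono Set.inter_subset_left).div_const 2)
    exact continuous_const.mul ((continuous_const.add continuous_abs).log
      fun x => (add_pos_of_pos_of_nonneg one_pos (abs_nonneg x)).ne')
  obtain ⟨C₀, hC₀⟩ :=
    ((isCompact_Icc.inter_left (isClosed_realInterval bl br)).bddAbove_image hcont)
  refine ⟨κ, lt_min hκ₁ hκ₂, max C₀ (max C₁ C₂), fun x hx => ?_⟩
  have hlog : 0 ≤ Real.log (1 + |x|) := Real.log_nonneg (by linarith [abs_nonneg x])
  have hC1 : C₁ ≤ max C₀ (max C₁ C₂) := (le_max_left _ _).trans (le_max_right _ _)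
  have hC2 : C₂ ≤ max C₀ (max C₁ C₂) := (le_max_right _ _).trans (le_max_right _ _)
  rcases le_total x u with hxu | hxu
  · have h := hu x hxu hx
    have := mul_le_mul_of_nonneg_right (min_le_left κ₁ κ₂) hlog
    rw [← hκ] at this
    linarith
  rcases le_total v x with hxv | hxv
  · have h := hv x hxv hx
    have := mul_le_mul_of_nonneg_right (min_le_right κ₁ κ₂) hlog
    rw [← hκ] at this
    linarith
  · have h := hC₀ (Set.mem_image_of_mem _ ⟨hx, hxu, hxv⟩)
    have := le_max_left C₀ (max C₁ C₂)
    linarith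

end Interval

/-! ### Removing a part of the domain -/

section Removal

variable {β : ℝ} {V : ℝ → ℝ} {S S' A : Set ℝ} {μ : Measure ℝ}

lemma energy_congr {V' : ℝ → ℝ} (h : Set.EqOn V V' S) {ν : Measure ℝ} [SFinite ν]
    (hν : ν Sᶜ = 0) : energy V ν = energy V' ν := by
  have hmem : ∀ᵐ x ∂ν, x ∈ S := hν
  have hae : ∀ᵐ p ∂ν.prod ν, p.1 ∈ S ∧ p.2 ∈ S :=
    (Measure.quasiMeasurePreserving_fst.ae hmem).and (Measure.quasiMeasurePreserving_snd.ae hmem)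
  have heq : (fun p : ℝ × ℝ => ((V p.1 / 2 + V p.2 / 2 : ℝ) : EReal) - logDist p.1 p.2)
      =ᵐ[ν.prod ν] fun p => ((V' p.1 / 2 + V' p.2 / 2 : ℝ) : EReal) - logDist p.1 p.2 := by
    filter_upwards [hae] with p hp
    rw [h hp.1, h hp.2]
  rw [energy, energy, extIntegral, extIntegral,
    lintegral_congr_ae (heq.mono fun p hp => congrArg EReal.toENNReal hp),
    lintegral_congr_ae (heq.mono fun p hp => congrArg (fun z => EReal.toENNReal (-z)) hp)]

lemma IsEquilibriumMeasure.congr {V' : ℝ → ℝ} (hμ : IsEquilibriumMeasure V S μ)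
    (h : Set.EqOn V V' S) : IsEquilibriumMeasure V' S μ := by
  have := hμ.1
  refine ⟨hμ.1, hμ.2.1, fun ν hν hνS => ?_⟩
  rw [← energy_congr h hμ.2.1, ← energy_congr h hνS]
  exact hμ.2.2 ν hν hνS

lemma effPotential_congr {V' : ℝ → ℝ} (h : Set.EqOn V V' S) :
    effPotential V S μ = effPotential V' S μ := by
  funext x
  unfold effPotential
  split_ifs with hx
  · rw [h hx]
  · rfl

lemma ExpClose.congr {V' : ℝ → ℝ} {γ : ℕ → ℝ} {η : ℝ} (hS : MeasurableSet S)
    (hS' : MeasurableSet S') (hsub : S' ⊆ S) (h : Set.EqOn V V' S)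
    (hclose : ExpClose γ β V' S S' η) : ExpClose γ β V S S' η := by
  simpa only [ExpClose, correlator, ensemble, partitionFunction, gibbsMeasure_congr hS h,
    gibbsMeasure_congr hS' (h.mono hsub)] using hclose

/-- A part of the domain which is at a positive distance from the equilibrium measure and contains
no minimizer of the effective potential may be removed. -/
theorem exists_expClose (hβ : 0 < β) (hS : IsClosed S) (hconv : Convex ℝ S) {a b : ℝ} (hab : a < b)
    (habS : Set.Icc a b ⊆ S) (hV : ContinuousOn V S) {κ C : ℝ} (hκ : 0 < κ)
    (hconf : ∀ x ∈ S, (1 + κ) * Real.log (1 + |x|) - C ≤ V x / 2)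
    (hμ : IsEquilibriumMeasure V S μ) {M₀ : ℝ} (hμM₀ : ∀ᵐ x ∂μ, |x| ≤ M₀)
    (hS' : MeasurableSet S') (hsub : S' ⊆ S) (hA : IsClosed A) (hAS : A ⊆ S)
    (hdiff : S \ S' ⊆ A) {ε : ℝ} (hε : 0 < ε) (hfar : ∀ x ∈ A, ∀ᵐ ξ ∂μ, ε ≤ |x - ξ|)
    (hmin : ∀ x ∈ A, ¬ ∀ y, effPotential V S μ x ≤ effPotential V S μ y) :
    ∃ η > 0, ExpClose correlatorConst β V S S' η := by
  obtain ⟨W, hW⟩ := ContinuousMap.exists_restrict_eq hS ⟨S.domRestrict V, hV.domRestrict⟩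
  have hVW : Set.EqOn V W S := fun x hx => (DFunLike.congr_fun hW ⟨x, hx⟩).symm
  rw [effPotential_congr hVW] at hmin
  obtain ⟨η, hη, h⟩ := exists_outlier_decay hβ W.continuous hS hconv hab habS hκ
    (fun x hx => hVW hx ▸ hconf x hx) (hμ.congr hVW) hμM₀ hA hAS hε hfar hmin
  exact ⟨η / 2, half_pos hη, ExpClose.congr hS.measurableSet hS' hsub hVW
    (expClose_of_outlier_decay hS ⟨a, habS (Set.left_mem_Icc.2 hab.le)⟩ hS' hsub hdiff hη h)⟩

end Removal

end BetaEnsemble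

theorem mainTheorem6 :
    ∃ γ : ℕ → ℝ, (∀ n, 0 < γ n) ∧
      ∀ (β : ℝ) (_ : 0 < β) (bl br : EReal) (_ : bl < br) (V : ℝ → ℝ)
        (_ : ContinuousOn V (BetaEnsemble.realInterval bl br))
        (_ : bl = ⊥ →
          1 < liminf (fun x : ℝ => ((V x / (2 * Real.log |x|) : ℝ) : EReal)) atBot)
        (_ : br = ⊤ →
          1 < liminf (fun x : ℝ => ((V x / (2 * Real.log |x|) : ℝ) : EReal)) atTop)
        (μeq : Measure ℝ)
        (_ : BetaEnsemble.IsEquilibriumMeasure V (BetaEnsemble.realInterval bl br) μeq)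
        (αl αr : ℝ) (_ : IsLeast μeq.support αl) (_ : IsGreatest μeq.support αr)
        (_ : ∀ x : ℝ,
          (∀ y : ℝ, BetaEnsemble.effPotential V (BetaEnsemble.realInterval bl br) μeq x ≤
            BetaEnsemble.effPotential V (BetaEnsemble.realInterval bl br) μeq y) →
          x ∈ Set.Icc αl αr),
        (bl < (αl : EReal) → ∀ ε : ℝ, 0 < ε → ∃ η : ℝ, 0 < η ∧
          BetaEnsemble.ExpClose γ β V (BetaEnsemble.realInterval bl br)
            (BetaEnsemble.realInterval (max bl ((αl - ε : ℝ) : EReal)) br) η) ∧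
        ((αr : EReal) < br → ∀ ε : ℝ, 0 < ε → ∃ η : ℝ, 0 < η ∧
          BetaEnsemble.ExpClose γ β V (BetaEnsemble.realInterval bl br)
            (BetaEnsemble.realInterval bl (min br ((αr + ε : ℝ) : EReal))) η) := by
  refine ⟨BetaEnsemble.correlatorConst, BetaEnsemble.correlatorConst_pos, ?_⟩
  intro β hβ bl br hb V hV hl hr μ hμ αl αr hαl hαr hmin
  have hS := BetaEnsemble.isClosed_realInterval bl br
  obtain ⟨a, b, hab, habS⟩ := BetaEnsemble.exists_Icc_subset_realInterval hb
  obtain ⟨κ, hκ, C, hconf⟩ := BetaEnsemble.exists_confinement hV hl hr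
  have hμI : ∀ᵐ x ∂μ, x ∈ Set.Icc αl αr :=
    Filter.mem_of_superset Measure.support_mem_ae fun x hx => ⟨hαl.2 hx, hαr.2 hx⟩
  have hμM : ∀ᵐ x ∂μ, |x| ≤ max |αl| |αr| := hμI.mono fun x hx => abs_le_max_abs_abs hx.1 hx.2
  refine ⟨fun _ ε hε => ?_, fun _ ε hε => ?_⟩
  · refine BetaEnsemble.exists_expClose (A := BetaEnsemble.realInterval bl br ∩ Set.Iic (αl - ε))
      hβ hS (BetaEnsemble.convex_realInterval bl br) hab habS hV hκ hconf hμ hμM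
      (BetaEnsemble.isClosed_realInterval _ _).measurableSet ?_ (hS.inter isClosed_Iic)
      Set.inter_subset_left ?_ hε ?_ ?_
    · exact fun x hx => ⟨(le_max_left _ _).trans hx.1, hx.2⟩
    · rintro x ⟨hx, hx'⟩
      refine ⟨hx, not_lt.1 fun h => hx' ⟨max_le hx.1 (EReal.coe_le_coe_iff.2 h.le), hx.2⟩⟩
    · rintro x ⟨-, hx⟩
      rw [Set.mem_Iic] at hx
      filter_upwards [hμI] with ξ hξ
      rw [abs_sub_comm]
      exact le_trans (by linarith [hξ.1]) (le_abs_self _)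
    · rintro x ⟨-, hx⟩ h
      rw [Set.mem_Iic] at hx
      linarith [(hmin x h).1]
  · refine BetaEnsemble.exists_expClose (A := BetaEnsemble.realInterval bl br ∩ Set.Ici (αr + ε))
      hβ hS (BetaEnsemble.convex_realInterval bl br) hab habS hV hκ hconf hμ hμM
      (BetaEnsemble.isClosed_realInterval _ _).measurableSet ?_ (hS.inter isClosed_Ici)
      Set.inter_subset_left ?_ hε ?_ ?_
    · exact fun x hx => ⟨hx.1, hx.2.trans (min_le_left _ _)⟩
    · rintro x ⟨hx, hx'⟩
      refine ⟨hx, not_lt.1 fun h => hx' ⟨hx.1, le_min hx.2 (EReal.coe_le_coe_iff.2 h.le)⟩⟩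
    · rintro x ⟨-, hx⟩
      rw [Set.mem_Ici] at hx
      filter_upwards [hμI] with ξ hξ
      exact le_trans (by linarith [hξ.2]) (le_abs_self _)
    · rintro x ⟨-, hx⟩ h
      rw [Set.mem_Ici] at hx
      linarith [(hmin x h).2]
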